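/- Let $d\ge 1$ and let $\Phi$ be a probability measure on the finite non-negative configurations $\varphi=(\varphi(\mathbf z))_{\mathbf z\in\mathbb Z^d}$ on $\mathbb Z^d$ (finitely supported functions $\mathbb Z^d\to\{0,1,2,\dots\}$). Write $\|\varphi\|=\sum_{\mathbf z}\varphi(\mathbf z)$ and $\|\varphi\|_r=\sum_{\mathbf z}|\mathbf z|^r\varphi(\mathbf z)$, with $|\cdot|$ the $\ell^\infty$-norm, and let $\varphi$ also denote a random configuration with law $\Phi$. Assume that $\Phi$ is irreducible, i.e. no proper subgroup of $\mathbb Z^d$ contains every site $\mathbf z$ with $\mathbb P(\varphi(\mathbf z)>0)>0$, and that $$\mathbb E\big[\|\varphi\|_1^2\big]<\infty,\qquad \mathbb E\big[\|\varphi\|_2\big]<\infty,\qquad \mathbb E\big[\|\varphi\|^2\big]<\infty .$$ Put $\lambda=\mathbb E\|\varphi\|$. Consider the competing urn scheme (two-type annihilating branching random walk) $\mathcal Z(t)=(Z_{\mathbf x}(t))_{\mathbf x\in\mathbb Z^d}$ in the balanced case $p=\tfrac12$. At time $0$ each site contains a single ball, which is red with probability $\tfrac12$ and blue otherwise, independently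 over the sites. Every ball carries an independent unit-rate Poisson clock; when the clock of a ball at $\mathbf z$ rings, the ball stays where it is and new balls of its colour are placed according to an independent copy of $\varphi$ translated by $\mathbf z$; red and blue balls at the same site annihilate immediately one for one. $Z_{\mathbf x}(t)$ is the number of red balls minus the number of blue balls at $\mathbf x$ at time $t$. (The scheme on the infinite lattice is the limit, as $r\to\infty$, of the schemes in which only the initial balls in $[-r,r]^d$ are kept.) Then there exists a constant $c>0$ such that for all $t>1/c$, $$\mathbb P\big(e^{-\lambda t}Z_{\mathbf 0}(t)>c\,t^{-d/4}\big)>c .$$ -/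

import Mathlib

open MeasureTheory ProbabilityTheory Filter Topology
open scoped ENNReal

namespace UrnScheme

/-- The lattice `ℤ^d`; its norm `‖z‖` is the sup norm. -/
abbrev Lattice (d : ℕ) : Type := Fin d → ℤ

/-- Finite non-negative configurations `φ` on `ℤ^d`: the possible offspring of one nucleation. -/
abbrev Offspring (d : ℕ) : Type := Lattice d →₀ ℕ

/-- Finite signed configurations: `ζ z = k > 0` means `k` red balls at `z`, `ζ z = -k < 0` means
`k` blue balls at `z`. -/
abbrev FinConfig (d : ℕ) : Type := Lattice d →₀ ℤ

/-- Arbitrary signed configurations on `ℤ^d`. -/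
abbrev Config (d : ℕ) : Type := Lattice d → ℤ

variable {d : ℕ}

/-! ### The offspring distribution -/

/-- The number of balls `‖φ‖` of an offspring configuration. -/
def size (φ : Offspring d) : ℕ := φ.sum fun _ n => n

/-- The displacement `∑_z |z|^k φ(z)`. -/
noncomputable def displacement (k : ℕ) (φ : Offspring d) : ℝ :=
  φ.sum fun z n => ‖z‖ ^ k * (n : ℝ)

/-- The expectation `E[f(φ)] ∈ [0, ∞]` of a non-negative function of the random offspring
configuration `φ` with law `Φ`. -/
noncomputable def expectation (Φ : PMF (Offspring d)) (f : Offspring d → ℝ) : ℝ≥0∞ :=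
  ∑' φ : Offspring d, Φ φ * ENNReal.ofReal (f φ)

/-- The mean number of children `λ = E‖φ‖`. -/
noncomputable def meanOffspring (Φ : PMF (Offspring d)) : ℝ :=
  (expectation Φ fun φ => (size φ : ℝ)).toReal

/-- `Φ` is irreducible: it is not supported on a proper subgroup of `ℤ^d`, i.e. no proper subgroup
contains all the sites that receive a ball with positive probability. -/
def Irreducible (Φ : PMF (Offspring d)) : Prop :=
  ∀ H : AddSubgroup (Lattice d),
    (∀ φ ∈ Φ.support, ∀ z ∈ φ.support, z ∈ H) → H = ⊤

/-! ### The process started from a finite configuration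

Every ball carries an independent rate one Poisson clock.  When the clock of a ball at `z` rings,
an independent `φ ∼ Φ`, translated by `z`, of balls of the colour of that ball is added, and
balls of opposite colours at the same site annihilate one for one.  In the signed encoding the
annihilation is just addition in `ℤ`. So the process is the continuous time Markov chain on
`FinConfig d` which, for each `z`, at rate `|ζ z|` draws `φ ∼ Φ` and jumps from `ζ` to
`nucleate ζ z φ`. -/

/-- The configuration after a ball at `z` has nucleated with offspring `φ`, all annihilations
included. -/
noncomputable def nucleate (ζ : FinConfig d) (z : Lattice d) (φ : Offspring d) : FinConfig d :=
  ζ + φ.sum fun x n => Finsupp.single (z + x) ((ζ z).sign * (n : ℤ))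

/-- The total number of balls in `ζ`, which is the total rate at which clocks ring. -/
def ballCount (ζ : FinConfig d) : ℕ := ζ.sum fun _ n => n.natAbs

/-- `transitionUpTo Φ n t ζ A` is the probability that the chain started from `ζ` makes at most `n`
nucleations during `[0, t]` and is in `A` at time `t`.  Either no clock rings before time `t`, or
the first ring is at some time `s ≤ t`, is that of each ball at rate one, and the chain
restarts from the configuration after this nucleation. -/
noncomputable def transitionUpTo (Φ : PMF (Offspring d)) :
    ℕ → ℝ → FinConfig d → Set (FinConfig d) → ℝ≥0∞
  | 0, t, ζ, A => ENNReal.ofReal (Real.exp (-(ballCount ζ * t))) * A.indicator 1 ζ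
  | n + 1, t, ζ, A =>
      ENNReal.ofReal (Real.exp (-(ballCount ζ * t))) * A.indicator 1 ζ +
        ∫⁻ s in Set.Icc 0 t, ENNReal.ofReal (Real.exp (-(ballCount ζ * s))) *
          ∑ z ∈ ζ.support, ((ζ z).natAbs : ℝ≥0∞) *
            ∑' φ : Offspring d, Φ φ * transitionUpTo Φ n (t - s) (nucleate ζ z φ) A

/-- The transition probability `P(Z(t, ζ) ∈ A)` of the process started from the finite
configuration `ζ`. -/
noncomputable def transition (Φ : PMF (Offspring d)) (t : ℝ) (ζ : FinConfig d)
    (A : Set (FinConfig d)) : ℝ≥0∞ :=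
  ⨆ n, transitionUpTo Φ n t ζ A

/-! ### The process started from a random Bernoulli colouring of the whole lattice -/

/-- The law of the `p`-random Bernoulli colouring: independently at each site, one red ball with
probability `p`, and otherwise one blue ball. -/
noncomputable def bernoulliColouring (d : ℕ) (p : unitInterval) : Measure (Config d) :=
  Measure.infinitePi fun _ : Lattice d => bernoulliMeasure (1 : ℤ) (-1) p

/-- The restriction of a configuration to the box `[-r, r]^d`. -/
noncomputable def restrictBox (r : ℕ) (ζ : Config d) : FinConfig d :=
  Finsupp.indicator (Finset.Icc (fun _ => -(r : ℤ)) (fun _ => (r : ℤ))) fun z _ => ζ z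

/-- The probability that the process started from the restriction to `[-r, r]^d` of a `p`-random
Bernoulli colouring is in `A` at time `t`. -/
noncomputable def boxProb (Φ : PMF (Offspring d)) (p : unitInterval) (r : ℕ) (t : ℝ)
    (A : Set (FinConfig d)) : ℝ≥0∞ :=
  ∫⁻ ζ, transition Φ t (restrictBox r ζ) A ∂(bernoulliColouring d p)

/-- `ν` is the law at time `t` of the competing urn scheme on `ℤ^d` started from a `p`-random
Bernoulli colouring.  The scheme on the infinite lattice is the limit, as `r → ∞`, of the schemes
started from the restrictions of the colouring to `[-r, r]^d`; thus `ν` is the probability measure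
on configurations for which the joint law of the numbers of balls at any finitely many sites is the
limit of the corresponding joint laws for those. -/
def IsUrnLaw (Φ : PMF (Offspring d)) (p : unitInterval) (t : ℝ) (ν : Measure (Config d)) : Prop :=
  IsProbabilityMeasure ν ∧
    ∀ (F : Finset (Lattice d)) (a : Config d),
      Tendsto (fun r : ℕ => boxProb Φ p r t {η | ∀ x ∈ F, η x = a x}) atTop
        (𝓝 (ν {η | ∀ x ∈ F, η x = a x}))

/-- The law is unique, so that `urnLaw` below involves no choice. -/
theorem IsUrnLaw.unique {Φ : PMF (Offspring d)} {p : unitInterval} {t : ℝ}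
    {ν ν' : Measure (Config d)} (h : IsUrnLaw Φ p t ν) (h' : IsUrnLaw Φ p t ν') : ν = ν' := by
  obtain ⟨_, h⟩ := h
  obtain ⟨_, h'⟩ := h'
  have key : IsProjectiveLimit ν fun F => ν'.map F.restrict := by
    intro F
    refine Measure.ext_of_singleton fun b => ?_
    have hm : Measurable (F.restrict : Config d → _) := by fun_prop
    rw [Measure.map_apply hm (measurableSet_singleton b),
      Measure.map_apply hm (measurableSet_singleton b)]
    classical
    have hs : (F.restrict : Config d → _) ⁻¹' {b} =
        {η | ∀ x ∈ F, η x = (if hx : x ∈ F then b ⟨x, hx⟩ else 0)} := by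
      ext η
      simp only [Set.mem_preimage, Set.mem_singleton_iff, funext_iff, Set.mem_ofPred_eq,
        Subtype.forall, Finset.restrict]
      refine forall_congr' fun x => forall_congr' fun hx => ?_
      simp [hx]
    rw [hs]
    exact tendsto_nhds_unique (h F _) (h' F _)
  have : ∀ F : Finset (Lattice d), IsFiniteMeasure (ν'.map F.restrict) := fun F => inferInstance
  exact key.unique fun F => rfl

open Classical in
/-- The law of the configuration `Z(t)` of the competing urn scheme on `ℤ^d` started from a
`p`-random Bernoulli colouring (the zero measure if there were no such law). -/
noncomputable def urnLaw (Φ : PMF (Offspring d)) (p : unitInterval) (t : ℝ) :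
    Measure (Config d) :=
  if h : ∃ ν, IsUrnLaw Φ p t ν then h.choose else 0

/-- The balanced parameter `p = 1/2`. -/
noncomputable def half : unitInterval := ⟨1 / 2, by norm_num, by norm_num⟩

end UrnScheme

/-!
The idea is to compare the moments of `Z₀(t)`, the number of balls at the origin, with those of a
linear flow. Annihilation in the signed encoding is addition, so the mean of `Z(t)` given the
initial colouring `ζ` is linear in `ζ`: `E[Z₀(t) | ζ] = L(ζ) = ∑ y, w(t, y) ζ(y)`, where
`w(t, ·) = e^{t μ *} δ₀` is the flow of the mean kernel `μ(x) = E[φ(x)]`. For the balanced colouring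
`L` is a Rademacher sum of variance `σ² = ∑ y, w(t, y)²`, and Fourier analysis on the torus shows
that `w(t, y) ≤ C e^{λt} t^{-d/2}` (irreducibility, `exists_flow_le`) and that
`σ² ≥ c e^{2λt} t^{-d/2}` (finiteness of `E‖φ‖₂`, `exists_le_tsum_flow_sq`). By Jensen's inequality
and Khintchine's inequality, `E[Z₀⁺] ≥ E[L⁺] ≥ σ / 4` (`ofReal_lin_flow_le`,
`ofReal_sqrt_le_lintegral_colourSum`). Conversely the nucleations add little variance:
`E[Z₀²] ≤ C e^{2λt} t^{-d/2}` (`semigroup_sq_le`), because the conditional variance is produced by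
the nucleations at rate at most `∑ z, |Z_z| E[‖φ‖ ∑ x, φ(x) w(z + x)] sup w`, and the heat kernel
bound makes this comparable to the bound on `σ²`. The Paley–Zygmund inequality (`paleyZygmund`)
then shows that `Z₀(t)` exceeds a multiple of `e^{λt} t^{-d/4}` with probability bounded below.

All this takes place for the schemes started from boxes, which are honest Markov chains with
countably many states. Their transition probabilities are the minimal solution of a backward
equation, so that moment bounds are obtained by exhibiting explicit supersolutions
(`JumpSystem.semigroup_le`), and lower bounds by a comparison principle
(`JumpSystem.sub_le_super`). For the passage to the infinite lattice, two schemes are coupled so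
that balls of equal colour at the same site nucleate together; the expected number of discrepancies
at a site is bounded by the linear flow (`semigroup_le_add_wnorm`). With tightness and Prokhorov's
theorem this gives the existence of the limiting law (`exists_isUrnLaw`), so that `urnLaw` is not
the junk value `0`, and the bounds pass to the limit (`tendsto_boxProb_origin`).
-/

namespace UrnScheme

open scoped NNReal

/-! ### Minimal semigroups of pure jump chains -/

/-- The data of a continuous time pure jump chain on `S`: in the state `s` the jump labelled `j`
occurs at rate `rate s j` and leads to `move s j`; `total s` is the total jump rate. -/
structure JumpSystem (S J : Type*) where
  rate : S → J → ℝ≥0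
  move : S → J → S
  total : S → ℝ≥0
  hasSum_rate : ∀ s, HasSum (rate s) (total s)

namespace JumpSystem

variable {S J : Type*} (Q : JumpSystem S J)

/-- The jump part of the generator, `F ↦ ∑ⱼ rate s j * F (move s j)`. -/
noncomputable def gen (F : S → ℝ≥0∞) (s : S) : ℝ≥0∞ := ∑' j, (Q.rate s j : ℝ≥0∞) * F (Q.move s j)

/-- The probability of no jump during a time `t`. -/
noncomputable def stay (s : S) (t : ℝ) : ℝ≥0∞ := ENNReal.ofReal (Real.exp (-(Q.total s * t)))

/-- The Duhamel operator `F ↦ ∫₀ᵗ e^{-q(s)(t-u)} (gen F(u))(s) du`, by which the minimal semigroup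
is iterated. -/
noncomputable def duhamel (F : ℝ → S → ℝ≥0∞) (t : ℝ) (s : S) : ℝ≥0∞ :=
  ∫⁻ u in Set.Icc 0 t, Q.stay s (t - u) * Q.gen (F u) s

/-- The expectation of `g` at time `t`, on the event that at most `n` jumps have occurred. -/
noncomputable def upTo (g : S → ℝ≥0∞) : ℕ → ℝ → S → ℝ≥0∞
  | 0 => fun t s => Q.stay s t * g s
  | n + 1 => fun t s => Q.stay s t * g s + Q.duhamel (upTo g n) t s

/-- The minimal semigroup of the chain, applied to `g`. -/
noncomputable def semigroup (g : S → ℝ≥0∞) (t : ℝ) (s : S) : ℝ≥0∞ := ⨆ n, Q.upTo g n t s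

lemma stay_ne_top (s : S) (t : ℝ) : Q.stay s t ≠ ∞ := ENNReal.ofReal_ne_top

lemma stay_sub (s : S) (t u : ℝ) :
    Q.stay s (t - u) = Q.stay s t * ENNReal.ofReal (Real.exp (Q.total s * u)) := by
  rw [stay, stay, ← ENNReal.ofReal_mul (Real.exp_nonneg _), ← Real.exp_add]
  congr 2; ring

lemma gen_mono {F G : S → ℝ≥0∞} (h : ∀ s, F s ≤ G s) (s : S) : Q.gen F s ≤ Q.gen G s :=
  ENNReal.tsum_le_tsum fun j => by gcongr; exact h _

lemma gen_add (F G : S → ℝ≥0∞) (s : S) :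
    Q.gen (fun x => F x + G x) s = Q.gen F s + Q.gen G s := by
  simp only [gen, mul_add, ENNReal.tsum_add]

lemma gen_const_mul (a : ℝ≥0∞) (F : S → ℝ≥0∞) (s : S) :
    Q.gen (fun x => a * F x) s = a * Q.gen F s := by
  simp only [gen, ← ENNReal.tsum_mul_left]
  exact tsum_congr fun j => by ring

lemma gen_tsum {ι : Type*} (F : ι → S → ℝ≥0∞) (s : S) :
    Q.gen (fun x => ∑' i, F i x) s = ∑' i, Q.gen (F i) s := by
  simp only [gen, ← ENNReal.tsum_mul_left]
  exact ENNReal.tsum_comm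

lemma gen_one (s : S) : Q.gen (fun _ => 1) s = Q.total s := by
  simp only [gen, mul_one]
  rw [← (Q.hasSum_rate s).tsum_eq, ENNReal.coe_tsum (Q.hasSum_rate s).summable]

/-- Monotone convergence for the jump part of the generator. -/
lemma gen_iSup {F : ℕ → S → ℝ≥0∞} (hF : Monotone F) (s : S) :
    Q.gen (fun x => ⨆ n, F n x) s = ⨆ n, Q.gen (F n) s := by
  let _ : MeasurableSpace J := ⊤
  simp only [gen, ENNReal.mul_iSup, ← lintegral_count]
  exact lintegral_iSup (fun n => measurable_from_top) fun m n h j => by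
    dsimp only
    gcongr
    exact hF h _

/-- Each `t ↦ duhamel F t s` is a continuous function times a monotone one, hence measurable. -/
lemma measurable_duhamel (F : ℝ → S → ℝ≥0∞) (s : S) : Measurable fun t => Q.duhamel F t s := by
  have : (fun t => Q.duhamel F t s) = fun t => Q.stay s t *
      ∫⁻ u in Set.Icc 0 t, ENNReal.ofReal (Real.exp (Q.total s * u)) * Q.gen (F u) s := by
    funext t
    rw [← lintegral_const_mul' _ _ (Q.stay_ne_top s t)]
    simp only [duhamel, stay_sub, mul_assoc]
  rw [this]
  refine Measurable.mul (by unfold stay; fun_prop) (Monotone.measurable fun a b hab => ?_)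
  exact lintegral_mono_set (Set.Icc_subset_Icc_right hab)

lemma measurable_stay (s : S) : Measurable (Q.stay s) := by unfold stay; fun_prop

lemma measurable_upTo (g : S → ℝ≥0∞) (n : ℕ) (s : S) : Measurable fun t => Q.upTo g n t s := by
  cases n with
  | zero => exact (Q.measurable_stay s).mul_const _
  | succ n => exact ((Q.measurable_stay s).mul_const _).add (Q.measurable_duhamel _ s)

lemma measurable_semigroup (g : S → ℝ≥0∞) (s : S) : Measurable fun t => Q.semigroup g t s :=
  Measurable.iSup fun n => Q.measurable_upTo g n s

lemma duhamel_mono {F G : ℝ → S → ℝ≥0∞} {t : ℝ} (h : ∀ u, 0 ≤ u → u ≤ t → ∀ s, F u s ≤ G u s)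
    (s : S) : Q.duhamel F t s ≤ Q.duhamel G t s := by
  refine setLIntegral_mono' measurableSet_Icc fun u hu => ?_
  gcongr
  exact Q.gen_mono (h u hu.1 hu.2) s

lemma duhamel_const_mul {a : ℝ≥0∞} (ha : a ≠ ∞) (F : ℝ → S → ℝ≥0∞) (t : ℝ) (s : S) :
    Q.duhamel (fun u x => a * F u x) t s = a * Q.duhamel F t s := by
  simp only [duhamel]
  rw [← lintegral_const_mul' _ _ ha]
  refine lintegral_congr fun u => ?_
  rw [gen_const_mul]; ring

section Countable

variable [Countable J]

lemma measurable_gen {F : ℝ → S → ℝ≥0∞} (hF : ∀ s, Measurable fun t => F t s) (s : S) :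
    Measurable fun t => Q.gen (F t) s :=
  Measurable.tsum fun _ => (hF _).const_mul _

lemma measurable_integrand {F : ℝ → S → ℝ≥0∞} (hF : ∀ s, Measurable fun t => F t s) (t : ℝ)
    (s : S) : Measurable fun u => Q.stay s (t - u) * Q.gen (F u) s :=
  ((Q.measurable_stay s).comp (measurable_const.sub measurable_id)).mul (Q.measurable_gen hF s)

lemma duhamel_add {F G : ℝ → S → ℝ≥0∞} (hG : ∀ s, Measurable fun t => G t s) (t : ℝ) (s : S) :
    Q.duhamel (fun u x => F u x + G u x) t s = Q.duhamel F t s + Q.duhamel G t s := by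
  simp only [duhamel, gen_add, mul_add]
  exact lintegral_add_right _ (Q.measurable_integrand hG t s)

lemma duhamel_tsum {ι : Type*} [Countable ι] {F : ι → ℝ → S → ℝ≥0∞}
    (hF : ∀ i s, Measurable fun t => F i t s) (t : ℝ) (s : S) :
    Q.duhamel (fun u x => ∑' i, F i u x) t s = ∑' i, Q.duhamel (F i) t s := by
  simp only [duhamel, gen_tsum, ← ENNReal.tsum_mul_left]
  exact lintegral_tsum fun i => (Q.measurable_integrand (hF i) t s).aemeasurable

lemma duhamel_iSup {F : ℕ → ℝ → S → ℝ≥0∞} (hF : ∀ n s, Measurable fun t => F n t s)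
    (hmono : ∀ u, Monotone fun n => F n u) (t : ℝ) (s : S) :
    Q.duhamel (fun u x => ⨆ n, F n u x) t s = ⨆ n, Q.duhamel (F n) t s := by
  simp only [duhamel]
  rw [← lintegral_iSup (fun n => Q.measurable_integrand (hF n) t s)]
  · refine lintegral_congr fun u => ?_
    rw [Q.gen_iSup (hmono u), ENNReal.mul_iSup]
  · intro m n h u
    dsimp only
    gcongr
    exact Q.gen_mono (fun x => hmono u h x) s

end Countable

lemma upTo_le_succ (g : S → ℝ≥0∞) (n : ℕ) (t : ℝ) (s : S) :
    Q.upTo g n t s ≤ Q.upTo g (n + 1) t s := by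
  induction n generalizing t s with
  | zero => exact le_self_add
  | succ n ih =>
    simp only [upTo]
    exact add_le_add le_rfl (Q.duhamel_mono (fun u _ _ x => ih u x) s)

lemma monotone_upTo (g : S → ℝ≥0∞) (t : ℝ) : Monotone fun n => Q.upTo g n t :=
  monotone_nat_of_le_succ fun n s => Q.upTo_le_succ g n t s

/-- The semigroup solves the backward equation in integrated form. -/
lemma semigroup_eq [Countable J] (g : S → ℝ≥0∞) (t : ℝ) (s : S) :
    Q.semigroup g t s = Q.stay s t * g s + Q.duhamel (Q.semigroup g) t s := by
  have h : Q.duhamel (Q.semigroup g) t s = ⨆ n, Q.duhamel (Q.upTo g n) t s :=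
    Q.duhamel_iSup (Q.measurable_upTo g) (Q.monotone_upTo g) t s
  rw [h, ENNReal.add_iSup]
  refine le_antisymm (iSup_le fun n => ?_) (iSup_le fun n => le_iSup_of_le (n + 1) le_rfl)
  exact (Q.upTo_le_succ g n t s).trans (le_iSup_of_le n le_rfl)

/-- The semigroup is the least non-negative supersolution of the backward equation. -/
lemma semigroup_le {g : S → ℝ≥0∞} {W : ℝ → S → ℝ≥0∞}
    (hW : ∀ t, 0 ≤ t → ∀ s, Q.stay s t * g s + Q.duhamel W t s ≤ W t s) {t : ℝ} (ht : 0 ≤ t)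
    (s : S) : Q.semigroup g t s ≤ W t s := by
  refine iSup_le fun n => ?_
  induction n generalizing t s with
  | zero => exact le_self_add.trans (hW t ht s)
  | succ n ih =>
    refine le_trans ?_ (hW t ht s)
    simp only [upTo]
    exact add_le_add le_rfl (Q.duhamel_mono (fun u hu _ x => ih hu x) s)

lemma semigroup_mono {g h : S → ℝ≥0∞} (hgh : ∀ s, g s ≤ h s) (t : ℝ) (s : S) :
    Q.semigroup g t s ≤ Q.semigroup h t s := by
  refine iSup_mono fun n => ?_
  induction n generalizing t s with
  | zero => exact mul_le_mul_right (hgh s) _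
  | succ n ih =>
    simp only [upTo]
    exact add_le_add (mul_le_mul_right (hgh s) _) (Q.duhamel_mono (fun u _ _ x => ih u x) s)

lemma semigroup_const_mul {a : ℝ≥0∞} (ha : a ≠ ∞) (g : S → ℝ≥0∞) (t : ℝ) (s : S) :
    Q.semigroup (fun x => a * g x) t s = a * Q.semigroup g t s := by
  simp only [semigroup, ENNReal.mul_iSup]
  congr 1
  funext n
  induction n generalizing t s with
  | zero => simp only [upTo]; ring
  | succ n ih =>
    simp only [upTo, mul_add]
    rw [← Q.duhamel_const_mul ha, show Q.upTo (fun x => a * g x) n =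
      fun u x => a * Q.upTo g n u x by funext u x; exact ih u x]
    ring

/-- The semigroup is countably additive. -/
lemma semigroup_tsum [Countable J] {ι : Type*} [Countable ι] (g : ι → S → ℝ≥0∞) (t : ℝ) (s : S) :
    Q.semigroup (fun x => ∑' i, g i x) t s = ∑' i, Q.semigroup (g i) t s := by
  have h : ∀ n t s, Q.upTo (fun x => ∑' i, g i x) n t s = ∑' i, Q.upTo (g i) n t s := by
    intro n
    induction n with
    | zero => intro t s; simp only [upTo, ENNReal.tsum_mul_left]
    | succ n ih =>
      intro t s
      simp only [upTo, ENNReal.tsum_add, ENNReal.tsum_mul_left]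
      rw [← Q.duhamel_tsum (fun i => Q.measurable_upTo (g i) n)]
      congr 2
      funext u x; exact ih u x
  simp only [semigroup, h]
  let _ : MeasurableSpace ι := ⊤
  simp only [← lintegral_count]
  exact (lintegral_iSup (fun n => measurable_from_top)
    fun m n hmn i => Q.monotone_upTo (g i) t hmn s).symm

lemma semigroup_add [Countable J] (g h : S → ℝ≥0∞) (t : ℝ) (s : S) :
    Q.semigroup (fun x => g x + h x) t s = Q.semigroup g t s + Q.semigroup h t s := by
  have := Q.semigroup_tsum (fun b : Bool => if b then g else h) t s
  simpa [tsum_bool, add_comm] using this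

/-- **Comparison principle.** A subsolution `U` lies below a supersolution `W` with the same initial
value, provided that `U ≤ K` for some `K` such that the sum over `n ≥ 1` of the expectations of `K`
right after the `n`-th jump is finite, as is ensured by the function `V`. -/
theorem sub_le_super [Countable J] {g : S → ℝ≥0∞} {U W K V : ℝ → S → ℝ≥0∞}
    (hU : ∀ t, 0 ≤ t → ∀ s, U t s ≤ Q.stay s t * g s + Q.duhamel U t s)
    (hW : ∀ t, 0 ≤ t → ∀ s, Q.stay s t * g s + Q.duhamel W t s ≤ W t s)
    (hUK : ∀ t, 0 ≤ t → ∀ s, U t s ≤ K t s) (hK : ∀ s, Measurable fun t => K t s)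
    (hV : ∀ t, 0 ≤ t → ∀ s, Q.duhamel (fun u x => K u x + V u x) t s ≤ V t s)
    (hfin : ∀ t s, V t s ≠ ∞) {t : ℝ} (ht : 0 ≤ t) (s : S) : U t s ≤ W t s := by
  -- `κ n` is the expectation of `K` right after the `n`-th jump
  let κ : ℕ → ℝ → S → ℝ≥0∞ := fun n => Nat.rec K (fun _ F => Q.duhamel F) n
  have hκm : ∀ n s, Measurable fun t => κ n t s := by
    intro n
    cases n with
    | zero => exact hK
    | succ n => exact fun s => Q.measurable_duhamel _ s
  have hsum : ∀ n t, 0 ≤ t → ∀ s, ∑ i ∈ Finset.range n, κ (i + 1) t s ≤ V t s := by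
    intro n
    induction n with
    | zero => simp
    | succ n ih =>
      intro t ht s
      refine le_trans ?_ (hV t ht s)
      have h : ∑ i ∈ Finset.range (n + 1), κ (i + 1) t s
          = Q.duhamel (fun u x => ∑ i ∈ Finset.range (n + 1), κ i u x) t s := by
        have := Q.duhamel_tsum (F := fun i : Finset.range (n + 1) => κ i) (fun i => hκm i) t s
        simp only [tsum_fintype] at this
        rw [Finset.sum_coe_sort (Finset.range (n + 1)) (fun i => Q.duhamel (κ i) t s)] at this
        rw [← this]
        congr 1
        funext u x
        exact Finset.sum_coe_sort (Finset.range (n + 1)) (fun i => κ i u x)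
      rw [h]
      refine Q.duhamel_mono (fun u hu _ x => ?_) s
      rw [Finset.sum_range_succ', add_comm]
      gcongr
      · exact le_rfl
      · exact ih u hu x
  -- `U` exceeds `W` at most by the part of `K` after `n` jumps, which is summable in `n`
  have hle : ∀ n t, 0 ≤ t → ∀ s, U t s ≤ W t s + κ n t s := by
    intro n
    induction n with
    | zero => exact fun t ht s => (hUK t ht s).trans le_add_self
    | succ n ih =>
      intro t ht s
      calc U t s ≤ Q.stay s t * g s + Q.duhamel U t s := hU t ht s
        _ ≤ Q.stay s t * g s + Q.duhamel (fun u x => W u x + κ n u x) t s := by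
          gcongr
          exact Q.duhamel_mono (fun u hu _ x => ih u hu x) s
        _ = Q.stay s t * g s + Q.duhamel W t s + κ (n + 1) t s := by
          rw [Q.duhamel_add (hκm n), add_assoc]
        _ ≤ W t s + κ (n + 1) t s := by gcongr; exact hW t ht s
  have hlim : Tendsto (fun n => κ (n + 1) t s) atTop (𝓝 0) := by
    refine ENNReal.tendsto_atTop_zero_of_tsum_ne_top (ne_top_of_le_ne_top (hfin t s) ?_)
    rw [ENNReal.tsum_eq_iSup_nat]
    exact iSup_le fun n => hsum n t ht s
  have := (tendsto_const_nhds (x := W t s)).add hlim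
  rw [add_zero] at this
  exact ge_of_tendsto' this fun n => hle (n + 1) t ht s

/-! ### Differential criteria for sub- and supersolutions -/

/-- Variation of constants for `y' + q y`. -/
lemma integral_exp_mul_deriv_add {q t : ℝ} (ht : 0 ≤ t) {y D : ℝ → ℝ}
    (hy : ContinuousOn y (Set.Icc 0 t)) (hd : ∀ u ∈ Set.Ioo 0 t, HasDerivAt y (D u) u)
    (hD : ContinuousOn D (Set.Icc 0 t)) :
    ∫ u in Set.Icc 0 t, Real.exp (-(q * (t - u))) * (D u + q * y u)
      = y t - Real.exp (-(q * t)) * y 0 := by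
  have hc : ContinuousOn (fun u => Real.exp (-(q * (t - u)))) (Set.Icc 0 t) := by fun_prop
  rw [integral_Icc_eq_integral_Ioc, ← intervalIntegral.integral_of_le ht,
    intervalIntegral.integral_eq_sub_of_hasDerivAt_of_le ht (hc.mul hy)
      (f' := fun u => Real.exp (-(q * (t - u))) * (D u + q * y u))]
  · simp
  · intro u hu
    have h1 : HasDerivAt (fun u => Real.exp (-(q * (t - u))))
        (Real.exp (-(q * (t - u))) * q) u := by
      have := (((hasDerivAt_id u).const_sub t).const_mul q).neg.exp
      simpa using this
    refine (h1.mul (hd u hu)).congr_deriv ?_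
    ring
  · refine ContinuousOn.intervalIntegrable ?_
    rw [Set.uIcc_of_le ht]
    exact hc.mul (hD.add (hy.const_smul q))

/-- A differentiable `W` with `gen F ≤ ∂ₜ W + q W` dominates the Duhamel integral of `F`. For
`F = W` this says that `W` is a supersolution of the backward equation. -/
lemma super_of_hasDerivAt {W D : ℝ → S → ℝ} {F : ℝ → S → ℝ≥0∞}
    (hd : ∀ t, 0 ≤ t → ∀ s, HasDerivAt (fun u => W u s) (D t s) t)
    (hD : ∀ s, ContinuousOn (fun t => D t s) (Set.Ici 0))
    (hW0 : ∀ s, 0 ≤ W 0 s) (hnn : ∀ t, 0 ≤ t → ∀ s, 0 ≤ D t s + Q.total s * W t s)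
    (hG : ∀ t, 0 ≤ t → ∀ s,
      Q.gen (F t) s ≤ ENNReal.ofReal (D t s + Q.total s * W t s))
    {t : ℝ} (ht : 0 ≤ t) (s : S) :
    Q.stay s t * ENNReal.ofReal (W 0 s) + Q.duhamel F t s
      ≤ ENNReal.ofReal (W t s) := by
  have hyc : ContinuousOn (fun u => W u s) (Set.Icc 0 t) :=
    fun u hu => (hd u hu.1 s).continuousAt.continuousWithinAt
  have hDc : ContinuousOn (fun u => D u s) (Set.Icc 0 t) := (hD s).mono Set.Icc_subset_Ici_self
  have hid := integral_exp_mul_deriv_add (q := Q.total s) ht hyc (fun u hu => hd u hu.1.le s) hDc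
  have hle : Q.duhamel F t s ≤
      ENNReal.ofReal (W t s - Real.exp (-(Q.total s * t)) * W 0 s) := by
    rw [← hid, ofReal_integral_eq_lintegral_ofReal]
    · refine setLIntegral_mono' measurableSet_Icc fun u hu => ?_
      rw [ENNReal.ofReal_mul (Real.exp_nonneg _)]
      exact mul_le_mul_right (hG u hu.1 s) _
    · refine ContinuousOn.integrableOn_Icc ?_
      exact ContinuousOn.mul (by fun_prop) (hDc.add (hyc.const_smul (Q.total s : ℝ)))
    · refine (ae_restrict_iff' measurableSet_Icc).2 (ae_of_all _ fun u hu => ?_)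
      exact mul_nonneg (Real.exp_nonneg _) (hnn u hu.1 s)
  have h0 : 0 ≤ W t s - Real.exp (-(Q.total s * t)) * W 0 s := by
    rw [← hid]
    refine setIntegral_nonneg measurableSet_Icc fun u hu => ?_
    exact mul_nonneg (Real.exp_nonneg _) (hnn u hu.1 s)
  calc _ ≤ ENNReal.ofReal (Real.exp (-(Q.total s * t)) * W 0 s) +
        ENNReal.ofReal (W t s - Real.exp (-(Q.total s * t)) * W 0 s) := by
        rw [ENNReal.ofReal_mul (Real.exp_nonneg _)]
        exact add_le_add le_rfl hle
    _ = ENNReal.ofReal (W t s) := by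
        rw [← ENNReal.ofReal_add (mul_nonneg (Real.exp_nonneg _) (hW0 s)) h0]
        congr 1; ring

/-- The positive part of a differentiable `U` with `∂ₜ U + q U ≤ gen U⁺` is a subsolution of the
backward equation. -/
lemma sub_of_hasDerivAt {U D : ℝ → S → ℝ}
    (hc : ∀ s, ContinuousOn (fun t => U t s) (Set.Ici 0))
    (hd : ∀ t, 0 < t → ∀ s, HasDerivAt (fun u => U u s) (D t s) t)
    (hD : ∀ s, ContinuousOn (fun t => D t s) (Set.Ici 0))
    (hG : ∀ t, 0 ≤ t → ∀ s,
      ENNReal.ofReal (D t s + Q.total s * U t s) ≤ Q.gen (fun x => ENNReal.ofReal (U t x)) s)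
    {t : ℝ} (ht : 0 ≤ t) (s : S) :
    ENNReal.ofReal (U t s) ≤
      Q.stay s t * ENNReal.ofReal (U 0 s) + Q.duhamel (fun u x => ENNReal.ofReal (U u x)) t s := by
  have hyc : ContinuousOn (fun u => U u s) (Set.Icc 0 t) := (hc s).mono Set.Icc_subset_Ici_self
  have hDc : ContinuousOn (fun u => D u s) (Set.Icc 0 t) := (hD s).mono Set.Icc_subset_Ici_self
  have hid := integral_exp_mul_deriv_add (q := Q.total s) ht hyc (fun u hu => hd u hu.1 s) hDc
  set f : ℝ → ℝ := fun u => Real.exp (-(Q.total s * (t - u))) * (D u s + Q.total s * U u s)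
  have hf : IntegrableOn f (Set.Icc 0 t) := by
    refine ContinuousOn.integrableOn_Icc ?_
    exact ContinuousOn.mul (by fun_prop) (hDc.add (hyc.const_smul (Q.total s : ℝ)))
  have hle : ENNReal.ofReal (∫ u in Set.Icc 0 t, f u) ≤
      Q.duhamel (fun u x => ENNReal.ofReal (U u x)) t s := by
    calc ENNReal.ofReal (∫ u in Set.Icc 0 t, f u)
        ≤ ENNReal.ofReal (∫ u in Set.Icc 0 t, max (f u) 0) :=
          ENNReal.ofReal_le_ofReal (integral_mono hf hf.pos_part fun u => le_max_left _ _)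
      _ = ∫⁻ u in Set.Icc 0 t, ENNReal.ofReal (max (f u) 0) :=
          ofReal_integral_eq_lintegral_ofReal hf.pos_part (ae_of_all _ fun u => le_max_right _ _)
      _ ≤ _ := by
          refine setLIntegral_mono' measurableSet_Icc fun u hu => ?_
          rw [ENNReal.ofReal_max, ENNReal.ofReal_zero, max_eq_left (by simp),
            ENNReal.ofReal_mul (Real.exp_nonneg _)]
          exact mul_le_mul_right (hG u hu.1 s) _
  calc ENNReal.ofReal (U t s)
      = ENNReal.ofReal (Real.exp (-(Q.total s * t)) * U 0 s + ∫ u in Set.Icc 0 t, f u) := by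
        rw [hid]; congr 1; ring
    _ ≤ ENNReal.ofReal (Real.exp (-(Q.total s * t)) * U 0 s) +
        ENNReal.ofReal (∫ u in Set.Icc 0 t, f u) := ENNReal.ofReal_add_le
    _ ≤ _ := by
        rw [ENNReal.ofReal_mul (Real.exp_nonneg _)]
        exact add_le_add le_rfl hle

/-! ### Differentiability of the semigroup on bounded functions -/

lemma one_super {t : ℝ} (ht : 0 ≤ t) (s : S) :
    Q.stay s t * 1 + Q.duhamel (fun _ _ => 1) t s ≤ 1 := by
  have := Q.super_of_hasDerivAt (W := fun _ _ => 1) (D := fun _ _ => 0) (F := fun _ _ => 1)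
    (fun _ _ _ => hasDerivAt_const _ _) (fun _ => continuousOn_const) (by simp) (by simp)
    (fun _ _ _ => by simp [gen_one]) ht s
  simpa using this

lemma semigroup_le_one {g : S → ℝ≥0∞} (hg : ∀ s, g s ≤ 1) {t : ℝ} (ht : 0 ≤ t) (s : S) :
    Q.semigroup g t s ≤ 1 :=
  Q.semigroup_le (W := fun _ _ => 1)
    (fun _ ht s => (add_le_add (mul_le_mul_right (hg s) _) le_rfl).trans (Q.one_super ht s)) ht s

lemma summable_rate_mul {F : S → ℝ} (h1 : ∀ s, |F s| ≤ 1) (s : S) :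
    Summable fun j => (Q.rate s j : ℝ) * F (Q.move s j) := by
  refine Summable.of_norm_bounded (NNReal.summable_coe.2 (Q.hasSum_rate s).summable) fun j => ?_
  rw [norm_mul, Real.norm_of_nonneg (Q.rate s j).coe_nonneg]
  exact mul_le_of_le_one_right (Q.rate s j).coe_nonneg (h1 _)

lemma gen_ofReal {F : S → ℝ} (h0 : ∀ s, 0 ≤ F s) (h1 : ∀ s, F s ≤ 1) (s : S) :
    Q.gen (fun x => ENNReal.ofReal (F x)) s =
      ENNReal.ofReal (∑' j, (Q.rate s j : ℝ) * F (Q.move s j)) := by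
  rw [ENNReal.ofReal_tsum_of_nonneg (fun j => mul_nonneg (Q.rate s j).coe_nonneg (h0 _))
    (Q.summable_rate_mul (fun s => abs_le.2 ⟨by linarith [h0 s], h1 s⟩) s)]
  refine tsum_congr fun j => ?_
  rw [ENNReal.ofReal_mul (Q.rate s j).coe_nonneg, ENNReal.ofReal_coe_nnreal]

/-- On a bounded function the semigroup is real valued and continuous in time, and it solves the
backward equation. -/
lemma exists_real_semigroup [Countable J] {g : S → ℝ≥0∞} (hg : ∀ s, g s ≤ 1) :
    ∃ F D : ℝ → S → ℝ, (∀ t, 0 ≤ t → ∀ s, Q.semigroup g t s = ENNReal.ofReal (F t s)) ∧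
      (∀ t s, 0 ≤ F t s) ∧ (∀ t, 0 ≤ t → ∀ s, F t s ≤ 1) ∧
      (∀ s, ContinuousOn (fun t => F t s) (Set.Ici 0)) ∧
      (∀ s, ContinuousOn (fun t => D t s) (Set.Ici 0)) ∧
      (∀ t, 0 < t → ∀ s, HasDerivAt (fun u => F u s) (D t s) t) ∧
      ∀ t, 0 ≤ t → ∀ s, D t s = ∑' j, (Q.rate s j : ℝ) * F t (Q.move s j) - Q.total s * F t s := by
  let F : ℝ → S → ℝ := fun t s => (Q.semigroup g t s).toReal
  have hle : ∀ t, 0 ≤ t → ∀ s, Q.semigroup g t s ≤ 1 := fun t ht s => Q.semigroup_le_one hg ht s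
  have hF : ∀ t, 0 ≤ t → ∀ s, Q.semigroup g t s = ENNReal.ofReal (F t s) := fun t ht s =>
    (ENNReal.ofReal_toReal (ne_top_of_le_ne_top ENNReal.one_ne_top (hle t ht s))).symm
  have hF0 : ∀ t s, 0 ≤ F t s := fun t s => ENNReal.toReal_nonneg
  have hF1 : ∀ t, 0 ≤ t → ∀ s, F t s ≤ 1 := fun t ht s =>
    ENNReal.toReal_le_of_le_ofReal zero_le_one (by simpa using hle t ht s)
  have hFm : ∀ s, Measurable fun t => F t s := fun s => (Q.measurable_semigroup g s).ennreal_toReal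
  let h : ℝ → S → ℝ := fun t s => ∑' j, (Q.rate s j : ℝ) * F t (Q.move s j)
  have hFabs : ∀ t, 0 ≤ t → ∀ s, |F t s| ≤ 1 := fun t ht s =>
    abs_le.2 ⟨by linarith [hF0 t s], hF1 t ht s⟩
  have hgen : ∀ t, 0 ≤ t → ∀ s, Q.gen (Q.semigroup g t) s = ENNReal.ofReal (h t s) := by
    intro t ht s
    rw [← Q.gen_ofReal (hF0 t) (hF1 t ht) s]
    congr 1
    funext x; exact hF t ht x
  have hh0 : ∀ t s, 0 ≤ h t s := fun t s => tsum_nonneg fun j =>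
    mul_nonneg (Q.rate s j).coe_nonneg (hF0 _ _)
  have hh1 : ∀ t, 0 ≤ t → ∀ s, h t s ≤ Q.total s := by
    intro t ht s
    have h2 := NNReal.hasSum_coe.2 (Q.hasSum_rate s)
    rw [← h2.tsum_eq]
    exact (Q.summable_rate_mul (hFabs t ht) s).tsum_le_tsum
      (fun j => mul_le_of_le_one_right (Q.rate s j).coe_nonneg (hF1 t ht _)) h2.summable
  have hhm : ∀ s, Measurable fun t => h t s := by
    intro s
    have : (fun t => (∑' j, (Q.rate s j : ℝ≥0∞) * ENNReal.ofReal (F t (Q.move s j))).toReal) =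
        fun t => h t s := by
      funext t
      rw [ENNReal.tsum_toReal_eq fun j => ENNReal.mul_ne_top ENNReal.coe_ne_top
        ENNReal.ofReal_ne_top]
      refine tsum_congr fun j => ?_
      rw [ENNReal.toReal_mul, ENNReal.toReal_ofReal (hF0 _ _), ENNReal.coe_toReal]
    rw [← this]
    exact (Measurable.tsum fun j => ((hFm _).ennreal_ofReal).const_mul _).ennreal_toReal
  let k : S → ℝ → ℝ := fun s u => Real.exp (Q.total s * u) * h u s
  have hki : ∀ s a, 0 ≤ a → IntervalIntegrable (k s) volume 0 a := by
    intro s a ha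
    rw [intervalIntegrable_iff_integrableOn_Icc_of_le ha]
    refine Measure.integrableOn_of_bounded (M := Real.exp (Q.total s * a) * Q.total s)
      (by simp) (Measurable.aestronglyMeasurable (by unfold k; have := hhm s; fun_prop)) ?_
    refine (ae_restrict_iff' measurableSet_Icc).2 (ae_of_all _ fun u hu => ?_)
    rw [Real.norm_of_nonneg (mul_nonneg (Real.exp_nonneg _) (hh0 _ _))]
    gcongr
    · exact hu.2
    · exact hh1 u hu.1 s
  -- the backward equation, multiplied by `e^{qt}`, exhibits `F` as a primitive
  have hrep : ∀ t, 0 ≤ t → ∀ s,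
      F t s = Real.exp (-(Q.total s * t)) * ((g s).toReal + ∫ u in (0 : ℝ)..t, k s u) := by
    intro t ht s
    have hgf : g s ≠ ∞ := ne_top_of_le_ne_top ENNReal.one_ne_top (hg s)
    have h0 : 0 ≤ ∫ u in (0 : ℝ)..t, k s u :=
      intervalIntegral.integral_nonneg ht fun u _ => mul_nonneg (Real.exp_nonneg _) (hh0 _ _)
    have : Q.semigroup g t s = ENNReal.ofReal
        (Real.exp (-(Q.total s * t)) * ((g s).toReal + ∫ u in (0 : ℝ)..t, k s u)) := by
      rw [Q.semigroup_eq, mul_add, ENNReal.ofReal_add (by positivity) (by positivity),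
        ENNReal.ofReal_mul (Real.exp_nonneg _), ENNReal.ofReal_mul (Real.exp_nonneg _),
        ENNReal.ofReal_toReal hgf]
      congr 1
      rw [intervalIntegral.integral_of_le ht, ← integral_Icc_eq_integral_Ioc,
        ofReal_integral_eq_lintegral_ofReal
          ((intervalIntegrable_iff_integrableOn_Icc_of_le ht).1 (hki s t ht))
          (ae_of_all _ fun u => mul_nonneg (Real.exp_nonneg _) (hh0 _ _)),
        ← lintegral_const_mul' _ _ ENNReal.ofReal_ne_top, duhamel]
      refine setLIntegral_congr_fun measurableSet_Icc fun u hu => ?_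
      rw [hgen u hu.1 s, stay_sub, ENNReal.ofReal_mul (Real.exp_nonneg _), mul_assoc]
      rfl
    change (Q.semigroup g t s).toReal = _
    rw [this, ENNReal.toReal_ofReal (by positivity)]
  have hcont : ∀ s, ContinuousOn (fun t => F t s) (Set.Ici 0) := by
    intro s t ht
    have h1 : ContinuousOn (fun t => Real.exp (-(Q.total s * t)) *
        ((g s).toReal + ∫ u in (0 : ℝ)..t, k s u)) (Set.Icc 0 (t + 1)) := by
      refine ContinuousOn.mul (by fun_prop) (continuousOn_const.add ?_)
      have := intervalIntegral.continuousOn_primitive_interval' (hki s (t + 1) (by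
        have : (0 : ℝ) ≤ t := ht
        linarith)) (a := 0) (by simp)
      rwa [Set.uIcc_of_le (by have : (0 : ℝ) ≤ t := ht; linarith)] at this
    have h2 : ContinuousOn (fun t => F t s) (Set.Icc 0 (t + 1)) :=
      h1.congr fun u hu => hrep u hu.1 s
    refine (h2 t ⟨ht, by linarith⟩).mono_of_mem_nhdsWithin ?_
    exact inter_mem_nhdsWithin _ (Iic_mem_nhds (by linarith))
  have hhc : ∀ s, ContinuousOn (fun t => h t s) (Set.Ici 0) := by
    intro s
    refine continuousOn_tsum (fun j => (hcont _).const_smul (Q.rate s j : ℝ))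
      (NNReal.summable_coe.2 (Q.hasSum_rate s).summable) fun j t ht => ?_
    rw [norm_mul, Real.norm_of_nonneg (Q.rate s j).coe_nonneg]
    exact mul_le_of_le_one_right (Q.rate s j).coe_nonneg (hFabs t ht _)
  refine ⟨F, fun t s => h t s - Q.total s * F t s, hF, hF0, hF1, hcont,
    fun s => (hhc s).sub ((hcont s).const_smul (Q.total s : ℝ)), ?_, fun t _ s => rfl⟩
  intro t ht s
  have hkc : ContinuousAt (k s) t :=
    ContinuousAt.mul (by fun_prop) ((hhc s).continuousAt (Ici_mem_nhds ht))
  have hd : HasDerivAt (fun t => ∫ u in (0 : ℝ)..t, k s u) (k s t) t :=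
    intervalIntegral.integral_hasDerivAt_right (hki s t ht.le)
      (Measurable.stronglyMeasurable (by
        unfold k; have := hhm s; fun_prop)).stronglyMeasurableAtFilter
      hkc
  have he : HasDerivAt (fun t => Real.exp (-(Q.total s * t)))
      (-(Real.exp (-(Q.total s * t)) * Q.total s)) t := by
    have := ((hasDerivAt_id t).const_mul (Q.total s : ℝ)).neg.exp
    simpa using this
  have hd2 := he.mul (hd.const_add (g s).toReal)
  have heq : (fun u => F u s) =ᶠ[𝓝 t] fun u => Real.exp (-(Q.total s * u)) *
      ((g s).toReal + ∫ v in (0 : ℝ)..u, k s v) := by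
    filter_upwards [Ici_mem_nhds ht] with u hu using hrep u hu s
  refine (hd2.congr_of_eventuallyEq heq).congr_deriv ?_
  beta_reduce
  rw [hrep t ht.le s]
  have : Real.exp (-(Q.total s * t)) * k s t = h t s := by
    change _ * (_ * _) = _
    rw [← mul_assoc, ← Real.exp_add]; simp
  rw [this]; ring

end JumpSystem

/-! ### The linear flow generated by a summable kernel -/

section Flow

variable {G : Type*} [AddCommGroup G]

/-- The convolution operator `h ↦ (y ↦ ∑ₓ μ x * h (y + x))`. -/
noncomputable def conv (μ h : G → ℝ) (y : G) : ℝ := ∑' x, μ x * h (y + x)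

/-- The solution `w(t) = exp(t * conv μ) h` of `w' = conv μ w`, `w(0) = h`. -/
noncomputable def flow (μ h : G → ℝ) (t : ℝ) (y : G) : ℝ :=
  ∑' n : ℕ, t ^ n / n.factorial * ((conv μ)^[n] h) y

lemma summable_expSeries {a : ℕ → ℝ} {B r : ℝ} (ha : ∀ n, |a n| ≤ r ^ n * B) (t : ℝ) :
    Summable fun n : ℕ => t ^ n / n.factorial * a n := by
  refine Summable.of_norm_bounded ((Real.summable_pow_div_factorial (|t| * r)).mul_right B)
    fun n => ?_
  rw [norm_mul, norm_div, norm_pow, Real.norm_eq_abs, Real.norm_natCast, Real.norm_eq_abs, mul_pow]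
  calc |t| ^ n / n.factorial * |a n| ≤ |t| ^ n / n.factorial * (r ^ n * B) := by gcongr; exact ha n
    _ = _ := by ring

/-- Termwise differentiation of an exponential generating function. -/
lemma hasDerivAt_expSeries {a : ℕ → ℝ} {B r : ℝ} (ha : ∀ n, |a n| ≤ r ^ n * B)
    (t : ℝ) : HasDerivAt (fun t => ∑' n : ℕ, t ^ n / n.factorial * a n)
      (∑' n : ℕ, t ^ n / n.factorial * a (n + 1)) t := by
  set R := |t| + 1
  have hB : 0 ≤ B := by simpa using (abs_nonneg _).trans (ha 0)
  have key := hasDerivAt_tsum_of_isPreconnected (𝕜 := ℝ) (F := ℝ)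
    (g := fun (n : ℕ) t => t ^ n / n.factorial * a n)
    (g' := fun (n : ℕ) t => (n : ℝ) * t ^ (n - 1) / n.factorial * a n)
    (u := fun (n : ℕ) => (n : ℝ) * R ^ (n - 1) / n.factorial * (r ^ n * B)) (t := Metric.ball 0 R)
    (y₀ := 0) (y := t) ?_ Metric.isOpen_ball (convex_ball _ _).isPreconnected ?_ ?_ ?_ ?_ ?_
  · refine key.congr_deriv ?_
    have hs : Summable fun n : ℕ => (n : ℝ) * t ^ (n - 1) / n.factorial * a n := by
      rw [← summable_nat_add_iff 1]
      refine (summable_expSeries (a := fun n => a (n + 1)) (B := r * B) (r := r)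
        (fun n => (ha (n + 1)).trans_eq (by ring)) t).congr fun n => ?_
      rw [Nat.factorial_succ]; push_cast
      field_simp
    rw [hs.tsum_eq_zero_add]
    simp only [Nat.cast_zero, zero_mul, zero_div, zero_add]
    refine tsum_congr fun n => ?_
    rw [Nat.factorial_succ]; push_cast
    field_simp
  · rw [← summable_nat_add_iff 1]
    refine ((Real.summable_pow_div_factorial (R * r)).mul_right (r * B)).congr fun n => ?_
    rw [Nat.factorial_succ, mul_pow]; push_cast
    field_simp
    ring
  · intro n s _
    exact ((hasDerivAt_pow n s).div_const _).mul_const _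
  · intro n s hs
    rw [norm_mul, norm_div, norm_mul, norm_pow, Real.norm_natCast, Real.norm_natCast]
    have : ‖s‖ ≤ R := by simpa using (Metric.mem_ball.1 hs).le
    gcongr
    exact ha n
  · simp [R]; positivity
  · exact summable_expSeries ha 0
  · simp [R]

variable {μ ν h : G → ℝ} {lam B kap : ℝ}

lemma summable_conv (hμ : ∀ x, 0 ≤ μ x) (hs : Summable μ) (h0 : ∀ y, 0 ≤ h y)
    (hB : ∀ y, h y ≤ B) (y : G) : Summable fun x => μ x * h (y + x) :=
  Summable.of_nonneg_of_le (fun x => mul_nonneg (hμ x) (h0 _))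
    (fun x => mul_le_mul_of_nonneg_left (hB _) (hμ x)) (hs.mul_right B)

lemma conv_nonneg (hμ : ∀ x, 0 ≤ μ x) (h0 : ∀ y, 0 ≤ h y) (y : G) : 0 ≤ conv μ h y :=
  tsum_nonneg fun x => mul_nonneg (hμ x) (h0 _)

lemma conv_le (hμ : ∀ x, 0 ≤ μ x) (hs : HasSum μ lam) (h0 : ∀ y, 0 ≤ h y)
    (hB : ∀ y, h y ≤ B) (y : G) : conv μ h y ≤ lam * B := by
  rw [← (hs.mul_right B).tsum_eq]
  exact (summable_conv hμ hs.summable h0 hB y).tsum_le_tsum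
    (fun x => mul_le_mul_of_nonneg_left (hB _) (hμ x)) (hs.mul_right B).summable

lemma iterate_conv_nonneg (hμ : ∀ x, 0 ≤ μ x) (h0 : ∀ y, 0 ≤ h y) (n : ℕ) (y : G) :
    0 ≤ ((conv μ)^[n] h) y := by
  induction n generalizing y with
  | zero => exact h0 y
  | succ n ih =>
    rw [Function.iterate_succ_apply']
    exact conv_nonneg hμ ih y

lemma iterate_conv_le (hμ : ∀ x, 0 ≤ μ x) (hs : HasSum μ lam) (h0 : ∀ y, 0 ≤ h y)
    (hB : ∀ y, h y ≤ B) (n : ℕ) (y : G) : ((conv μ)^[n] h) y ≤ lam ^ n * B := by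
  induction n generalizing y with
  | zero => simpa using hB y
  | succ n ih =>
    rw [Function.iterate_succ_apply', pow_succ', mul_assoc]
    exact conv_le hμ hs (iterate_conv_nonneg hμ h0 n) ih y

lemma abs_iterate_conv_le (hμ : ∀ x, 0 ≤ μ x) (hs : HasSum μ lam) (h0 : ∀ y, 0 ≤ h y)
    (hB : ∀ y, h y ≤ B) (n : ℕ) (y : G) : |((conv μ)^[n] h) y| ≤ lam ^ n * B := by
  rw [abs_of_nonneg (iterate_conv_nonneg hμ h0 n y)]
  exact iterate_conv_le hμ hs h0 hB n y

lemma flow_zero (μ h : G → ℝ) (y : G) : flow μ h 0 y = h y := by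
  rw [flow, tsum_eq_single 0 (fun n hn => by simp [hn])]
  simp

lemma summable_flow (hμ : ∀ x, 0 ≤ μ x) (hs : HasSum μ lam) (h0 : ∀ y, 0 ≤ h y)
    (hB : ∀ y, h y ≤ B) (t : ℝ) (y : G) :
    Summable fun n : ℕ => t ^ n / n.factorial * ((conv μ)^[n] h) y :=
  summable_expSeries (fun n => abs_iterate_conv_le hμ hs h0 hB n y) t

lemma flow_nonneg (hμ : ∀ x, 0 ≤ μ x) (h0 : ∀ y, 0 ≤ h y) {t : ℝ} (ht : 0 ≤ t) (y : G) :
    0 ≤ flow μ h t y :=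
  tsum_nonneg fun n => mul_nonneg (by positivity) (iterate_conv_nonneg hμ h0 n y)

lemma flow_le (hμ : ∀ x, 0 ≤ μ x) (hs : HasSum μ lam) (h0 : ∀ y, 0 ≤ h y)
    (hB : ∀ y, h y ≤ B) {t : ℝ} (ht : 0 ≤ t) (y : G) :
    flow μ h t y ≤ Real.exp (lam * t) * B := by
  have h1 : HasSum (fun n : ℕ => (lam * t) ^ n / n.factorial) (Real.exp (lam * t)) := by
    rw [Real.exp_eq_exp_ℝ]; exact NormedSpace.expSeries_div_hasSum_exp (lam * t)
  rw [← (h1.mul_right B).tsum_eq]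
  refine (summable_flow hμ hs h0 hB t y).tsum_le_tsum (fun n => ?_) (h1.mul_right B).summable
  calc t ^ n / n.factorial * ((conv μ)^[n] h) y ≤ t ^ n / n.factorial * (lam ^ n * B) := by
        gcongr; exact iterate_conv_le hμ hs h0 hB n y
    _ = _ := by rw [mul_pow]; ring

/-- Convolution operators commute, by Fubini's theorem. -/
lemma conv_comm (hμ : ∀ x, 0 ≤ μ x) (hs : HasSum μ lam) (hν : ∀ x, 0 ≤ ν x) (hsν : HasSum ν kap)
    (h0 : ∀ y, 0 ≤ h y) (hB : ∀ y, h y ≤ B) : conv ν (conv μ h) = conv μ (conv ν h) := by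
  funext y
  have hsum : Summable fun p : G × G => ν p.1 * μ p.2 * h (y + p.1 + p.2) :=
    Summable.of_nonneg_of_le (fun p => mul_nonneg (mul_nonneg (hν _) (hμ _)) (h0 _))
      (fun p => mul_le_mul_of_nonneg_left (hB _) (mul_nonneg (hν _) (hμ _)))
      ((hsν.summable.mul_of_nonneg hs.summable hν hμ).mul_right B)
  have hcomm := hsum.tsum_comm (f := fun x z => ν x * μ z * h (y + x + z))
  simp only [conv, ← tsum_mul_left]
  calc ∑' x, ∑' z, ν x * (μ z * h (y + x + z)) = ∑' x, ∑' z, ν x * μ z * h (y + x + z) := by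
        simp only [mul_assoc]
    _ = ∑' z, ∑' x, ν x * μ z * h (y + x + z) := hcomm.symm
    _ = _ := tsum_congr fun z => tsum_congr fun x => by rw [add_right_comm]; ring

lemma conv_iterate_comm (hμ : ∀ x, 0 ≤ μ x) (hs : HasSum μ lam) (hν : ∀ x, 0 ≤ ν x)
    (hsν : HasSum ν kap) (h0 : ∀ y, 0 ≤ h y) (hB : ∀ y, h y ≤ B) (n : ℕ) :
    conv ν ((conv μ)^[n] h) = (conv μ)^[n] (conv ν h) := by
  induction n with
  | zero => rfl
  | succ n ih =>
    rw [Function.iterate_succ_apply', Function.iterate_succ_apply', ← ih]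
    exact conv_comm hμ hs hν hsν (iterate_conv_nonneg hμ h0 n) (iterate_conv_le hμ hs h0 hB n)

/-- Convolutions commute with the flow. -/
lemma conv_flow (hμ : ∀ x, 0 ≤ μ x) (hs : HasSum μ lam) (hν : ∀ x, 0 ≤ ν x) (hsν : HasSum ν kap)
    (h0 : ∀ y, 0 ≤ h y) (hB : ∀ y, h y ≤ B) (t : ℝ) (y : G) :
    conv ν (flow μ h t) y = flow μ (conv ν h) t y := by
  have hsum : Summable fun p : G × ℕ =>
      ν p.1 * (t ^ p.2 / p.2.factorial * ((conv μ)^[p.2] h) (y + p.1)) := by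
    refine Summable.of_norm_bounded ((hsν.summable.mul_of_nonneg
      (g := fun n : ℕ => |t| ^ n / n.factorial * (lam ^ n * B))
      (((Real.summable_pow_div_factorial (|t| * lam)).mul_right B).congr
        fun n => by rw [mul_pow]; ring) hν fun n => ?_)) fun p => ?_
    · exact mul_nonneg (by positivity)
        ((abs_nonneg _).trans (abs_iterate_conv_le hμ hs h0 hB n 0))
    · rw [norm_mul, norm_mul, norm_div, norm_pow, Real.norm_eq_abs t, Real.norm_natCast,
        Real.norm_of_nonneg (hν _)]
      refine mul_le_mul_of_nonneg_left ?_ (hν _)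
      gcongr
      exact abs_iterate_conv_le hμ hs h0 hB _ _
  have hcomm := hsum.tsum_comm
    (f := fun x n => ν x * (t ^ n / n.factorial * ((conv μ)^[n] h) (y + x)))
  simp only [conv, flow, ← tsum_mul_left]
  refine hcomm.symm.trans (tsum_congr fun n => ?_)
  rw [← conv_iterate_comm hμ hs hν hsν h0 hB n]
  change _ = _ * ∑' x, _
  rw [← tsum_mul_left]
  exact tsum_congr fun x => by ring

lemma hasDerivAt_flow (hμ : ∀ x, 0 ≤ μ x) (hs : HasSum μ lam) (h0 : ∀ y, 0 ≤ h y)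
    (hB : ∀ y, h y ≤ B) (t : ℝ) (y : G) :
    HasDerivAt (fun t => flow μ h t y) (conv μ (flow μ h t) y) t := by
  rw [conv_flow hμ hs hμ hs h0 hB]
  exact hasDerivAt_expSeries (fun n => abs_iterate_conv_le hμ hs h0 hB n y) t

end Flow

/-! ### The Fourier transform of the flow -/

section ProductSums

variable {α β : Type*}

lemma hasSum_mul_prod {f : α → ℂ} {g : β → ℂ} {m a : ℂ} (hm : HasSum f m) (ha : HasSum g a)
    (hf : Summable fun x => ‖f x‖) (hg : Summable fun x => ‖g x‖) :
    HasSum (fun p : α × β => f p.1 * g p.2) (m * a) := by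
  rw [← hm.tsum_eq, ← ha.tsum_eq, tsum_mul_tsum_of_summable_norm hf hg]
  exact (summable_mul_of_summable_norm hf hg).hasSum

lemma hasSum_of_prod {f : α × β → ℂ} {g : α → ℂ} {a : ℂ} (h : HasSum f a)
    (hf : ∀ y, HasSum (fun x => f (y, x)) (g y)) : HasSum g a :=
  h.prod_fiberwise hf

lemma summable_prod_expSeries {c : ℕ → α → ℝ} (h0 : ∀ n y, 0 ≤ c n y) {a r : ℝ}
    (hc : ∀ n, HasSum (c n) (r ^ n * a)) (t : ℝ) :
    Summable fun p : ℕ × α => |t| ^ p.1 / p.1.factorial * c p.1 p.2 := by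
  rw [summable_prod_of_nonneg fun p => mul_nonneg (by positivity) (h0 _ _)]
  refine ⟨fun n => by dsimp only; exact (hc n).summable.mul_left _, ?_⟩
  refine ((Real.summable_pow_div_factorial (|t| * r)).mul_right a).congr fun n => ?_
  dsimp only
  rw [tsum_mul_left, (hc n).tsum_eq, mul_pow]
  ring

end ProductSums

section Flow

variable {G : Type*} [AddCommGroup G] {μ h : G → ℝ} {lam : ℝ}

/-- The Fourier transform turns convolution into multiplication. -/
lemma hasSum_conv_mul {χ : G → ℂ} (hχ : ∀ x, ‖χ x‖ = 1) (hadd : ∀ x y, χ (x + y) = χ x * χ y)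
    (hμ : ∀ x, 0 ≤ μ x) (hs : Summable μ) (h0 : ∀ y, 0 ≤ h y) (hh : Summable h) {m a : ℂ}
    (hm : HasSum (fun x => (μ x : ℂ) * χ (-x)) m) (ha : HasSum (fun y => (h y : ℂ) * χ y) a) :
    HasSum (fun y => (conv μ h y : ℂ) * χ y) (m * a) := by
  have hn1 : Summable fun x => ‖(μ x : ℂ) * χ (-x)‖ := by
    refine hs.congr fun x => ?_
    rw [norm_mul, hχ, mul_one, Complex.norm_real, Real.norm_of_nonneg (hμ x)]
  have hn2 : Summable fun x => ‖(h x : ℂ) * χ x‖ := by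
    refine hh.congr fun x => ?_
    rw [norm_mul, hχ, mul_one, Complex.norm_real, Real.norm_of_nonneg (h0 x)]
  have hp := hasSum_mul_prod hm ha hn1 hn2
  let e : G × G ≃ G × G := ⟨fun p => (p.2, p.1 + p.2), fun p => (p.2 - p.1, p.1),
    fun p => by simp, fun p => by simp⟩
  obtain ⟨f, hf⟩ : ∃ f : G × G → ℂ, f = fun p => (μ p.1 : ℂ) * χ (-p.1) * ((h p.2 : ℂ) * χ p.2) :=
    ⟨_, rfl⟩
  rw [← hf] at hp
  refine hasSum_of_prod (f := fun p => f (e p)) (e.hasSum_iff.2 hp) fun y => ?_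
  have h1 := (Complex.hasSum_ofReal.2 (summable_conv (μ := μ) (h := h) hμ hs h0 (B := ∑' y, h y)
    (fun y => hh.le_tsum y fun _ _ => h0 _) y).hasSum).mul_right (χ y)
  refine h1.congr_fun fun x => ?_
  have : χ y = χ (-x) * χ (y + x) := by rw [← hadd]; congr 1; abel
  simp only [hf, e, Equiv.coe_fn_mk]
  rw [this]; push_cast; ring

lemma hasSum_iterate_conv_mul {χ : G → ℂ} (hχ : ∀ x, ‖χ x‖ = 1)
    (hadd : ∀ x y, χ (x + y) = χ x * χ y) (hμ : ∀ x, 0 ≤ μ x) (hs : Summable μ)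
    (h0 : ∀ y, 0 ≤ h y) (hh : Summable h) {m a : ℂ}
    (hm : HasSum (fun x => (μ x : ℂ) * χ (-x)) m) (ha : HasSum (fun y => (h y : ℂ) * χ y) a)
    (n : ℕ) : Summable ((conv μ)^[n] h) ∧
      HasSum (fun y => (((conv μ)^[n] h) y : ℂ) * χ y) (m ^ n * a) := by
  induction n with
  | zero => simpa using ⟨hh, ha⟩
  | succ n ih =>
    rw [Function.iterate_succ_apply', pow_succ', mul_assoc]
    have hn := iterate_conv_nonneg hμ h0 n
    refine ⟨?_, hasSum_conv_mul hχ hadd hμ hs hn ih.1 hm ih.2⟩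
    have h1 := hasSum_conv_mul (χ := fun _ => 1) (by simp) (by simp) hμ hs hn ih.1
      (by simpa only [mul_one] using Complex.hasSum_ofReal.2 hs.hasSum)
      (by simpa only [mul_one] using Complex.hasSum_ofReal.2 ih.1.hasSum)
    simp only [mul_one] at h1
    exact Complex.summable_ofReal.1 h1.summable

lemma hasSum_iterate_conv (hμ : ∀ x, 0 ≤ μ x) (hs : HasSum μ lam) (h0 : ∀ y, 0 ≤ h y) {a : ℝ}
    (hh : HasSum h a) (n : ℕ) : HasSum ((conv μ)^[n] h) (lam ^ n * a) := by
  have h1 := hasSum_iterate_conv_mul (χ := fun _ => 1) (by simp) (by simp) hμ hs.summable h0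
    hh.summable (by simpa only [mul_one] using Complex.hasSum_ofReal.2 hs)
    (by simpa only [mul_one] using Complex.hasSum_ofReal.2 hh) n
  have h2 := h1.2
  simp only [mul_one] at h2
  exact_mod_cast h2

/-- The Fourier transform of the flow. -/
lemma hasSum_flow_mul {χ : G → ℂ} (hχ : ∀ x, ‖χ x‖ = 1) (hadd : ∀ x y, χ (x + y) = χ x * χ y)
    (hμ : ∀ x, 0 ≤ μ x) (hs : HasSum μ lam) (h0 : ∀ y, 0 ≤ h y) (hh : Summable h) {m a : ℂ}
    (hm : HasSum (fun x => (μ x : ℂ) * χ (-x)) m) (ha : HasSum (fun y => (h y : ℂ) * χ y) a)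
    (t : ℝ) : HasSum (fun y => (flow μ h t y : ℂ) * χ y) (Complex.exp (t * m) * a) := by
  have hB : ∀ y, h y ≤ ∑' y, h y := fun y => hh.le_tsum y fun _ _ => h0 _
  obtain ⟨f, hfd⟩ : ∃ f : ℕ × G → ℂ, ∀ n y,
      f (n, y) = (t : ℂ) ^ n / n.factorial * ((((conv μ)^[n] h) y : ℂ) * χ y) :=
    ⟨fun p => (t : ℂ) ^ p.1 / p.1.factorial * ((((conv μ)^[p.1] h) p.2 : ℂ) * χ p.2),
      fun _ _ => rfl⟩
  have hf : Summable f := by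
    have h1 := summable_prod_expSeries (iterate_conv_nonneg hμ h0)
      (hasSum_iterate_conv hμ hs h0 hh.hasSum) t
    refine Summable.of_norm_bounded h1 ?_
    rintro ⟨n, y⟩
    rw [hfd, norm_mul, norm_mul, hχ, mul_one, norm_div, norm_pow,
      Complex.norm_real, Complex.norm_real, Complex.norm_natCast,
      Real.norm_of_nonneg (iterate_conv_nonneg hμ h0 _ _), Real.norm_eq_abs]
  have h1 : HasSum (fun n : ℕ => (t : ℂ) ^ n / n.factorial * (m ^ n * a))
      (Complex.exp (t * m) * a) := by
    have h2 := (NormedSpace.expSeries_div_hasSum_exp ((t : ℂ) * m)).mul_right a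
    rw [← Complex.exp_eq_exp_ℂ] at h2
    refine h2.congr_fun fun n => ?_
    rw [mul_pow]; ring
  have h2 : HasSum f (Complex.exp (t * m) * a) := by
    have h3 := hasSum_of_prod hf.hasSum (g := fun n : ℕ => (t : ℂ) ^ n / n.factorial * (m ^ n * a))
      fun n => by
        simp only [hfd]
        exact (hasSum_iterate_conv_mul hχ hadd hμ hs.summable h0 hh hm ha n).2.mul_left _
    rw [h1.unique h3]
    exact hf.hasSum
  have h4 : HasSum (fun p : G × ℕ => f (p.2, p.1)) (Complex.exp (t * m) * a) :=
    (Equiv.prodComm G ℕ).hasSum_iff.2 h2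
  refine hasSum_of_prod h4 fun y => ?_
  have h5 := (Complex.hasSum_ofReal.2 (summable_flow hμ hs h0 hB t y).hasSum).mul_right (χ y)
  refine h5.congr_fun fun n => ?_
  simp only [hfd]; push_cast; ring

lemma hasSum_flow (hμ : ∀ x, 0 ≤ μ x) (hs : HasSum μ lam) (h0 : ∀ y, 0 ≤ h y) {a : ℝ}
    (hh : HasSum h a) (t : ℝ) : HasSum (flow μ h t) (Real.exp (lam * t) * a) := by
  have h1 := hasSum_flow_mul (χ := fun _ => 1) (by simp) (by simp) hμ hs h0 hh.summable
    (by simpa only [mul_one] using Complex.hasSum_ofReal.2 hs)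
    (by simpa only [mul_one] using Complex.hasSum_ofReal.2 hh) t
  simp only [mul_one] at h1
  rw [mul_comm lam]
  exact_mod_cast h1

end Flow

/-! ### Heat kernel estimates by Fourier analysis on the torus -/

section Fourier

open UnitAddTorus

-- the Fourier theory of `UnitAddTorus` uses the normalised Haar measure on the circle
attribute [local instance] instMeasureSpaceUnitAddCircle
  instIsAddHaarMeasureUnitAddCircleVolume instIsProbabilityMeasureUnitAddCircleVolume

variable {d : ℕ}

/-- The duality pairing `z · θ` of the lattice with the torus. -/
noncomputable def pairing (z : Lattice d) (θ : UnitAddTorus (Fin d)) : UnitAddCircle :=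
  ∑ i, z i • θ i

lemma mFourier_eq_fourier_pairing (z : Lattice d) (θ : UnitAddTorus (Fin d)) :
    mFourier z θ = fourier 1 (pairing z θ) := by
  have h : ∀ s : Finset (Fin d), ∏ i ∈ s, fourier (z i) (θ i) =
      (fourier 1 (∑ i ∈ s, z i • θ i) : ℂ) := by
    intro s
    induction s using Finset.cons_induction with
    | empty => simp
    | cons a s ha ih =>
      rw [Finset.prod_cons, Finset.sum_cons, ih]
      simp only [fourier_apply, one_zsmul, AddCircle.toCircle_add, Circle.coe_mul]
  exact h Finset.univ

lemma norm_mFourier_apply (z : Lattice d) (θ : UnitAddTorus (Fin d)) : ‖mFourier z θ‖ = 1 := by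
  rw [mFourier_eq_fourier_pairing, fourier_apply, Circle.norm_coe]

/-- On the circle `1 - cos (2πx) = 2 sin² (πx)` is comparable to the squared distance to zero. -/
lemma one_sub_re_fourier (x : UnitAddCircle) :
    8 * ‖x‖ ^ 2 ≤ 1 - (fourier 1 x : ℂ).re ∧
      1 - (fourier 1 x : ℂ).re ≤ 2 * Real.pi ^ 2 * ‖x‖ ^ 2 := by
  obtain ⟨r, hr, rfl⟩ : ∃ r : ℝ, |r| ≤ 1 / 2 ∧ (r : UnitAddCircle) = x := by
    obtain ⟨s, rfl⟩ := QuotientAddGroup.mk_surjective x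
    refine ⟨s - round s, abs_sub_round s, ?_⟩
    have : (((round s : ℤ) : ℝ) : UnitAddCircle) = 0 := by
      exact (AddCircle.coe_eq_zero_iff (p := (1 : ℝ))).2 ⟨round s, by simp⟩
    change ((s - round s : ℝ) : UnitAddCircle) = (s : UnitAddCircle)
    rw [AddCircle.coe_sub, this, sub_zero]
  have hn : ‖(r : UnitAddCircle)‖ = |r| :=
    (AddCircle.norm_coe_eq_abs_iff (p := (1 : ℝ)) one_ne_zero).2 (by simpa using hr)
  have hre : (fourier 1 (r : UnitAddCircle) : ℂ).re = Real.cos (2 * (Real.pi * r)) := by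
    rw [fourier_coe_apply]
    have : (2 * (Real.pi : ℂ) * Complex.I * ((1 : ℤ) : ℂ) * (r : ℂ) / ((1 : ℝ) : ℂ)) =
        ((2 * (Real.pi * r) : ℝ) : ℂ) * Complex.I := by push_cast; ring
    rw [this, Complex.exp_ofReal_mul_I_re]
  rw [hn, hre, Real.cos_two_mul', sq_abs]
  have h1 : 1 - (Real.cos (Real.pi * r) ^ 2 - Real.sin (Real.pi * r) ^ 2) =
      2 * Real.sin (Real.pi * r) ^ 2 := by
    have := Real.sin_sq_add_cos_sq (Real.pi * r); linarith
  rw [h1]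
  have hpi := Real.pi_pos
  constructor
  · have h2 : 2 / Real.pi * |Real.pi * r| ≤ |Real.sin (Real.pi * r)| := by
      apply Real.mul_abs_le_abs_sin
      rw [abs_mul, abs_of_pos hpi]; nlinarith
    have h3 : 2 * |r| ≤ |Real.sin (Real.pi * r)| := by
      refine le_trans (le_of_eq ?_) h2
      rw [abs_mul, abs_of_pos hpi]; field_simp
    have h4 := pow_le_pow_left₀ (by positivity) h3 2
    rw [sq_abs, mul_pow, sq_abs] at h4
    linarith
  · have h2 := pow_le_pow_left₀ (abs_nonneg _) (Real.abs_sin_le_abs (x := Real.pi * r)) 2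
    rw [sq_abs, sq_abs, mul_pow] at h2
    linarith

/-- The function `θ ↦ ∑ μ(z) (1 - cos(2π z·θ))`, the rate of decay of the character `θ` under the
walk with jump rates `μ`. -/
noncomputable def gap (μ : Lattice d → ℝ) (θ : UnitAddTorus (Fin d)) : ℝ :=
  ∑' z, μ z * (1 - (mFourier z θ).re)

variable {μ : Lattice d → ℝ} {lam : ℝ}

lemma one_sub_re_mFourier_nonneg (z : Lattice d) (θ : UnitAddTorus (Fin d)) :
    0 ≤ 1 - (mFourier z θ).re := by
  have := (Complex.re_le_norm (mFourier z θ)).trans_eq (norm_mFourier_apply z θ)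
  linarith

lemma hasSum_gap (hμ : ∀ x, 0 ≤ μ x) (hs : Summable μ) (θ : UnitAddTorus (Fin d)) :
    HasSum (fun z => μ z * (1 - (mFourier z θ).re)) (gap μ θ) := by
  refine Summable.hasSum (Summable.of_nonneg_of_le
    (fun z => mul_nonneg (hμ z) (one_sub_re_mFourier_nonneg z θ)) (fun z => ?_) (hs.mul_right 2))
  refine mul_le_mul_of_nonneg_left ?_ (hμ z)
  have := (abs_le.1 ((Complex.abs_re_le_norm (mFourier z θ)).trans_eq (norm_mFourier_apply z θ))).1
  linarith

/-- Point mass at the origin. -/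
noncomputable def delta (d : ℕ) : Lattice d → ℝ := fun y => if y = 0 then 1 else 0

lemma delta_nonneg (y : Lattice d) : 0 ≤ delta d y := by unfold delta; split_ifs <;> simp

lemma delta_le_one (y : Lattice d) : delta d y ≤ 1 := by unfold delta; split_ifs <;> simp

lemma hasSum_delta : HasSum (delta d) 1 := by
  unfold delta; exact hasSum_ite_eq 0 1

/-- The flow started from a point mass, as the Fourier coefficients of a continuous function of
known modulus on the torus. -/
lemma exists_fourier_flow (hμ : ∀ x, 0 ≤ μ x) (hs : HasSum μ lam) (t : ℝ) :
    ∃ F : C(UnitAddTorus (Fin d), ℂ), (∀ θ, ‖F θ‖ = Real.exp (t * (lam - gap μ θ))) ∧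
      ∀ y, mFourierCoeff F y = (flow μ (delta d) t y : ℂ) := by
  set w := flow μ (delta d) t
  have hw : Summable w := (hasSum_flow hμ hs delta_nonneg hasSum_delta t).summable
  have hsum : Summable fun y => (w y : ℂ) • (mFourier y : C(UnitAddTorus (Fin d), ℂ)) := by
    refine Summable.of_norm ?_
    simpa only [norm_smul, mFourier_norm, mul_one, Complex.norm_real] using hw.norm
  refine ⟨∑' y, (w y : ℂ) • mFourier y, fun θ => ?_, fun y => ?_⟩
  · have h1 : HasSum (fun y => (w y : ℂ) • mFourier y θ) ((∑' y, (w y : ℂ) • mFourier y :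
        C(UnitAddTorus (Fin d), ℂ)) θ) := by
      simpa only [map_smul] using! (ContinuousMap.evalCLM ℂ θ).hasSum hsum.hasSum
    have hms : Summable fun x => (μ x : ℂ) * mFourier (-x) θ := by
      refine Summable.of_norm ?_
      simpa only [norm_mul, norm_mFourier_apply, mul_one, Complex.norm_real] using hs.summable.norm
    have hd : HasSum (fun y => (delta d y : ℂ) * mFourier y θ) 1 := by
      have := hasSum_ite_eq (0 : Lattice d) (1 : ℂ)
      refine this.congr_fun fun y => ?_
      by_cases hy : y = 0 <;> simp [delta, hy, mFourier_zero]
    have h2 := hasSum_flow_mul (χ := fun y => mFourier y θ) (norm_mFourier_apply · θ)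
      (fun x y => mFourier_add) hμ hs delta_nonneg hasSum_delta.summable hms.hasSum hd t
    rw [h1.unique h2, mul_one, Complex.norm_exp]
    congr 1
    rw [Complex.re_ofReal_mul]
    congr 1
    have h3 := (Complex.hasSum_re hms.hasSum)
    have h4 := hs.sub (hasSum_gap hμ hs.summable θ)
    refine h3.unique (h4.congr_fun fun z => ?_)
    rw [Complex.re_ofReal_mul, mFourier_neg, Complex.conj_re]
    ring
  · have h1 := (ContinuousMap.toLp (E := ℂ) 2 (volume : Measure (UnitAddTorus (Fin d))) ℂ).hasSum
      hsum.hasSum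
    have h2 := (innerSL ℂ (mFourierLp (d := Fin d) 2 y)).hasSum h1
    rw [← mFourierCoeff_toLp, ← mFourierBasis_repr, HilbertBasis.repr_apply_apply,
      coe_mFourierBasis]
    refine h2.unique ((hasSum_ite_eq y (w y : ℂ)).congr_fun fun z => ?_)
    have h3 := orthonormal_iff_ite.1 (orthonormal_mFourier (d := Fin d)) y z
    simp only [map_smul, innerSL_apply_apply, smul_eq_mul]
    rw [h3]
    by_cases hz : z = y
    · simp [hz]
    · simp [hz, Ne.symm hz]

lemma flow_le_integral (hμ : ∀ x, 0 ≤ μ x) (hs : HasSum μ lam) (t : ℝ) (y : Lattice d) :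
    flow μ (delta d) t y ≤ ∫ θ : UnitAddTorus (Fin d), Real.exp (t * (lam - gap μ θ)) := by
  obtain ⟨F, hF, hc⟩ := exists_fourier_flow hμ hs t
  calc flow μ (delta d) t y ≤ ‖(flow μ (delta d) t y : ℂ)‖ := by
        rw [Complex.norm_real]; exact le_abs_self _
    _ = ‖∫ θ, mFourier (-y) θ • F θ‖ := by rw [← hc y]; rfl
    _ ≤ ∫ θ, ‖mFourier (-y) θ • F θ‖ := norm_integral_le_integral_norm _
    _ = _ := by simp only [norm_smul, norm_mFourier_apply, one_mul, hF]

/-- Parseval's identity for the flow. -/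
lemma hasSum_flow_sq (hμ : ∀ x, 0 ≤ μ x) (hs : HasSum μ lam) (t : ℝ) :
    HasSum (fun y => flow μ (delta d) t y ^ 2)
      (∫ θ : UnitAddTorus (Fin d), Real.exp (2 * t * (lam - gap μ θ))) := by
  obtain ⟨F, hF, hc⟩ := exists_fourier_flow hμ hs t
  have h := hasSum_sq_mFourierCoeff (ContinuousMap.toLp (E := ℂ) 2 volume ℂ F)
  simp only [mFourierCoeff_toLp, hc, Complex.norm_real, Real.norm_eq_abs, sq_abs] at h
  convert h using 1
  refine integral_congr_ae ?_
  filter_upwards [F.coeFn_toLp (p := 2) (𝕜 := ℂ) volume] with θ hθ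
  rw [hθ, hF, ← Real.exp_nat_mul]
  congr 1; push_cast; ring

lemma continuous_gap (hμ : ∀ x, 0 ≤ μ x) (hs : Summable μ) : Continuous (gap μ) := by
  refine continuous_tsum (u := fun z => μ z * 2) (fun z => ?_) (hs.mul_right 2) fun z θ => ?_
  · have := (mFourier z : C(UnitAddTorus (Fin d), ℂ)).continuous
    fun_prop
  · rw [Real.norm_of_nonneg (mul_nonneg (hμ z) (one_sub_re_mFourier_nonneg z θ))]
    refine mul_le_mul_of_nonneg_left ?_ (hμ z)
    have := (abs_le.1 ((Complex.abs_re_le_norm (mFourier z θ)).trans_eq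
      (norm_mFourier_apply z θ))).1
    linarith

lemma norm_pairing_le (z : Lattice d) (θ : UnitAddTorus (Fin d)) :
    ‖pairing z θ‖ ≤ d * ‖z‖ * ‖θ‖ := by
  calc ‖pairing z θ‖ ≤ ∑ i, ‖z i • θ i‖ := norm_sum_le _ _
    _ ≤ ∑ _i : Fin d, ‖z‖ * ‖θ‖ := Finset.sum_le_sum fun i _ =>
        (norm_zsmul_le _ _).trans (mul_le_mul (norm_le_pi_norm z i) (norm_le_pi_norm θ i)
          (norm_nonneg _) (norm_nonneg _))
    _ = d * ‖z‖ * ‖θ‖ := by simp [mul_assoc]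

lemma gap_le (hμ : ∀ x, 0 ≤ μ x) (hs : Summable μ) {M : ℝ}
    (hM : HasSum (fun z => ‖z‖ ^ 2 * μ z) M) (θ : UnitAddTorus (Fin d)) :
    gap μ θ ≤ 2 * Real.pi ^ 2 * d ^ 2 * M * ‖θ‖ ^ 2 := by
  refine hasSum_le (fun z => ?_) (hasSum_gap hμ hs θ)
    ((hM.mul_left (2 * Real.pi ^ 2 * d ^ 2)).mul_right (‖θ‖ ^ 2))
  calc μ z * (1 - (mFourier z θ).re) ≤ μ z * (2 * Real.pi ^ 2 * ‖pairing z θ‖ ^ 2) := by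
        refine mul_le_mul_of_nonneg_left ?_ (hμ z)
        rw [mFourier_eq_fourier_pairing]
        exact (one_sub_re_fourier _).2
    _ ≤ μ z * (2 * Real.pi ^ 2 * (d * ‖z‖ * ‖θ‖) ^ 2) := by
        refine mul_le_mul_of_nonneg_left ?_ (hμ z)
        gcongr
        exact norm_pairing_le z θ
    _ = _ := by ring

/-- The gap is non-degenerate when the jumps generate the lattice: the characters `z` with
`‖z·θ‖ ≤ C √(gap θ)` for all `θ` form a subgroup. -/
lemma exists_norm_pairing_le (hμ : ∀ x, 0 ≤ μ x) (hs : Summable μ)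
    (hgen : AddSubgroup.closure {z | 0 < μ z} = ⊤) (z : Lattice d) :
    ∃ C : ℝ, 0 ≤ C ∧ ∀ θ : UnitAddTorus (Fin d), ‖pairing z θ‖ ≤ C * √(gap μ θ) := by
  have hz : z ∈ AddSubgroup.closure {z | 0 < μ z} := hgen ▸ AddSubgroup.mem_top z
  induction hz using AddSubgroup.closure_induction with
  | mem z hz =>
    have hz' : 0 < μ z := hz
    refine ⟨√(1 / (8 * μ z)), Real.sqrt_nonneg _, fun θ => ?_⟩
    rw [← Real.sqrt_mul (by positivity)]
    refine Real.le_sqrt_of_sq_le ?_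
    have h1 : μ z * (1 - (mFourier z θ).re) ≤ gap μ θ :=
      le_hasSum (hasSum_gap hμ hs θ) z fun x _ =>
        mul_nonneg (hμ x) (one_sub_re_mFourier_nonneg x θ)
    have h2 := (one_sub_re_fourier (pairing z θ)).1
    rw [← mFourier_eq_fourier_pairing] at h2
    have h3 := mul_le_mul_of_nonneg_left h2 hz'.le
    rw [one_div, ← div_eq_inv_mul, le_div_iff₀ (by positivity)]
    linarith
  | zero => exact ⟨0, le_rfl, fun θ => by simp [pairing]⟩
  | add x y _ _ hx hy =>
    obtain ⟨C, hC, h⟩ := hx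
    obtain ⟨D, hD, h'⟩ := hy
    refine ⟨C + D, add_nonneg hC hD, fun θ => ?_⟩
    have : pairing (x + y) θ = pairing x θ + pairing y θ := by
      simp [pairing, add_smul, Finset.sum_add_distrib]
    rw [this, add_mul]
    exact (norm_add_le _ _).trans (add_le_add (h θ) (h' θ))
  | neg x _ hx =>
    obtain ⟨C, hC, h⟩ := hx
    refine ⟨C, hC, fun θ => ?_⟩
    have : pairing (-x) θ = -pairing x θ := by simp [pairing]
    rw [this, norm_neg]
    exact h θ

lemma gap_nonneg (hμ : ∀ x, 0 ≤ μ x) (θ : UnitAddTorus (Fin d)) : 0 ≤ gap μ θ :=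
  tsum_nonneg fun z => mul_nonneg (hμ z) (one_sub_re_mFourier_nonneg z θ)

/-- The gap dominates a multiple of the squared distance to the origin of the torus. -/
lemma exists_le_gap (hμ : ∀ x, 0 ≤ μ x) (hs : Summable μ)
    (hgen : AddSubgroup.closure {z | 0 < μ z} = ⊤) :
    ∃ c : ℝ, 0 < c ∧ ∀ θ : UnitAddTorus (Fin d), c * ∑ i, ‖θ i‖ ^ 2 ≤ gap μ θ := by
  choose C hC h using exists_norm_pairing_le hμ hs hgen
  have hi : ∀ (i : Fin d) (θ : UnitAddTorus (Fin d)),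
      ‖θ i‖ ^ 2 ≤ C (Pi.single i 1) ^ 2 * gap μ θ := by
    intro i θ
    have h1 := h (Pi.single i 1) θ
    have h2 : pairing (Pi.single i 1) θ = θ i := by
      rw [pairing, Finset.sum_eq_single i]
      · simp
      · intro j _ hj; simp [hj]
      · simp
    rw [h2] at h1
    have h3 := pow_le_pow_left₀ (norm_nonneg _) h1 2
    rwa [mul_pow, Real.sq_sqrt (gap_nonneg hμ θ)] at h3
  set K := ∑ i : Fin d, C (Pi.single i 1) ^ 2
  have hK : 0 ≤ K := Finset.sum_nonneg fun i _ => sq_nonneg _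
  refine ⟨1 / (K + 1), by positivity, fun θ => ?_⟩
  rw [one_div, ← div_eq_inv_mul, div_le_iff₀ (by positivity)]
  calc ∑ i, ‖θ i‖ ^ 2 ≤ ∑ i : Fin d, C (Pi.single i 1) ^ 2 * gap μ θ :=
        Finset.sum_le_sum fun i _ => hi i θ
    _ = K * gap μ θ := by rw [Finset.sum_mul]
    _ ≤ gap μ θ * (K + 1) := by nlinarith [gap_nonneg hμ θ]

/-- The Gaussian bound for a one-dimensional integral over the circle. -/
lemma integral_circle_exp_le {c : ℝ} (hc : 0 < c) :
    ∫ x : UnitAddCircle, Real.exp (-c * ‖x‖ ^ 2) ≤ √(Real.pi / c) := by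
  have h0 : (volume : Measure UnitAddCircle) = @volume _ (AddCircle.measureSpace 1) := by
    have h := AddCircle.volume_eq_smul_haarAddCircle (T := 1)
    rw [ENNReal.ofReal_one, one_smul] at h
    exact h.symm
  have h1 := UnitAddCircle.integral_preimage (-(1 / 2)) fun x => Real.exp (-c * ‖x‖ ^ 2)
  rw [h0, ← h1, ← integral_gaussian c]
  have hle : ∫ x in Set.Ioc (-(1 / 2) : ℝ) (-(1 / 2) + 1), 
      Real.exp (-c * ‖(x : UnitAddCircle)‖ ^ 2) =
      ∫ x in Set.Ioc (-(1 / 2) : ℝ) (-(1 / 2) + 1), Real.exp (-c * x ^ 2) := by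
    refine setIntegral_congr_fun measurableSet_Ioc fun x hx => ?_
    have : ‖(x : UnitAddCircle)‖ = |x| := by
      refine (AddCircle.norm_coe_eq_abs_iff (p := (1 : ℝ)) one_ne_zero).2 ?_
      rw [abs_one, abs_le]
      constructor <;> linarith [hx.1, hx.2]
    simp only [this, sq_abs]
  rw [hle]
  exact setIntegral_le_integral (integrable_exp_neg_mul_sq hc)
    (ae_of_all _ fun x => (Real.exp_pos _).le)

/-- The heat kernel upper bound. The time shift `T` makes it uniform down to time zero. -/
theorem exists_flow_le (hμ : ∀ x, 0 ≤ μ x) (hs : HasSum μ lam)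
    (hgen : AddSubgroup.closure {z | 0 < μ z} = ⊤) {T : ℝ} (hT : 0 < T) :
    ∃ C : ℝ, 0 < C ∧ ∀ t, 0 ≤ t → ∀ y,
      flow μ (delta d) t y ≤ C * Real.exp (lam * t) * (t + T) ^ (-(d : ℝ) / 2) := by
  obtain ⟨c, hc, hgap⟩ := exists_le_gap hμ hs.summable hgen
  refine ⟨Real.exp (c * T) ^ d * √(Real.pi / c) ^ d, by positivity, fun t ht y => ?_⟩
  have htT : 0 < t + T := by linarith
  have hhalf : ∀ x : UnitAddCircle, ‖x‖ ≤ 1 := fun x => by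
    have := AddCircle.norm_le_half_period (p := (1 : ℝ)) (x := x) one_ne_zero
    rw [abs_one] at this; linarith
  have hpt : ∀ θ : UnitAddTorus (Fin d), Real.exp (t * (lam - gap μ θ)) ≤
      Real.exp (lam * t) * Real.exp (c * T) ^ d *
        ∏ i, Real.exp (-(c * (t + T)) * ‖θ i‖ ^ 2) := by
    intro θ
    rw [← Real.exp_sum, ← Real.exp_nat_mul, ← Real.exp_add, ← Real.exp_add]
    gcongr
    rw [← Finset.mul_sum]
    have h1 : ∑ i, ‖θ i‖ ^ 2 ≤ d := by
      calc ∑ i, ‖θ i‖ ^ 2 ≤ ∑ _i : Fin d, (1 : ℝ) := Finset.sum_le_sum fun i _ =>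
            pow_le_one₀ (norm_nonneg _) (hhalf _)
        _ = d := by simp
    have h2 := mul_le_mul_of_nonneg_left (hgap θ) ht
    have h3 := mul_le_mul_of_nonneg_left h1 (mul_pos hc hT).le
    nlinarith
  have hint : Integrable (fun x : UnitAddCircle => Real.exp (-(c * (t + T)) * ‖x‖ ^ 2)) :=
    (Continuous.integrable_of_hasCompactSupport (by fun_prop) (HasCompactSupport.of_compactSpace _))
  calc flow μ (delta d) t y ≤ ∫ θ : UnitAddTorus (Fin d), Real.exp (t * (lam - gap μ θ)) :=
        flow_le_integral hμ hs t y
    _ ≤ ∫ θ : UnitAddTorus (Fin d), Real.exp (lam * t) * Real.exp (c * T) ^ d *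
        ∏ i, Real.exp (-(c * (t + T)) * ‖θ i‖ ^ 2) := by
        refine integral_mono ?_ ?_ hpt
        · have := continuous_gap hμ hs.summable
          exact Continuous.integrable_of_hasCompactSupport (by fun_prop)
            (HasCompactSupport.of_compactSpace _)
        · exact Continuous.integrable_of_hasCompactSupport (by fun_prop)
            (HasCompactSupport.of_compactSpace _)
    _ = Real.exp (lam * t) * Real.exp (c * T) ^ d *
        (∫ x : UnitAddCircle, Real.exp (-(c * (t + T)) * ‖x‖ ^ 2)) ^ d := by
        rw [integral_const_mul, integral_fintype_prod_volume_eq_pow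
          (fun x : UnitAddCircle => Real.exp (-(c * (t + T)) * ‖x‖ ^ 2)), Fintype.card_fin]
    _ ≤ Real.exp (lam * t) * Real.exp (c * T) ^ d * √(Real.pi / (c * (t + T))) ^ d := by
        gcongr
        exact integral_circle_exp_le (by positivity)
    _ = _ := by
        have h4 : √(Real.pi / (c * (t + T))) = √(Real.pi / c) * (t + T) ^ (-(1 : ℝ) / 2) := by
          rw [← div_div, Real.sqrt_div' _ htT.le, Real.sqrt_eq_rpow (t + T), neg_div,
            Real.rpow_neg htT.le]
          rfl
        have h5 : ((t + T) ^ (-(1 : ℝ) / 2)) ^ d = (t + T) ^ (-(d : ℝ) / 2) := by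
          rw [← Real.rpow_natCast, ← Real.rpow_mul htT.le]
          congr 1; ring
        rw [h4, mul_pow, h5]; ring

/-- The lower bound on the sum of squares, which is up to a factor the return probability of the
symmetrised walk. -/
theorem exists_le_tsum_flow_sq (hμ : ∀ x, 0 ≤ μ x) (hs : HasSum μ lam)
    (hM : Summable fun z => ‖z‖ ^ 2 * μ z) :
    ∃ c : ℝ, 0 < c ∧ ∀ t, 1 ≤ t →
      c * Real.exp (2 * lam * t) * t ^ (-(d : ℝ) / 2) ≤ ∑' y, flow μ (delta d) t y ^ 2 := by
  set K := 2 * Real.pi ^ 2 * d ^ 2 * ∑' z, ‖z‖ ^ 2 * μ z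
  refine ⟨Real.exp (-(K / 2)), Real.exp_pos _, fun t ht => ?_⟩
  have ht0 : 0 < t := by linarith
  rw [(hasSum_flow_sq hμ hs t).tsum_eq]
  -- on a ball of radius of order `t^{-1/2}` the exponent `t * gap` is bounded
  set δ := t ^ (-(1 : ℝ) / 2) / 2
  have hδ0 : 0 ≤ δ := by positivity
  have hδ : t * δ ^ 2 = 1 / 4 := by
    simp only [δ]
    rw [div_pow, ← Real.rpow_natCast, ← Real.rpow_mul ht0.le]
    norm_num
    rw [Real.rpow_neg_one]; field_simp
  have hδ1 : 2 * δ ≤ 1 := by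
    simp only [δ]
    have := Real.rpow_le_one_of_one_le_of_nonpos ht (show (-(1 : ℝ) / 2) ≤ 0 by norm_num)
    linarith
  let B : Set (UnitAddTorus (Fin d)) := Metric.closedBall 0 δ
  have hvol1 : ∀ x : UnitAddCircle, volume (Metric.closedBall x δ) = ENNReal.ofReal (2 * δ) := by
    have h0 : (volume : Measure UnitAddCircle) = @volume _ (AddCircle.measureSpace 1) := by
      have h := AddCircle.volume_eq_smul_haarAddCircle (T := 1)
      rw [ENNReal.ofReal_one, one_smul] at h
      exact h.symm
    intro x
    rw [h0, AddCircle.volume_closedBall, min_eq_right hδ1]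
  have hvol : (volume : Measure (UnitAddTorus (Fin d))).real B = t ^ (-(d : ℝ) / 2) := by
    have h1 : (volume : Measure (UnitAddTorus (Fin d))) B = ENNReal.ofReal (2 * δ) ^ d := by
      rw [show B = Set.pi Set.univ fun i => Metric.closedBall 0 δ from
        closedBall_pi _ hδ0, volume_pi_pi]
      simp [hvol1]
    rw [measureReal_def, h1, ENNReal.toReal_pow, ENNReal.toReal_ofReal (by positivity)]
    simp only [δ]
    rw [mul_div_cancel₀ _ two_ne_zero, ← Real.rpow_natCast, ← Real.rpow_mul ht0.le]
    congr 1; ring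
  have hcont : Continuous fun θ : UnitAddTorus (Fin d) =>
      Real.exp (2 * t * (lam - gap μ θ)) := by
    have := continuous_gap hμ hs.summable
    fun_prop
  have hint := hcont.integrable_of_hasCompactSupport (μ := volume)
    (HasCompactSupport.of_compactSpace _)
  calc Real.exp (-(K / 2)) * Real.exp (2 * lam * t) * t ^ (-(d : ℝ) / 2)
      = ∫ _θ in B, Real.exp (-(K / 2)) * Real.exp (2 * lam * t) := by
        rw [setIntegral_const, hvol, smul_eq_mul]; ring
    _ ≤ ∫ θ in B, Real.exp (2 * t * (lam - gap μ θ)) := by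
        refine setIntegral_mono_on (integrable_const _).integrableOn hint.integrableOn
          measurableSet_closedBall fun θ hθ => ?_
        rw [← Real.exp_add]
        gcongr
        have h1 : ‖θ‖ ≤ δ := by simpa [B] using hθ
        have h2 := gap_le hμ hs.summable hM.hasSum θ
        have hK : 0 ≤ K := mul_nonneg (by positivity)
          (tsum_nonneg fun z => mul_nonneg (by positivity) (hμ z))
        have h3 : gap μ θ ≤ K * δ ^ 2 := h2.trans (by gcongr)
        have h4 := mul_le_mul_of_nonneg_left h3 ht0.le
        have h5 : t * (K * δ ^ 2) = K / 4 := by rw [mul_left_comm, hδ]; ring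
        nlinarith
    _ ≤ _ := setIntegral_le_integral hint (ae_of_all _ fun θ => (Real.exp_pos _).le)

end Fourier

section Moments

variable {d : ℕ}

/-! ### Moments of the offspring distribution -/

/-- The total value `∑ₓ φ(x) u(z + x)` on `u` of an offspring `φ` placed at `z`. -/
noncomputable def off (u : Lattice d → ℝ) (z : Lattice d) (φ : Offspring d) : ℝ :=
  φ.sum fun x n => (n : ℝ) * u (z + x)

lemma hasSum_off (u : Lattice d → ℝ) (z : Lattice d) (φ : Offspring d) :
    HasSum (fun x => (φ x : ℝ) * u (z + x)) (off u z φ) :=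
  hasSum_sum_of_ne_finset_zero fun x hx => by simp [Finsupp.notMem_support_iff.1 hx]

lemma off_one (z : Lattice d) (φ : Offspring d) : off (fun _ => 1) z φ = size φ := by
  simp [off, size, Finsupp.sum]

lemma off_nonneg {u : Lattice d → ℝ} (hu : ∀ y, 0 ≤ u y) (z : Lattice d) (φ : Offspring d) :
    0 ≤ off u z φ :=
  Finset.sum_nonneg fun _ _ => mul_nonneg (Nat.cast_nonneg _) (hu _)

lemma off_le {u : Lattice d → ℝ} {B : ℝ} (hu : ∀ y, u y ≤ B) (z : Lattice d) (φ : Offspring d) :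
    off u z φ ≤ B * size φ := by
  rw [← off_one z φ, off, off, Finsupp.mul_sum]
  refine Finset.sum_le_sum fun x _ => ?_
  dsimp only
  rw [mul_one, mul_comm]
  exact mul_le_mul_of_nonneg_right (hu _) (Nat.cast_nonneg _)

variable (Φ : PMF (Offspring d))

lemma hasSum_prob : HasSum (fun φ => (Φ φ).toReal) 1 := by
  have h := ENNReal.hasSum_toReal (f := Φ) (by rw [Φ.tsum_coe]; simp)
  rwa [← ENNReal.tsum_toReal_eq fun φ => Φ.apply_ne_top φ, Φ.tsum_coe, ENNReal.toReal_one] at h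

/-- Finite expectations are convergent real sums. -/
lemma hasSum_expectation {f : Offspring d → ℝ} (hf : ∀ φ, 0 ≤ f φ) (h : expectation Φ f < ∞) :
    HasSum (fun φ => (Φ φ).toReal * f φ) (expectation Φ f).toReal := by
  have := ENNReal.hasSum_toReal h.ne
  rw [← ENNReal.tsum_toReal_eq fun φ => ENNReal.mul_ne_top (Φ.apply_ne_top φ)
    ENNReal.ofReal_ne_top] at this
  simp only [ENNReal.toReal_mul, ENNReal.toReal_ofReal (hf _)] at this
  exact this

/-- The mean measure `x ↦ E[g(φ) φ(x)]` of the offspring, weighted by `g`. -/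
noncomputable def meanKernel (g : Offspring d → ℝ) (x : Lattice d) : ℝ :=
  ∑' φ, (Φ φ).toReal * g φ * φ x

variable {Φ} {g : Offspring d → ℝ} {a : ℝ}

lemma meanKernel_nonneg (hg : ∀ φ, 0 ≤ g φ) (x : Lattice d) : 0 ≤ meanKernel Φ g x :=
  tsum_nonneg fun φ => mul_nonneg (mul_nonneg ENNReal.toReal_nonneg (hg φ)) (Nat.cast_nonneg _)

/-- Campbell's formula for a bounded test function. -/
lemma hasSum_meanKernel_off (hg : ∀ φ, 0 ≤ g φ)
    (ha : HasSum (fun φ => (Φ φ).toReal * g φ * size φ) a) {u : Lattice d → ℝ}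
    (hu : ∀ y, 0 ≤ u y) {B : ℝ} (hB : ∀ y, u y ≤ B) (z : Lattice d) :
    HasSum (fun φ => (Φ φ).toReal * g φ * off u z φ) (conv (meanKernel Φ g) u z) ∧
      Summable fun x => meanKernel Φ g x * u (z + x) := by
  have hw : ∀ φ, 0 ≤ (Φ φ).toReal * g φ := fun φ => mul_nonneg ENNReal.toReal_nonneg (hg φ)
  have hs : Summable fun p : Offspring d × Lattice d =>
      (Φ p.1).toReal * g p.1 * ((p.1 p.2 : ℝ) * u (z + p.2)) := by
    rw [summable_prod_of_nonneg fun p =>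
      mul_nonneg (hw _) (mul_nonneg (Nat.cast_nonneg _) (hu _))]
    dsimp only
    refine ⟨fun φ => (hasSum_off u z φ).summable.mul_left _, ?_⟩
    simp only [tsum_mul_left, (hasSum_off u z _).tsum_eq]
    refine Summable.of_nonneg_of_le (fun φ => mul_nonneg (hw φ) (off_nonneg hu z φ)) (fun φ => ?_)
      (ha.summable.mul_right B)
    calc (Φ φ).toReal * g φ * off u z φ ≤ (Φ φ).toReal * g φ * (B * size φ) :=
          mul_le_mul_of_nonneg_left (off_le hB z φ) (hw φ)
      _ = _ := by ring
  have h1 : HasSum (fun φ => (Φ φ).toReal * g φ * off u z φ) _ :=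
    hs.hasSum.prod_fiberwise fun φ => (hasSum_off u z φ).mul_left _
  have hs' := hs.prod_symm
  have hfib : ∀ x, HasSum (fun φ : Offspring d => (Φ φ).toReal * g φ * ((φ x : ℝ) * u (z + x)))
      (meanKernel Φ g x * u (z + x)) := by
    intro x
    have hx : Summable fun φ : Offspring d => (Φ φ).toReal * g φ * φ x := by
      refine Summable.of_nonneg_of_le (fun φ => mul_nonneg (hw φ) (Nat.cast_nonneg _))
        (fun φ => mul_le_mul_of_nonneg_left ?_ (hw φ)) ha.summable
      rw [← off_one 0 φ]
      have := le_hasSum (hasSum_off (fun _ => 1) 0 φ) x fun y _ => by positivity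
      simpa using this
    refine (hx.hasSum.mul_right (u (z + x))).congr_fun fun φ => ?_
    ring
  have h2 := hs'.hasSum.prod_fiberwise hfib
  have h3 : ∑' p : Lattice d × Offspring d, (Φ p.swap.1).toReal * g p.swap.1 *
      ((p.swap.1 p.swap.2 : ℝ) * u (z + p.swap.2)) = ∑' p : Offspring d × Lattice d,
      (Φ p.1).toReal * g p.1 * ((p.1 p.2 : ℝ) * u (z + p.2)) :=
    (Equiv.prodComm (Lattice d) (Offspring d)).tsum_eq fun p : Offspring d × Lattice d =>
      (Φ p.1).toReal * g p.1 * ((p.1 p.2 : ℝ) * u (z + p.2))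
  rw [h3] at h2
  refine ⟨?_, h2.summable⟩
  rw [conv, h2.tsum_eq]
  exact h1

/-- Campbell's formula for the constant test function. -/
lemma hasSum_meanKernel (hg : ∀ φ, 0 ≤ g φ)
    (ha : HasSum (fun φ => (Φ φ).toReal * g φ * size φ) a) : HasSum (meanKernel Φ g) a := by
  have h := hasSum_meanKernel_off hg ha (u := fun _ => 1) (by simp) (fun _ => le_rfl) 0
  simp only [off_one, mul_one] at h
  have h2 := h.1.unique ha
  simp only [conv, mul_one] at h2
  rw [← h2]
  exact h.2.hasSum

/-- The law `Φ` has a finite second moment of the number of balls and a finite mean of `‖φ‖₂`. The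
parameters are the mean and the second moment of the number of balls. The factor `1` makes
`hasSum_mean` the case `g = 1` of the weights `g` in `meanKernel`. -/
structure OffspringMoments (Φ : PMF (Offspring d)) (lam m2 : ℝ) : Prop where
  hasSum_mean : HasSum (fun φ => (Φ φ).toReal * 1 * size φ) lam
  hasSum_second : HasSum (fun φ => (Φ φ).toReal * size φ * size φ) m2
  summable_displacement : Summable fun z => ‖z‖ ^ 2 * meanKernel Φ (fun _ => 1) z

lemma exists_offspringMoments
    (hdisp2 : expectation Φ (fun φ => displacement 2 φ) < ∞)
    (hsecond : expectation Φ (fun φ => (size φ : ℝ) ^ 2) < ∞) :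
    ∃ m2, OffspringMoments Φ (meanOffspring Φ) m2 := by
  have h2 := hasSum_expectation Φ (fun φ => sq_nonneg (size φ : ℝ)) hsecond
  have h1 : expectation Φ (fun φ => (size φ : ℝ)) < ∞ := by
    refine lt_of_le_of_lt (ENNReal.tsum_le_tsum fun φ => ?_) hsecond
    gcongr
    dsimp only
    exact_mod_cast Nat.le_self_pow two_ne_zero _
  have hm := hasSum_expectation Φ (fun φ => (size φ).cast_nonneg) h1
  have hd0 : ∀ φ : Offspring d, 0 ≤ displacement 2 φ := fun φ =>
    Finset.sum_nonneg fun x _ => by positivity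
  have hdd := hasSum_expectation Φ hd0 hdisp2
  refine ⟨_, ⟨by simp only [mul_one]; exact hm, by simpa only [mul_assoc, ← sq] using h2, ?_⟩⟩
  have hs : Summable fun p : Offspring d × Lattice d =>
      (Φ p.1).toReal * (‖p.2‖ ^ 2 * (p.1 p.2 : ℝ)) := by
    have hfin : ∀ φ : Offspring d, HasSum (fun z => ‖z‖ ^ 2 * (φ z : ℝ)) (displacement 2 φ) :=
      fun φ => hasSum_sum_of_ne_finset_zero fun x hx => by simp [Finsupp.notMem_support_iff.1 hx]
    rw [summable_prod_of_nonneg fun p => mul_nonneg ENNReal.toReal_nonneg (by positivity)]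
    dsimp only
    refine ⟨fun φ => (hfin φ).summable.mul_left _, ?_⟩
    simp only [tsum_mul_left, (hfin _).tsum_eq]
    exact hdd.summable
  refine hs.prod_symm.prod.congr fun z => ?_
  simp only [Prod.swap_prod_mk, meanKernel, mul_one]
  rw [← tsum_mul_left]
  exact tsum_congr fun φ => by ring

/-- An irreducible offspring law charges a generating set of the lattice in the mean. -/
lemma closure_meanKernel_pos {lam m2 : ℝ} (hm : OffspringMoments Φ lam m2) (hirr : Irreducible Φ) :
    AddSubgroup.closure {z | 0 < meanKernel Φ (fun _ => 1) z} = ⊤ := by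
  refine hirr _ fun φ hφ z hz => AddSubgroup.subset_closure ?_
  have hw : 0 < (Φ φ).toReal :=
    ENNReal.toReal_pos ((Φ.mem_support_iff φ).1 hφ) (Φ.apply_ne_top φ)
  have hz' : 0 < (φ z : ℝ) := by
    exact_mod_cast Nat.pos_of_ne_zero (Finsupp.mem_support_iff.1 hz)
  have hsum : Summable fun φ : Offspring d => (Φ φ).toReal * 1 * φ z := by
    refine Summable.of_nonneg_of_le (fun φ => by positivity)
      (fun φ => mul_le_mul_of_nonneg_left ?_ (by positivity)) hm.hasSum_mean.summable
    rw [← off_one 0 φ]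
    have := le_hasSum (hasSum_off (fun _ => 1) 0 φ) z fun y _ => by positivity
    simpa using this
  refine lt_of_lt_of_le ?_ (le_hasSum hsum.hasSum φ fun y _ => by positivity)
  positivity

lemma mean_pos {lam m2 : ℝ} (hd : 1 ≤ d) (hm : OffspringMoments Φ lam m2)
    (hirr : Irreducible Φ) : 0 < lam := by
  have hs := hasSum_meanKernel (fun _ => zero_le_one) hm.hasSum_mean
  have h0 := meanKernel_nonneg (Φ := Φ) (g := fun _ => 1) (fun _ => zero_le_one)
  obtain ⟨z, hz⟩ : ∃ z, 0 < meanKernel Φ (fun _ => 1) z := by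
    by_contra! h
    have h1 := closure_meanKernel_pos hm hirr
    have : {z : Lattice d | 0 < meanKernel Φ (fun _ => 1) z} = ∅ := by
      ext z; simpa using h z
    rw [this, AddSubgroup.closure_empty] at h1
    have h2 : (fun _ => 1 : Lattice d) ∈ (⊥ : AddSubgroup (Lattice d)) := h1 ▸ AddSubgroup.mem_top _
    have h3 := congrFun (AddSubgroup.mem_bot.1 h2) ⟨0, hd⟩
    simp at h3
  exact hz.trans_le (le_hasSum hs z fun y _ => h0 y)

end Moments

section Urn

variable {d : ℕ}

/-! ### Linear functionals and weighted norms of finite configurations -/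

/-- The linear functional `∑ y, ζ(y) u(y)`. -/
noncomputable def lin (u : Lattice d → ℝ) (ζ : FinConfig d) : ℝ := ζ.sum fun y n => (n : ℝ) * u y

/-- The weighted norm `∑ y, |ζ(y)| u(y)`. -/
noncomputable def wnorm (u : Lattice d → ℝ) (ζ : FinConfig d) : ℝ :=
  ζ.sum fun y n => |(n : ℝ)| * u y

/-- The signed configuration added by a nucleation at `z` with sign `c` and offspring `φ`. -/
noncomputable def burst (c : ℤ) (z : Lattice d) (φ : Offspring d) : FinConfig d :=
  φ.sum fun x n => Finsupp.single (z + x) (c * (n : ℤ))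

lemma nucleate_eq (ζ : FinConfig d) (z : Lattice d) (φ : Offspring d) :
    nucleate ζ z φ = ζ + burst (ζ z).sign z φ := rfl

lemma lin_add (u : Lattice d → ℝ) (ζ η : FinConfig d) : lin u (ζ + η) = lin u ζ + lin u η :=
  Finsupp.sum_add_index' (by simp) (by intros; push_cast; ring)

lemma wnorm_eq_sum {u : Lattice d → ℝ} {ζ : FinConfig d} {s : Finset (Lattice d)}
    (h : ζ.support ⊆ s) : wnorm u ζ = ∑ y ∈ s, |(ζ y : ℝ)| * u y :=
  Finsupp.sum_of_support_subset _ h _ (by simp)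

lemma wnorm_nonneg {u : Lattice d → ℝ} (hu : ∀ y, 0 ≤ u y) (ζ : FinConfig d) : 0 ≤ wnorm u ζ :=
  Finset.sum_nonneg fun _ _ => mul_nonneg (abs_nonneg _) (hu _)

lemma wnorm_mono {u v : Lattice d → ℝ} (h : ∀ y, u y ≤ v y) (ζ : FinConfig d) :
    wnorm u ζ ≤ wnorm v ζ :=
  Finset.sum_le_sum fun _ _ => mul_le_mul_of_nonneg_left (h _) (abs_nonneg _)

lemma wnorm_const_mul (c : ℝ) (u : Lattice d → ℝ) (ζ : FinConfig d) :
    wnorm (fun y => c * u y) ζ = c * wnorm u ζ := by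
  simp only [wnorm, Finsupp.mul_sum]
  exact Finset.sum_congr rfl fun y _ => by ring

lemma wnorm_add_le {u : Lattice d → ℝ} (hu : ∀ y, 0 ≤ u y) (ζ η : FinConfig d) :
    wnorm u (ζ + η) ≤ wnorm u ζ + wnorm u η := by
  classical
  rw [wnorm_eq_sum (s := ζ.support ∪ η.support) Finsupp.support_add,
    wnorm_eq_sum (s := ζ.support ∪ η.support) Finset.subset_union_left,
    wnorm_eq_sum (s := ζ.support ∪ η.support) (ζ := η) Finset.subset_union_right,
    ← Finset.sum_add_distrib]
  refine Finset.sum_le_sum fun y _ => ?_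
  rw [← add_mul]
  refine mul_le_mul_of_nonneg_right ?_ (hu y)
  rw [Finsupp.add_apply]; push_cast
  exact abs_add_le _ _

lemma wnorm_neg (u : Lattice d → ℝ) (ζ : FinConfig d) : wnorm u (-ζ) = wnorm u ζ := by
  simp [wnorm, Finsupp.sum_neg_index]

lemma abs_lin_le {u : Lattice d → ℝ} (hu : ∀ y, 0 ≤ u y) (ζ : FinConfig d) :
    |lin u ζ| ≤ wnorm u ζ := by
  refine (Finset.abs_sum_le_sum_abs _ _).trans (Finset.sum_le_sum fun y _ => ?_)
  dsimp only
  rw [abs_mul, abs_of_nonneg (hu y)]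

lemma lin_burst (u : Lattice d → ℝ) (c : ℤ) (z : Lattice d) (φ : Offspring d) :
    lin u (burst c z φ) = c * off u z φ := by
  have h : ∀ s : Finset (Lattice d), lin u (∑ x ∈ s, Finsupp.single (z + x) (c * (φ x : ℤ))) =
      c * ∑ x ∈ s, (φ x : ℝ) * u (z + x) := by
    intro s
    induction s using Finset.cons_induction with
    | empty => simp [lin]
    | cons x s hx ih =>
      rw [Finset.sum_cons, Finset.sum_cons, lin_add, ih, mul_add]
      congr 1
      rw [lin, Finsupp.sum_single_index (by simp)]
      push_cast; ring
  exact h φ.support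

lemma wnorm_burst_le {u : Lattice d → ℝ} (hu : ∀ y, 0 ≤ u y) {c : ℤ} (hc : |c| ≤ 1)
    (z : Lattice d) (φ : Offspring d) : wnorm u (burst c z φ) ≤ off u z φ := by
  have h : ∀ s : Finset (Lattice d), wnorm u (∑ x ∈ s, Finsupp.single (z + x) (c * (φ x : ℤ))) ≤
      ∑ x ∈ s, (φ x : ℝ) * u (z + x) := by
    intro s
    induction s using Finset.cons_induction with
    | empty => simp [wnorm]
    | cons x s hx ih =>
      rw [Finset.sum_cons, Finset.sum_cons]
      refine (wnorm_add_le hu _ _).trans (add_le_add ?_ ih)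
      rw [wnorm, Finsupp.sum_single_index (by simp)]
      refine mul_le_mul_of_nonneg_right ?_ (hu _)
      push_cast
      rw [abs_mul, Nat.abs_cast]
      refine mul_le_of_le_one_left (Nat.cast_nonneg _) ?_
      exact_mod_cast hc
  exact h φ.support

lemma abs_sign_le_one (n : ℤ) : |n.sign| ≤ 1 := by
  rcases lt_trichotomy n 0 with h | rfl | h
  · simp [Int.sign_eq_neg_one_of_neg h]
  · simp
  · simp [Int.sign_eq_one_of_pos h]

lemma lin_nucleate (u : Lattice d → ℝ) (ζ : FinConfig d) (z : Lattice d) (φ : Offspring d) :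
    lin u (nucleate ζ z φ) = lin u ζ + ((ζ z).sign : ℝ) * off u z φ := by
  rw [nucleate_eq, lin_add, lin_burst]

lemma wnorm_nucleate_le {u : Lattice d → ℝ} (hu : ∀ y, 0 ≤ u y) (ζ : FinConfig d)
    (z : Lattice d) (φ : Offspring d) : wnorm u (nucleate ζ z φ) ≤ wnorm u ζ + off u z φ := by
  rw [nucleate_eq]
  exact (wnorm_add_le hu _ _).trans (add_le_add le_rfl (wnorm_burst_le hu (abs_sign_le_one _) _ _))

lemma ballCount_eq (ζ : FinConfig d) : (ballCount ζ : ℝ) = wnorm (fun _ => 1) ζ := by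
  simp [ballCount, wnorm, Finsupp.sum, Nat.cast_natAbs]

/-- Nucleations at rate `|ζ(z)|` with the sign of `ζ(z)` have a mean that is linear in `ζ`. -/
lemma sum_abs_mul_sign (u : Lattice d → ℝ) (ζ : FinConfig d) :
    ∑ z ∈ ζ.support, |(ζ z : ℝ)| * (((ζ z).sign : ℝ) * u z) = lin u ζ := by
  refine Finset.sum_congr rfl fun z _ => ?_
  have : |(ζ z : ℝ)| * ((ζ z).sign : ℝ) = ζ z := by
    have := Int.sign_mul_abs (ζ z)
    rw [mul_comm]; exact_mod_cast this
  rw [← mul_assoc, this]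

/-! ### The urn scheme as a jump chain -/

/-- The jump chain of the urn scheme: at rate `|ζ(z)| Φ(φ)` the configuration `ζ` nucleates at `z`
with offspring `φ`. -/
noncomputable def urn (Φ : PMF (Offspring d)) :
    JumpSystem (FinConfig d) (Lattice d × Offspring d) where
  rate ζ j := (ζ j.1).natAbs * (Φ j.2).toNNReal
  move ζ j := nucleate ζ j.1 j.2
  total ζ := ballCount ζ
  hasSum_rate ζ := by
    rw [← ENNReal.hasSum_coe]
    have h : ∑' j : Lattice d × Offspring d,
        (((ζ j.1).natAbs * (Φ j.2).toNNReal : ℝ≥0) : ℝ≥0∞) = ballCount ζ := by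
      rw [ENNReal.tsum_prod']
      simp only [ENNReal.coe_mul, ENNReal.coe_natCast, ENNReal.coe_toNNReal (Φ.apply_ne_top _),
        ENNReal.tsum_mul_left, Φ.tsum_coe, mul_one]
      rw [tsum_eq_sum (s := ζ.support) fun z hz => by simp [Finsupp.notMem_support_iff.1 hz]]
      simp [ballCount, Finsupp.sum]
    rw [ENNReal.coe_natCast, ← h]
    exact ENNReal.summable.hasSum

variable {Φ : PMF (Offspring d)}

lemma gen_urn (F : FinConfig d → ℝ≥0∞) (ζ : FinConfig d) :
    (urn Φ).gen F ζ = ∑ z ∈ ζ.support, ((ζ z).natAbs : ℝ≥0∞) *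
      ∑' φ : Offspring d, Φ φ * F (nucleate ζ z φ) := by
  rw [JumpSystem.gen, ENNReal.tsum_prod']
  simp only [urn, ENNReal.coe_mul, ENNReal.coe_natCast, ENNReal.coe_toNNReal (Φ.apply_ne_top _),
    mul_assoc, ENNReal.tsum_mul_left]
  exact tsum_eq_sum fun z hz => by simp [Finsupp.notMem_support_iff.1 hz]

lemma transitionUpTo_eq (n : ℕ) (t : ℝ) (ζ : FinConfig d) (A : Set (FinConfig d)) :
    transitionUpTo Φ n t ζ A = (urn Φ).upTo (A.indicator 1) n t ζ := by
  have hstay : ∀ (ζ : FinConfig d) (t : ℝ),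
      (urn Φ).stay ζ t = ENNReal.ofReal (Real.exp (-(ballCount ζ * t))) := fun ζ t => by
    simp [JumpSystem.stay, urn]
  induction n generalizing t ζ with
  | zero => simp only [transitionUpTo, JumpSystem.upTo, hstay]
  | succ n ih =>
    simp only [transitionUpTo, JumpSystem.upTo, hstay, JumpSystem.duhamel, gen_urn, ih]
    congr 1
    -- the substitution `u = t - s` of the time of the first jump
    rw [← lintegral_indicator measurableSet_Icc, ← lintegral_indicator measurableSet_Icc,
      ← lintegral_sub_left_eq_self _ t]
    refine lintegral_congr fun u => ?_
    simp only [Set.indicator, Set.mem_Icc, sub_nonneg, sub_le_self_iff, sub_sub_cancel]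
    simp only [and_comm]

lemma transition_eq (t : ℝ) (ζ : FinConfig d) (A : Set (FinConfig d)) :
    transition Φ t ζ A = (urn Φ).semigroup (A.indicator 1) t ζ := by
  simp only [transition, JumpSystem.semigroup, transitionUpTo_eq]

lemma tsum_prob_le {F r : Offspring d → ℝ} {ρ : ℝ} (h0 : ∀ φ, 0 ≤ F φ) (h : ∀ φ, F φ ≤ r φ)
    (hr : HasSum (fun φ => (Φ φ).toReal * r φ) ρ) :
    ∑' φ, Φ φ * ENNReal.ofReal (F φ) ≤ ENNReal.ofReal ρ := by
  rw [← hr.tsum_eq, ENNReal.ofReal_tsum_of_nonneg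
    (fun φ => mul_nonneg ENNReal.toReal_nonneg ((h0 φ).trans (h φ))) hr.summable]
  refine ENNReal.tsum_le_tsum fun φ => ?_
  rw [ENNReal.ofReal_mul ENNReal.toReal_nonneg, ENNReal.ofReal_toReal (Φ.apply_ne_top φ)]
  gcongr
  exact h φ

lemma le_tsum_prob {F : Offspring d → ℝ} {ρ : ℝ}
    (hr : HasSum (fun φ => (Φ φ).toReal * F φ) ρ) :
    ENNReal.ofReal ρ ≤ ∑' φ, Φ φ * ENNReal.ofReal (F φ) := by
  have hs : Summable fun φ => (Φ φ).toReal * max (F φ) 0 := by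
    refine (Summable.of_nonneg_of_le (fun φ => by positivity) (fun φ => ?_) hr.summable.abs)
    rw [abs_mul, abs_of_nonneg ENNReal.toReal_nonneg]
    gcongr
    exact max_le (le_abs_self _) (abs_nonneg _)
  calc ENNReal.ofReal ρ ≤ ENNReal.ofReal (∑' φ, (Φ φ).toReal * max (F φ) 0) := by
        rw [← hr.tsum_eq]
        refine ENNReal.ofReal_le_ofReal (hr.summable.tsum_le_tsum (fun φ => ?_) hs)
        gcongr
        exact le_max_left _ _
    _ = _ := by
        rw [ENNReal.ofReal_tsum_of_nonneg (fun φ => by positivity) hs]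
        refine tsum_congr fun φ => ?_
        rw [ENNReal.ofReal_mul ENNReal.toReal_nonneg, ENNReal.ofReal_toReal (Φ.apply_ne_top φ),
          ENNReal.ofReal_max, ENNReal.ofReal_zero, max_eq_left (by simp)]

lemma natAbs_eq_ofReal (n : ℤ) : (n.natAbs : ℝ≥0∞) = ENNReal.ofReal |(n : ℝ)| := by
  rw [← Int.cast_abs, ← Nat.cast_natAbs, ENNReal.ofReal_natCast]

/-- An upper bound for the generator of the urn, from bounds for the mean of `F` after the
nucleation at each site. -/
lemma gen_urn_le {F : FinConfig d → ℝ} (hF : ∀ ζ, 0 ≤ F ζ) (ζ : FinConfig d)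
    {r : Lattice d → Offspring d → ℝ} {ρ : Lattice d → ℝ}
    (h : ∀ z φ, F (nucleate ζ z φ) ≤ r z φ)
    (hr : ∀ z, HasSum (fun φ => (Φ φ).toReal * r z φ) (ρ z)) :
    (urn Φ).gen (fun x => ENNReal.ofReal (F x)) ζ ≤
        ENNReal.ofReal (∑ z ∈ ζ.support, |(ζ z : ℝ)| * ρ z) ∧
      0 ≤ ∑ z ∈ ζ.support, |(ζ z : ℝ)| * ρ z := by
  have hρ : ∀ z, 0 ≤ ρ z := fun z => (hr z).nonneg fun φ =>
    mul_nonneg ENNReal.toReal_nonneg ((hF _).trans (h z φ))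
  refine ⟨?_, Finset.sum_nonneg fun z _ => mul_nonneg (abs_nonneg _) (hρ z)⟩
  rw [gen_urn, ENNReal.ofReal_sum_of_nonneg fun z _ => mul_nonneg (abs_nonneg _) (hρ z)]
  refine Finset.sum_le_sum fun z _ => ?_
  rw [ENNReal.ofReal_mul (abs_nonneg _), natAbs_eq_ofReal]
  gcongr
  exact tsum_prob_le (fun φ => hF _) (h z) (hr z)

lemma le_gen_urn {F : FinConfig d → ℝ} (ζ : FinConfig d) {ρ : Lattice d → ℝ}
    (hr : ∀ z, HasSum (fun φ => (Φ φ).toReal * F (nucleate ζ z φ)) (ρ z)) :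
    ENNReal.ofReal (∑ z ∈ ζ.support, |(ζ z : ℝ)| * ρ z) ≤
      (urn Φ).gen (fun x => ENNReal.ofReal (F x)) ζ := by
  rw [gen_urn]
  refine (Finset.le_sum_of_subadditive _ ENNReal.ofReal_zero.le
    (fun _ _ => ENNReal.ofReal_add_le) _ _).trans (Finset.sum_le_sum fun z _ => ?_)
  rw [ENNReal.ofReal_mul (abs_nonneg _), natAbs_eq_ofReal]
  gcongr
  exact le_tsum_prob (hr z)

end Urn

section Moments

variable {d : ℕ} {Φ : PMF (Offspring d)} {lam m2 : ℝ}

/-- The mean number `E[φ(x)]` of balls at `x`: the jump rates of the walk followed by the mean of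
the urn scheme. -/
noncomputable def meanRate (Φ : PMF (Offspring d)) : Lattice d → ℝ := meanKernel Φ fun _ => 1

/-- The size-biased mean number `E[‖φ‖ φ(x)]` of balls at `x`. -/
noncomputable def biasedRate (Φ : PMF (Offspring d)) : Lattice d → ℝ :=
  meanKernel Φ fun φ => size φ

lemma meanRate_nonneg (x : Lattice d) : 0 ≤ meanRate Φ x :=
  meanKernel_nonneg (fun _ => zero_le_one) x

lemma biasedRate_nonneg (x : Lattice d) : 0 ≤ biasedRate Φ x :=
  meanKernel_nonneg (fun _ => Nat.cast_nonneg _) x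

namespace OffspringMoments

lemma hasSum_meanRate (hm : OffspringMoments Φ lam m2) : HasSum (meanRate Φ) lam :=
  hasSum_meanKernel (fun _ => zero_le_one) hm.hasSum_mean

lemma hasSum_biasedRate (hm : OffspringMoments Φ lam m2) : HasSum (biasedRate Φ) m2 :=
  hasSum_meanKernel (fun _ => Nat.cast_nonneg _) hm.hasSum_second

lemma mean_nonneg (hm : OffspringMoments Φ lam m2) : 0 ≤ lam :=
  hm.hasSum_meanRate.nonneg meanRate_nonneg

lemma second_nonneg (hm : OffspringMoments Φ lam m2) : 0 ≤ m2 :=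
  hm.hasSum_biasedRate.nonneg biasedRate_nonneg

lemma hasSum_size (hm : OffspringMoments Φ lam m2) :
    HasSum (fun φ => (Φ φ).toReal * size φ) lam := by
  simpa only [mul_one] using hm.hasSum_mean

lemma hasSum_off (hm : OffspringMoments Φ lam m2) {u : Lattice d → ℝ} (hu : ∀ y, 0 ≤ u y) {B : ℝ}
    (hB : ∀ y, u y ≤ B) (z : Lattice d) :
    HasSum (fun φ => (Φ φ).toReal * off u z φ) (conv (meanRate Φ) u z) := by
  have := (hasSum_meanKernel_off (fun _ => zero_le_one) hm.hasSum_mean hu hB z).1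
  simp only [mul_one] at this
  exact this

lemma hasSum_size_mul_off (hm : OffspringMoments Φ lam m2) {u : Lattice d → ℝ}
    (hu : ∀ y, 0 ≤ u y) {B : ℝ} (hB : ∀ y, u y ≤ B) (z : Lattice d) :
    HasSum (fun φ => (Φ φ).toReal * (size φ * off u z φ)) (conv (biasedRate Φ) u z) := by
  have := (hasSum_meanKernel_off (fun _ => Nat.cast_nonneg _) hm.hasSum_second hu hB z).1
  simp only [mul_assoc] at this
  exact this

end OffspringMoments

end Moments

section Solutions

variable {d : ℕ} {Φ : PMF (Offspring d)} {lam m2 : ℝ} {h : Lattice d → ℝ} {B : ℝ}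

/-! ### Explicit sub- and supersolutions -/

lemma sum_abs_mul_add (ζ : FinConfig d) (a : ℝ) (u : Lattice d → ℝ) :
    ∑ z ∈ ζ.support, |(ζ z : ℝ)| * (a + u z) = ballCount ζ * a + wnorm u ζ := by
  rw [ballCount_eq]
  simp only [mul_add, Finset.sum_add_distrib, wnorm, Finsupp.sum, mul_one, Finset.sum_mul]

lemma total_urn (ζ : FinConfig d) : (((urn Φ).total ζ : ℝ≥0) : ℝ) = ballCount ζ := by simp [urn]

lemma hasDerivAt_wnorm_flow (hm : OffspringMoments Φ lam m2) (h0 : ∀ y, 0 ≤ h y)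
    (hB : ∀ y, h y ≤ B) (ζ : FinConfig d) (t : ℝ) :
    HasDerivAt (fun t => wnorm (flow (meanRate Φ) h t) ζ)
      (wnorm (conv (meanRate Φ) (flow (meanRate Φ) h t)) ζ) t :=
  HasDerivAt.fun_sum fun y _ =>
    (hasDerivAt_flow meanRate_nonneg hm.hasSum_meanRate h0 hB t y).const_mul _

lemma hasDerivAt_lin_flow (hm : OffspringMoments Φ lam m2) (h0 : ∀ y, 0 ≤ h y)
    (hB : ∀ y, h y ≤ B) (ζ : FinConfig d) (t : ℝ) :
    HasDerivAt (fun t => lin (flow (meanRate Φ) h t) ζ)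
      (lin (conv (meanRate Φ) (flow (meanRate Φ) h t)) ζ) t :=
  HasDerivAt.fun_sum fun y _ =>
    (hasDerivAt_flow meanRate_nonneg hm.hasSum_meanRate h0 hB t y).const_mul _

lemma conv_meanRate_flow (hm : OffspringMoments Φ lam m2) (h0 : ∀ y, 0 ≤ h y)
    (hB : ∀ y, h y ≤ B) (t : ℝ) :
    conv (meanRate Φ) (flow (meanRate Φ) h t) = flow (meanRate Φ) (conv (meanRate Φ) h) t :=
  funext fun y => conv_flow meanRate_nonneg hm.hasSum_meanRate meanRate_nonneg hm.hasSum_meanRate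
    h0 hB t y

lemma continuous_wnorm_conv_flow (hm : OffspringMoments Φ lam m2) (h0 : ∀ y, 0 ≤ h y)
    (hB : ∀ y, h y ≤ B) (ζ : FinConfig d) :
    Continuous fun t => wnorm (conv (meanRate Φ) (flow (meanRate Φ) h t)) ζ := by
  simp only [conv_meanRate_flow hm h0 hB]
  exact continuous_iff_continuousAt.2 fun t => (hasDerivAt_wnorm_flow hm
    (conv_nonneg meanRate_nonneg h0)
    (conv_le meanRate_nonneg hm.hasSum_meanRate h0 hB) ζ t).continuousAt

lemma continuous_lin_conv_flow (hm : OffspringMoments Φ lam m2) (h0 : ∀ y, 0 ≤ h y)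
    (hB : ∀ y, h y ≤ B) (ζ : FinConfig d) :
    Continuous fun t => lin (conv (meanRate Φ) (flow (meanRate Φ) h t)) ζ := by
  simp only [conv_meanRate_flow hm h0 hB]
  exact continuous_iff_continuousAt.2 fun t => (hasDerivAt_lin_flow hm
    (conv_nonneg meanRate_nonneg h0)
    (conv_le meanRate_nonneg hm.hasSum_meanRate h0 hB) ζ t).continuousAt

lemma flow_zero_eq (h : Lattice d → ℝ) : flow (meanRate Φ) h 0 = h := funext (flow_zero _ h)

/-- Annihilation only decreases the mean number of balls: the weighted norm along the flow is a
supersolution. -/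
lemma semigroup_wnorm_le (hm : OffspringMoments Φ lam m2) (h0 : ∀ y, 0 ≤ h y)
    (hB : ∀ y, h y ≤ B) {t : ℝ} (ht : 0 ≤ t) (ζ : FinConfig d) :
    (urn Φ).semigroup (fun x => ENNReal.ofReal (wnorm h x)) t ζ ≤
      ENNReal.ofReal (wnorm (flow (meanRate Φ) h t) ζ) := by
  refine (urn Φ).semigroup_le (W := fun t ζ => ENNReal.ofReal (wnorm (flow (meanRate Φ) h t) ζ))
    (fun t ht ζ => ?_) ht ζ
  have hfn : ∀ t, 0 ≤ t → ∀ y, 0 ≤ flow (meanRate Φ) h t y := fun t ht y =>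
    flow_nonneg meanRate_nonneg h0 ht y
  have hb : ∀ t, 0 ≤ t → ∀ ζ, (urn Φ).gen
      (fun x => ENNReal.ofReal (wnorm (flow (meanRate Φ) h t) x)) ζ ≤ ENNReal.ofReal
        (wnorm (conv (meanRate Φ) (flow (meanRate Φ) h t)) ζ +
          (urn Φ).total ζ * wnorm (flow (meanRate Φ) h t) ζ) := by
    intro t ht ζ
    have := (gen_urn_le (Φ := Φ) (fun ζ => wnorm_nonneg (hfn t ht) ζ) ζ
      (fun z φ => wnorm_nucleate_le (hfn t ht) ζ z φ) fun z => by
        simpa only [mul_add, one_mul] using ((hasSum_prob Φ).mul_right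
          (wnorm (flow (meanRate Φ) h t) ζ)).add
          (hm.hasSum_off (hfn t ht) (flow_le meanRate_nonneg hm.hasSum_meanRate h0 hB ht) z)).1
    rwa [sum_abs_mul_add, add_comm, ← total_urn (Φ := Φ)] at this
  have := (urn Φ).super_of_hasDerivAt
    (W := fun t ζ => wnorm (flow (meanRate Φ) h t) ζ)
    (D := fun t ζ => wnorm (conv (meanRate Φ) (flow (meanRate Φ) h t)) ζ)
    (fun t _ ζ => hasDerivAt_wnorm_flow hm h0 hB ζ t)
    (fun ζ => (continuous_wnorm_conv_flow hm h0 hB ζ).continuousOn)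
    (fun ζ => wnorm_nonneg (hfn 0 le_rfl) ζ)
    (fun t ht ζ => add_nonneg (wnorm_nonneg (conv_nonneg meanRate_nonneg (hfn t ht)) ζ)
      (mul_nonneg ((urn Φ).total ζ).coe_nonneg (wnorm_nonneg (hfn t ht) ζ))) hb ht ζ
  simpa only [flow_zero_eq] using this

lemma ballCount_nucleate_le (ζ : FinConfig d) (z : Lattice d) (φ : Offspring d) :
    (ballCount (nucleate ζ z φ) : ℝ) ≤ ballCount ζ + size φ := by
  rw [ballCount_eq, ballCount_eq, ← off_one z φ]
  exact wnorm_nucleate_le (fun _ => zero_le_one) ζ z φ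

/-- The comparison principle for the urn: subsolutions of linear growth in the number of balls lie
below supersolutions. A multiple of the squared number of balls controls the number of balls summed
over all jumps. -/
theorem urn_sub_le_super (hm : OffspringMoments Φ lam m2) {g : FinConfig d → ℝ≥0∞}
    {U W : ℝ → FinConfig d → ℝ≥0∞}
    (hU : ∀ t, 0 ≤ t → ∀ s, U t s ≤ (urn Φ).stay s t * g s + (urn Φ).duhamel U t s)
    (hW : ∀ t, 0 ≤ t → ∀ s, (urn Φ).stay s t * g s + (urn Φ).duhamel W t s ≤ W t s)
    (hUK : ∀ t, 0 ≤ t → ∀ ζ, U t ζ ≤ ENNReal.ofReal (Real.exp (lam * t) * (1 + ballCount ζ)))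
    {t : ℝ} (ht : 0 ≤ t) (ζ : FinConfig d) : U t ζ ≤ W t ζ := by
  have hl := hm.mean_nonneg
  have hm2 := hm.second_nonneg
  set c := 2 + 3 * lam + m2
  have hc : 0 < c := by positivity
  refine (urn Φ).sub_le_super hU hW
    (K := fun t ζ => ENNReal.ofReal (Real.exp (lam * t) * (1 + ballCount ζ)))
    (V := fun t ζ => ENNReal.ofReal ((ballCount ζ : ℝ) ^ 2 * (Real.exp (c * t) - 1)))
    hUK (fun ζ => by fun_prop) ?_ (fun _ _ => ENNReal.ofReal_ne_top) ht ζ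
  intro t ht ζ
  have hexp : ∀ t : ℝ, 0 ≤ t → 0 ≤ Real.exp (c * t) - 1 := fun t ht =>
    sub_nonneg.2 (Real.one_le_exp (by positivity))
  have hb : ∀ t, 0 ≤ t → ∀ ζ : FinConfig d, (urn Φ).gen (fun ζ =>
      ENNReal.ofReal (Real.exp (lam * t) * (1 + ballCount ζ)) +
        ENNReal.ofReal ((ballCount ζ : ℝ) ^ 2 * (Real.exp (c * t) - 1))) ζ ≤
      ENNReal.ofReal ((ballCount ζ : ℝ) ^ 2 * (Real.exp (c * t) * c) +
        (urn Φ).total ζ * ((ballCount ζ : ℝ) ^ 2 * (Real.exp (c * t) - 1))) := by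
    intro t ht ζ
    have he := hexp t ht
    set k := Real.exp (c * t) - 1 with hk
    set e := Real.exp (lam * t) with he'
    have hepos : 0 < e := Real.exp_pos _
    have hF : ∀ ζ : FinConfig d, 0 ≤ e * (1 + ballCount ζ) + (ballCount ζ : ℝ) ^ 2 * k :=
      fun ζ => by positivity
    simp_rw [← ENNReal.ofReal_add (show 0 ≤ e * (1 + ballCount _) by positivity)
      (show 0 ≤ (ballCount _ : ℝ) ^ 2 * k by positivity)]
    refine (gen_urn_le (Φ := Φ) (F := fun ζ => e * (1 + ballCount ζ) + (ballCount ζ : ℝ) ^ 2 * k)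
      hF ζ (r := fun _ φ => (e * (1 + ballCount ζ) + (ballCount ζ : ℝ) ^ 2 * k) +
        (e + 2 * ballCount ζ * k) * size φ + k * (size φ * size φ))
      (ρ := fun _ => (e * (1 + ballCount ζ) + (ballCount ζ : ℝ) ^ 2 * k) +
        (e + 2 * ballCount ζ * k) * lam + k * m2) (fun z φ => ?_) fun z => ?_).1.trans ?_
    · have h1 := ballCount_nucleate_le ζ z φ
      calc e * (1 + ballCount (nucleate ζ z φ)) + (ballCount (nucleate ζ z φ) : ℝ) ^ 2 * k
          ≤ e * (1 + (ballCount ζ + size φ)) + (ballCount ζ + size φ : ℝ) ^ 2 * k := by gcongr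
        _ = _ := by ring
    · have h1 := ((hasSum_prob Φ).mul_right (e * (1 + ballCount ζ) + (ballCount ζ : ℝ) ^ 2 * k)).add
        (hm.hasSum_size.mul_left (e + 2 * ballCount ζ * k))
      have h2 := h1.add (hm.hasSum_second.mul_left k)
      rw [one_mul] at h2
      refine h2.congr_fun fun φ => ?_
      ring
    · refine ENNReal.ofReal_le_ofReal ?_
      have h1 : ∑ z ∈ ζ.support, |(ζ z : ℝ)| = ballCount ζ := by
        rw [ballCount_eq]; simp [wnorm, Finsupp.sum]
      rw [← Finset.sum_mul, h1, total_urn]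
      have hq : (ballCount ζ : ℝ) ≤ (ballCount ζ : ℝ) ^ 2 := by
        exact_mod_cast Nat.le_self_pow two_ne_zero _
      set q : ℝ := (ballCount ζ : ℝ)
      have hq0 : 0 ≤ q := Nat.cast_nonneg _
      have hek : e ≤ k + 1 := by
        rw [hk, he', sub_add_cancel]
        refine Real.exp_le_exp.2 (mul_le_mul_of_nonneg_right ?_ ht)
        simp only [c]; linarith
      have hkc : Real.exp (c * t) * c = (k + 1) * (2 + 3 * lam + m2) := by rw [hk, sub_add_cancel]
      rw [hkc]
      have a1 : q * (e * (1 + q)) ≤ q ^ 2 * (2 * (k + 1)) := by nlinarith [mul_nonneg hq0 hepos.le]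
      have a2 : q * (e * lam) ≤ q ^ 2 * ((k + 1) * lam) := by
        have : e * lam ≤ (k + 1) * lam := mul_le_mul_of_nonneg_right hek hl
        exact mul_le_mul hq this (by positivity) (by positivity)
      have a3 : q * (k * m2) ≤ q ^ 2 * ((k + 1) * m2) := by
        have : k * m2 ≤ (k + 1) * m2 := mul_le_mul_of_nonneg_right (by linarith) hm2
        exact mul_le_mul hq this (by positivity) (by positivity)
      have a4 : q * (2 * q * k * lam) ≤ q ^ 2 * ((k + 1) * (2 * lam)) := by
        have : 0 ≤ q ^ 2 * lam := by positivity
        nlinarith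
      nlinarith
  have := (urn Φ).super_of_hasDerivAt
    (W := fun t ζ => (ballCount ζ : ℝ) ^ 2 * (Real.exp (c * t) - 1))
    (D := fun t ζ => (ballCount ζ : ℝ) ^ 2 * (Real.exp (c * t) * c))
    (fun t _ ζ => by
      have h1 := ((hasDerivAt_id t).const_mul c).exp.sub_const 1
      simpa using h1.const_mul ((ballCount ζ : ℝ) ^ 2))
    (fun ζ => by fun_prop) (fun ζ => by simp)
    (fun t ht ζ => by have := hexp t ht; positivity) hb ht ζ
  simpa using this

/-- The urn scheme does not explode. -/
theorem urn_semigroup_one (hm : OffspringMoments Φ lam m2) {t : ℝ} (ht : 0 ≤ t)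
    (ζ : FinConfig d) : (urn Φ).semigroup (fun _ => 1) t ζ = 1 := by
  refine le_antisymm ((urn Φ).semigroup_le_one (fun _ => le_rfl) ht ζ) ?_
  refine urn_sub_le_super hm (g := fun _ => 1) (U := fun _ _ => 1) (fun t ht ζ => ?_)
    (fun t ht ζ => ((urn Φ).semigroup_eq _ t ζ).ge) (fun t ht ζ => ?_) ht ζ
  · have := (urn Φ).sub_of_hasDerivAt (U := fun _ _ => 1) (D := fun _ _ => 0)
      (fun _ => continuousOn_const) (fun _ _ _ => hasDerivAt_const _ _)
      (fun _ => continuousOn_const) (fun _ _ _ => by simp [JumpSystem.gen_one]) ht ζ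
    simpa using this
  · rw [ENNReal.one_le_ofReal]
    have := Real.one_le_exp (mul_nonneg hm.mean_nonneg ht)
    have h2 : (0 : ℝ) ≤ ballCount ζ := Nat.cast_nonneg _
    nlinarith

/-- The mean of the positive part of a linear functional is at least the positive part of its
mean. In the signed encoding annihilation does not change the value of a linear functional, so its
mean solves a linear equation, whose positive part is a subsolution. -/
theorem ofReal_lin_flow_le (hm : OffspringMoments Φ lam m2) (h0 : ∀ y, 0 ≤ h y)
    (hB : ∀ y, h y ≤ 1) {t : ℝ} (ht : 0 ≤ t) (ζ : FinConfig d) :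
    ENNReal.ofReal (lin (flow (meanRate Φ) h t) ζ) ≤
      (urn Φ).semigroup (fun x => ENNReal.ofReal (lin h x)) t ζ := by
  have hfn : ∀ t, 0 ≤ t → ∀ y, 0 ≤ flow (meanRate Φ) h t y := fun t ht y =>
    flow_nonneg meanRate_nonneg h0 ht y
  have hfl : ∀ t, 0 ≤ t → ∀ y, flow (meanRate Φ) h t y ≤ Real.exp (lam * t) := fun t ht y => by
    simpa using flow_le meanRate_nonneg hm.hasSum_meanRate h0 hB ht y
  refine urn_sub_le_super hm (g := fun x => ENNReal.ofReal (lin h x))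
    (U := fun t ζ => ENNReal.ofReal (lin (flow (meanRate Φ) h t) ζ)) (fun t ht ζ => ?_)
    (fun t ht ζ => ((urn Φ).semigroup_eq _ t ζ).ge) (fun t ht ζ => ?_) ht ζ
  · have hb : ∀ t, 0 ≤ t → ∀ ζ, ENNReal.ofReal
        (lin (conv (meanRate Φ) (flow (meanRate Φ) h t)) ζ +
          (urn Φ).total ζ * lin (flow (meanRate Φ) h t) ζ) ≤
        (urn Φ).gen (fun x => ENNReal.ofReal (lin (flow (meanRate Φ) h t) x)) ζ := by
      intro t ht ζ
      have := le_gen_urn (Φ := Φ) (F := lin (flow (meanRate Φ) h t)) ζ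
        (ρ := fun z => lin (flow (meanRate Φ) h t) ζ +
          ((ζ z).sign : ℝ) * conv (meanRate Φ) (flow (meanRate Φ) h t) z) fun z => by
        have h1 := ((hasSum_prob Φ).mul_right (lin (flow (meanRate Φ) h t) ζ)).add
          ((hm.hasSum_off (hfn t ht) (hfl t ht) z).mul_left ((ζ z).sign : ℝ))
        rw [one_mul] at h1
        refine h1.congr_fun fun φ => ?_
        rw [lin_nucleate]; ring
      simp only [mul_add, Finset.sum_add_distrib, sum_abs_mul_sign] at this
      rw [← Finset.sum_mul, add_comm] at this
      convert this using 4
      rw [total_urn, ballCount_eq]; simp [wnorm, Finsupp.sum]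
    have := (urn Φ).sub_of_hasDerivAt
      (U := fun t ζ => lin (flow (meanRate Φ) h t) ζ)
      (D := fun t ζ => lin (conv (meanRate Φ) (flow (meanRate Φ) h t)) ζ)
      (fun ζ => (continuous_iff_continuousAt.2 fun t =>
        (hasDerivAt_lin_flow hm h0 hB ζ t).continuousAt).continuousOn)
      (fun t _ ζ => hasDerivAt_lin_flow hm h0 hB ζ t)
      (fun ζ => (continuous_lin_conv_flow hm h0 hB ζ).continuousOn) hb ht ζ
    simpa only [flow_zero_eq] using this
  · refine ENNReal.ofReal_le_ofReal ?_
    calc lin (flow (meanRate Φ) h t) ζ ≤ wnorm (flow (meanRate Φ) h t) ζ :=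
          (le_abs_self _).trans (abs_lin_le (hfn t ht) ζ)
      _ ≤ wnorm (fun _ => Real.exp (lam * t) * 1) ζ :=
          wnorm_mono (fun y => by simpa using hfl t ht y) ζ
      _ = Real.exp (lam * t) * ballCount ζ := by rw [wnorm_const_mul, ballCount_eq]
      _ ≤ _ := by gcongr; linarith

end Solutions

section SecondMoment

variable {d : ℕ} {Φ : PMF (Offspring d)} {lam m2 : ℝ}

/-! ### The second moment -/

/-- The order `e^{λt} (t + T)^{-d/2}` of the heat kernel bound; the shift `T` keeps it finite, and
its logarithmic derivative under control, down to time zero. -/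
noncomputable def heatBound (d : ℕ) (lam T t : ℝ) : ℝ :=
  Real.exp (lam * t) * (t + T) ^ (-(d : ℝ) / 2)

lemma heatBound_pos {T t : ℝ} (hT : 0 < T) (ht : 0 ≤ t) : 0 < heatBound d lam T t := by
  have : 0 < t + T := by linarith
  unfold heatBound; positivity

lemma hasDerivAt_heatBound {T t : ℝ} (hT : 0 < T) (ht : 0 ≤ t) :
    HasDerivAt (heatBound d lam T) ((lam - (d : ℝ) / 2 / (t + T)) * heatBound d lam T t) t := by
  have htT : 0 < t + T := by linarith
  have h1 : HasDerivAt (fun t => Real.exp (lam * t)) (Real.exp (lam * t) * lam) t := by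
    simpa using ((hasDerivAt_id t).const_mul lam).exp
  have h2 := ((hasDerivAt_id t).add_const T).rpow_const (p := -(d : ℝ) / 2)
    (Or.inl (by simpa using htT.ne'))
  refine (h1.mul h2).congr_deriv ?_
  simp only [id, heatBound]
  rw [Real.rpow_sub_one htT.ne']
  field_simp
  ring

/-- The second moment at the origin. The first term is the square of the mean, and the second
bounds the contribution of the randomness of the nucleations: the weight `2C/λ * heatBound` is a
supersolution of `b' = λ b / 2`, and this growth absorbs the source `C * heatBound` coming from the
variance of a single nucleation. -/
theorem semigroup_sq_le (hd : 1 ≤ d) (hm : OffspringMoments Φ lam m2) (hl : 0 < lam) {C : ℝ}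
    (hC : 0 < C) (hw : ∀ t, 0 ≤ t → ∀ y,
      flow (meanRate Φ) (delta d) t y ≤ C * heatBound d lam (d / lam) t)
    {t : ℝ} (ht : 0 ≤ t) (ζ : FinConfig d) :
    (urn Φ).semigroup (fun x => ENNReal.ofReal (lin (delta d) x ^ 2)) t ζ ≤
      ENNReal.ofReal (lin (flow (meanRate Φ) (delta d) t) ζ ^ 2 +
        2 * C / lam * heatBound d lam (d / lam) t *
          wnorm (flow (meanRate Φ) (conv (biasedRate Φ) (delta d)) t) ζ) := by
  have hdpos : (0 : ℝ) < d := by exact_mod_cast hd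
  set T : ℝ := d / lam with hTdef
  have hT : 0 < T := by positivity
  set w := flow (meanRate Φ) (delta d) with hwdef
  set N := flow (meanRate Φ) (conv (biasedRate Φ) (delta d)) with hNdef
  have hw0 : ∀ t, 0 ≤ t → ∀ y, 0 ≤ w t y := fun t ht => flow_nonneg meanRate_nonneg delta_nonneg ht
  have hν0 : ∀ y, 0 ≤ conv (biasedRate Φ) (delta d) y := conv_nonneg biasedRate_nonneg delta_nonneg
  have hνB : ∀ y, conv (biasedRate Φ) (delta d) y ≤ m2 * 1 :=
    conv_le biasedRate_nonneg hm.hasSum_biasedRate delta_nonneg delta_le_one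
  have hN0 : ∀ t, 0 ≤ t → ∀ y, 0 ≤ N t y := fun t ht => flow_nonneg meanRate_nonneg hν0 ht
  have hNB : ∀ t, 0 ≤ t → ∀ y, N t y ≤ Real.exp (lam * t) * (m2 * 1) := fun t ht =>
    flow_le meanRate_nonneg hm.hasSum_meanRate hν0 hνB ht
  have hNw : ∀ t y, conv (biasedRate Φ) (w t) y = N t y := fun t y =>
    conv_flow meanRate_nonneg hm.hasSum_meanRate biasedRate_nonneg hm.hasSum_biasedRate
      delta_nonneg delta_le_one t y
  set b : ℝ → ℝ := fun t => 2 * C / lam * heatBound d lam T t with hb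
  set b' : ℝ → ℝ := fun t => 2 * C / lam * ((lam - (d : ℝ) / 2 / (t + T)) * heatBound d lam T t)
    with hb'
  have hb0 : ∀ t, 0 ≤ t → 0 ≤ b t := fun t ht => by
    have := heatBound_pos (d := d) (lam := lam) hT ht
    positivity
  -- `T = d/λ` makes the logarithmic derivative of the heat bound at least `λ/2`
  have hbd : ∀ t, 0 ≤ t → C * heatBound d lam T t ≤ b' t := by
    intro t ht
    have h1 := heatBound_pos (d := d) (lam := lam) hT ht
    have h2 : (d : ℝ) / 2 / (t + T) ≤ lam / 2 := by
      rw [div_le_iff₀ (by linarith)]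
      have : lam * T = d := by rw [hTdef]; field_simp
      nlinarith [mul_nonneg hl.le ht]
    calc C * heatBound d lam T t = 2 * C / lam * (lam / 2 * heatBound d lam T t) := by
          field_simp
      _ ≤ b' t := by
          simp only [hb']
          gcongr
          linarith
  let W : ℝ → FinConfig d → ℝ := fun t ζ => lin (w t) ζ ^ 2 + b t * wnorm (N t) ζ
  let D : ℝ → FinConfig d → ℝ := fun t ζ => 2 * lin (w t) ζ * lin (conv (meanRate Φ) (w t)) ζ +
    (b' t * wnorm (N t) ζ + b t * wnorm (conv (meanRate Φ) (N t)) ζ)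
  have hWnn : ∀ t, 0 ≤ t → ∀ ζ, 0 ≤ W t ζ := fun t ht ζ =>
    add_nonneg (sq_nonneg _) (mul_nonneg (hb0 t ht) (wnorm_nonneg (hN0 t ht) ζ))
  have hderiv : ∀ t, 0 ≤ t → ∀ ζ, HasDerivAt (fun u => W u ζ) (D t ζ) t := by
    intro t ht ζ
    have h1 := (hasDerivAt_lin_flow hm delta_nonneg delta_le_one ζ t).pow 2
    have h2 := ((hasDerivAt_heatBound (d := d) (lam := lam) hT ht).const_mul (2 * C / lam)).mul
      (hasDerivAt_wnorm_flow hm hν0 hνB ζ t)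
    refine (h1.add h2).congr_deriv ?_
    simp only [D]
    push_cast
    ring
  have hcont : ∀ ζ, ContinuousOn (fun t => D t ζ) (Set.Ici 0) := by
    intro ζ
    have c1 : Continuous fun t => lin (w t) ζ := continuous_iff_continuousAt.2 fun t =>
      (hasDerivAt_lin_flow hm delta_nonneg delta_le_one ζ t).continuousAt
    have c2 := continuous_lin_conv_flow hm delta_nonneg delta_le_one ζ
    have c3 : Continuous fun t => wnorm (N t) ζ := continuous_iff_continuousAt.2 fun t =>
      (hasDerivAt_wnorm_flow hm hν0 hνB ζ t).continuousAt
    have c4 := continuous_wnorm_conv_flow hm hν0 hνB ζ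
    have c5 : ContinuousOn (heatBound d lam T) (Set.Ici 0) := fun t ht =>
      (hasDerivAt_heatBound hT ht).continuousAt.continuousWithinAt
    have c6 : ContinuousOn (fun t : ℝ => (d : ℝ) / 2 / (t + T)) (Set.Ici 0) :=
      ContinuousOn.div (by fun_prop) (by fun_prop) fun t ht => by
        have : (0 : ℝ) ≤ t := ht
        linarith
    refine ContinuousOn.add ((c1.const_mul 2).mul c2).continuousOn (ContinuousOn.add ?_ ?_)
    · exact (continuousOn_const.mul ((continuousOn_const.sub c6).mul c5)).mul c3.continuousOn
    · exact (continuousOn_const.mul c5).mul c4.continuousOn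
  have hgen : ∀ t, 0 ≤ t → ∀ ζ,
      (urn Φ).gen (fun x => ENNReal.ofReal (W t x)) ζ ≤
        ENNReal.ofReal (D t ζ + (urn Φ).total ζ * W t ζ) ∧
      0 ≤ D t ζ + (urn Φ).total ζ * W t ζ := by
    intro t ht ζ
    have hβ := hw t ht
    set β := C * heatBound d lam T t
    have key := gen_urn_le (Φ := Φ) (F := W t) (hWnn t ht) ζ
      (r := fun z φ => W t ζ + ((ζ z).sign : ℝ) * (2 * lin (w t) ζ) * off (w t) z φ +
        β * (size φ * off (w t) z φ) + b t * off (N t) z φ)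
      (ρ := fun z => W t ζ + (((ζ z).sign : ℝ) * (2 * lin (w t) ζ * conv (meanRate Φ) (w t) z) +
        (β * N t z + b t * conv (meanRate Φ) (N t) z))) (fun z φ => ?_) fun z => ?_
    · have hsum : ∑ z ∈ ζ.support, |(ζ z : ℝ)| * (W t ζ +
          (((ζ z).sign : ℝ) * (2 * lin (w t) ζ * conv (meanRate Φ) (w t) z) +
            (β * N t z + b t * conv (meanRate Φ) (N t) z))) = (urn Φ).total ζ * W t ζ +
          (2 * lin (w t) ζ * lin (conv (meanRate Φ) (w t)) ζ +
            (β * wnorm (N t) ζ + b t * wnorm (conv (meanRate Φ) (N t)) ζ)) := by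
        simp only [mul_add, Finset.sum_add_distrib]
        congr 1
        · rw [← Finset.sum_mul, total_urn, ballCount_eq]; simp [wnorm, Finsupp.sum]
        congr 1
        · rw [← sum_abs_mul_sign (conv (meanRate Φ) (w t)) ζ, Finset.mul_sum]
          exact Finset.sum_congr rfl fun z _ => by ring
        · simp only [wnorm, Finsupp.sum, Finset.mul_sum]
          congr 1 <;> exact Finset.sum_congr rfl fun z _ => by ring
      rw [hsum] at key
      have hle : (urn Φ).total ζ * W t ζ +
          (2 * lin (w t) ζ * lin (conv (meanRate Φ) (w t)) ζ +
            (β * wnorm (N t) ζ + b t * wnorm (conv (meanRate Φ) (N t)) ζ)) ≤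
          D t ζ + (urn Φ).total ζ * W t ζ := by
        have := mul_le_mul_of_nonneg_right (hbd t ht) (wnorm_nonneg (hN0 t ht) ζ)
        simp only [D]
        linarith
      exact ⟨key.1.trans (ENNReal.ofReal_le_ofReal hle), key.2.trans hle⟩
    · -- expand the square; the square of the sign is at most one
      have h1 := wnorm_nucleate_le (hN0 t ht) ζ z φ
      have h2 := mul_le_mul_of_nonneg_left h1 (hb0 t ht)
      have h3 := off_le hβ z φ
      have h4 := off_nonneg (hw0 t ht) z φ
      have h5 : ((ζ z).sign : ℝ) ^ 2 ≤ 1 := by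
        have := abs_sign_le_one (ζ z)
        rw [sq_le_one_iff_abs_le_one]
        exact_mod_cast this
      have h6 := mul_le_mul_of_nonneg_right h3 h4
      have h7 : ((ζ z).sign : ℝ) ^ 2 * off (w t) z φ ^ 2 ≤ off (w t) z φ ^ 2 :=
        mul_le_of_le_one_left (sq_nonneg _) h5
      simp only [W]
      rw [lin_nucleate]
      nlinarith
    · have s1 := ((hasSum_prob Φ).mul_right (W t ζ)).add
        ((hm.hasSum_off (hw0 t ht) hβ z).mul_left (((ζ z).sign : ℝ) * (2 * lin (w t) ζ)))
      have s2 := (s1.add ((hm.hasSum_size_mul_off (hw0 t ht) hβ z).mul_left β)).add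
        ((hm.hasSum_off (hN0 t ht) (hNB t ht) z).mul_left (b t))
      rw [hNw] at s2
      have e : W t ζ + (((ζ z).sign : ℝ) * (2 * lin (w t) ζ * conv (meanRate Φ) (w t) z) +
          (β * N t z + b t * conv (meanRate Φ) (N t) z)) = 1 * W t ζ +
          ((ζ z).sign : ℝ) * (2 * lin (w t) ζ) * conv (meanRate Φ) (w t) z + β * N t z +
          b t * conv (meanRate Φ) (N t) z := by ring
      rw [e]
      exact s2.congr_fun fun φ => by ring
  have hsuper := fun t ht ζ => (urn Φ).super_of_hasDerivAt (W := W) (D := D) hderiv hcont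
    (hWnn 0 le_rfl) (fun t ht ζ => (hgen t ht ζ).2) (fun t ht ζ => (hgen t ht ζ).1) (t := t) ht ζ
  refine (urn Φ).semigroup_le (W := fun t ζ => ENNReal.ofReal (W t ζ)) (fun t ht ζ => ?_) ht ζ
  refine le_trans ?_ (hsuper t ht ζ)
  gcongr
  simp only [W, hwdef, flow_zero_eq]
  exact le_add_of_nonneg_right (mul_nonneg (hb0 0 le_rfl) (wnorm_nonneg (hN0 0 le_rfl) ζ))

end SecondMoment

section Coupling

variable {d : ℕ} {Φ : PMF (Offspring d)} {lam m2 : ℝ}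

/-! ### A coupling of two urn schemes -/

/-- The rate at which stacks of `a` and `b` balls at one site nucleate simultaneously: balls of the
same colour are paired off. -/
def common (a b : ℤ) : ℕ := if a.sign = b.sign then min a.natAbs b.natAbs else 0

lemma common_le_left (a b : ℤ) : common a b ≤ a.natAbs := by
  unfold common; split_ifs <;> simp

lemma common_le_right (a b : ℤ) : common a b ≤ b.natAbs := by
  unfold common; split_ifs <;> simp

lemma sign_eq_of_common_ne_zero {a b : ℤ} (h : common a b ≠ 0) : a.sign = b.sign := by
  unfold common at h; split_ifs at h with h' <;> simp_all

/-- The unpaired balls are the discrepancy of the two stacks. -/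
lemma natAbs_sub_eq (a b : ℤ) :
    (a - b).natAbs = (a.natAbs - common a b) + (b.natAbs - common a b) := by
  unfold common
  rcases lt_trichotomy a 0 with ha | rfl | ha <;> rcases lt_trichotomy b 0 with hb | rfl | hb <;>
    simp_all [Int.sign_eq_neg_one_of_neg, Int.sign_eq_one_of_pos] <;> omega

/-- The rates, at a site with stacks of `a` and `b` balls, of a joint nucleation, a nucleation in
the first configuration only, and one in the second only. -/
def pairRate (a b : ℤ) : Fin 3 → ℕ := ![common a b, a.natAbs - common a b, b.natAbs - common a b]

/-- The pair of configurations after a joint nucleation, or one in the first or second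
configuration only. -/
noncomputable def pairMove (s : FinConfig d × FinConfig d) (z : Lattice d) (φ : Offspring d) :
    Fin 3 → FinConfig d × FinConfig d :=
  ![(nucleate s.1 z φ, nucleate s.2 z φ), (nucleate s.1 z φ, s.2), (s.1, nucleate s.2 z φ)]

open Classical in
/-- The sites occupied in at least one of two configurations. -/
noncomputable def sites (s : FinConfig d × FinConfig d) : Finset (Lattice d) :=
  s.1.support ∪ s.2.support

lemma support_fst_subset (s : FinConfig d × FinConfig d) : s.1.support ⊆ sites s := by
  classical exact Finset.subset_union_left

lemma support_snd_subset (s : FinConfig d × FinConfig d) : s.2.support ⊆ sites s := by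
  classical exact Finset.subset_union_right

lemma pairRate_eq_zero {s : FinConfig d × FinConfig d} {z : Lattice d} (hz : z ∉ sites s)
    (i : Fin 3) : pairRate (s.1 z) (s.2 z) i = 0 := by
  have h1 : s.1 z = 0 := Finsupp.notMem_support_iff.1 fun h => hz (support_fst_subset s h)
  have h2 : s.2 z = 0 := Finsupp.notMem_support_iff.1 fun h => hz (support_snd_subset s h)
  fin_cases i <;> simp [pairRate, common, h1, h2]

/-- Two urn schemes, coupled so that balls of the same colour at the same site nucleate
simultaneously, with the same offspring, as far as possible. -/
noncomputable def pairUrn (Φ : PMF (Offspring d)) :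
    JumpSystem (FinConfig d × FinConfig d) ((Lattice d × Offspring d) × Fin 3) where
  rate s j := pairRate (s.1 j.1.1) (s.2 j.1.1) j.2 * (Φ j.1.2).toNNReal
  move s j := pairMove s j.1.1 j.1.2 j.2
  total s := ∑ z ∈ sites s, ∑ i, (pairRate (s.1 z) (s.2 z) i : ℝ≥0)
  hasSum_rate s := by
    rw [← ENNReal.hasSum_coe]
    have h : ∑' j : (Lattice d × Offspring d) × Fin 3,
        ((pairRate (s.1 j.1.1) (s.2 j.1.1) j.2 * (Φ j.1.2).toNNReal : ℝ≥0) : ℝ≥0∞) =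
        ((∑ z ∈ sites s, ∑ i, (pairRate (s.1 z) (s.2 z) i : ℝ≥0) : ℝ≥0) : ℝ≥0∞) := by
      rw [ENNReal.tsum_prod', ENNReal.tsum_prod']
      simp only [ENNReal.coe_mul, ENNReal.coe_natCast, ENNReal.coe_toNNReal (Φ.apply_ne_top _),
        tsum_fintype, ← Finset.sum_mul, ENNReal.tsum_mul_left, Φ.tsum_coe, mul_one]
      rw [tsum_eq_sum (s := sites s) fun z hz => by simp [pairRate_eq_zero hz]]
      simp
    rw [← h]
    exact ENNReal.summable.hasSum

lemma gen_pairUrn (F : FinConfig d × FinConfig d → ℝ≥0∞) (s : FinConfig d × FinConfig d) :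
    (pairUrn Φ).gen F s = ∑ z ∈ sites s, ∑' φ : Offspring d, Φ φ *
      ∑ i, (pairRate (s.1 z) (s.2 z) i : ℝ≥0∞) * F (pairMove s z φ i) := by
  rw [JumpSystem.gen, ENNReal.tsum_prod', ENNReal.tsum_prod']
  simp only [pairUrn, ENNReal.coe_mul, ENNReal.coe_natCast, ENNReal.coe_toNNReal (Φ.apply_ne_top _),
    tsum_fintype, Finset.mul_sum]
  rw [tsum_eq_sum (s := sites s) fun z hz => by simp [pairRate_eq_zero hz]]
  refine Finset.sum_congr rfl fun z _ => tsum_congr fun φ => Finset.sum_congr rfl fun i _ => ?_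
  ring

lemma gen_pairUrn_le {F : FinConfig d × FinConfig d → ℝ} (hF : ∀ s, 0 ≤ F s)
    (s : FinConfig d × FinConfig d) {r : Lattice d → Offspring d → ℝ} {ρ : Lattice d → ℝ}
    (h : ∀ z φ, ∑ i, (pairRate (s.1 z) (s.2 z) i : ℝ) * F (pairMove s z φ i) ≤ r z φ)
    (hr : ∀ z, HasSum (fun φ => (Φ φ).toReal * r z φ) (ρ z)) :
    (pairUrn Φ).gen (fun x => ENNReal.ofReal (F x)) s ≤ ENNReal.ofReal (∑ z ∈ sites s, ρ z) := by
  have h0 : ∀ z φ, 0 ≤ ∑ i, (pairRate (s.1 z) (s.2 z) i : ℝ) * F (pairMove s z φ i) := fun z φ =>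
    Finset.sum_nonneg fun i _ => mul_nonneg (Nat.cast_nonneg _) (hF _)
  have hρ : ∀ z, 0 ≤ ρ z := fun z => (hr z).nonneg fun φ =>
    mul_nonneg ENNReal.toReal_nonneg ((h0 z φ).trans (h z φ))
  rw [gen_pairUrn, ENNReal.ofReal_sum_of_nonneg fun z _ => hρ z]
  refine Finset.sum_le_sum fun z _ => (le_of_eq ?_).trans (tsum_prob_le (h0 z) (h z) (hr z))
  refine tsum_congr fun φ => ?_
  rw [ENNReal.ofReal_sum_of_nonneg fun i _ => mul_nonneg (Nat.cast_nonneg _) (hF _)]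
  simp only [ENNReal.ofReal_mul (Nat.cast_nonneg _), ENNReal.ofReal_natCast]

lemma le_gen_pairUrn {F : FinConfig d × FinConfig d → ℝ} (s : FinConfig d × FinConfig d)
    {ρ : Lattice d → ℝ} (hr : ∀ z, HasSum (fun φ => (Φ φ).toReal *
      ∑ i, (pairRate (s.1 z) (s.2 z) i : ℝ) * F (pairMove s z φ i)) (ρ z)) :
    ENNReal.ofReal (∑ z ∈ sites s, ρ z) ≤ (pairUrn Φ).gen (fun x => ENNReal.ofReal (F x)) s := by
  rw [gen_pairUrn]
  refine (Finset.le_sum_of_subadditive _ ENNReal.ofReal_zero.le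
    (fun _ _ => ENNReal.ofReal_add_le) _ _).trans (Finset.sum_le_sum fun z _ => ?_)
  refine (le_tsum_prob (hr z)).trans (ENNReal.tsum_le_tsum fun φ => ?_)
  gcongr
  refine (Finset.le_sum_of_subadditive _ ENNReal.ofReal_zero.le
    (fun _ _ => ENNReal.ofReal_add_le) _ _).trans (Finset.sum_le_sum fun i _ => ?_)
  rw [ENNReal.ofReal_mul (Nat.cast_nonneg _), ENNReal.ofReal_natCast]

lemma total_pairUrn (s : FinConfig d × FinConfig d) : (((pairUrn Φ).total s : ℝ≥0) : ℝ) =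
    ∑ z ∈ sites s, ∑ i, (pairRate (s.1 z) (s.2 z) i : ℝ) := by
  simp [pairUrn]

lemma total_pairUrn_le (s : FinConfig d × FinConfig d) :
    (((pairUrn Φ).total s : ℝ≥0) : ℝ) ≤ ballCount s.1 + ballCount s.2 := by
  rw [total_pairUrn, ballCount_eq, ballCount_eq, wnorm_eq_sum (support_fst_subset s),
    wnorm_eq_sum (support_snd_subset s), ← Finset.sum_add_distrib]
  refine Finset.sum_le_sum fun z _ => ?_
  have h1 := common_le_left (s.1 z) (s.2 z)
  have h2 := common_le_right (s.1 z) (s.2 z)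
  rw [Fin.sum_univ_three]
  simp only [pairRate, Matrix.cons_val, mul_one]
  rw [← Int.cast_abs, ← Int.cast_abs, ← Nat.cast_natAbs, ← Nat.cast_natAbs]
  norm_cast
  omega

/-- Along the coupling the expected number of discrepancies, weighted by `h` at time `t`, is at most
their initial number, weighted by the flow of `h`; hence the semigroup maps functions which are
Lipschitz for the `h`-weighted distance into functions which are Lipschitz for the distance weighted
by the flow of `h`. -/
theorem semigroup_le_add_wnorm (hm : OffspringMoments Φ lam m2) {h : Lattice d → ℝ} {B : ℝ}
    (h0 : ∀ y, 0 ≤ h y) (hB : ∀ y, h y ≤ B) {g : FinConfig d → ℝ≥0∞} (hg : ∀ ζ, g ζ ≤ 1)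
    (hgh : ∀ ζ ζ', g ζ ≤ g ζ' + ENNReal.ofReal (wnorm h (ζ - ζ'))) {t : ℝ} (ht : 0 ≤ t)
    (ζ ζ' : FinConfig d) :
    (urn Φ).semigroup g t ζ ≤ (urn Φ).semigroup g t ζ' +
      ENNReal.ofReal (wnorm (flow (meanRate Φ) h t) (ζ - ζ')) := by
  have hl := hm.mean_nonneg
  obtain ⟨F, D, hF, hF0, hF1, hFc, hDc, hFd, hD⟩ := (urn Φ).exists_real_semigroup hg
  have hfn : ∀ t, 0 ≤ t → ∀ y, 0 ≤ flow (meanRate Φ) h t y := fun t ht y =>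
    flow_nonneg meanRate_nonneg h0 ht y
  have hfB := fun (t : ℝ) (ht : 0 ≤ t) => flow_le meanRate_nonneg hm.hasSum_meanRate h0 hB ht
  have hinit : ∀ ζ, ENNReal.ofReal (F 0 ζ) = g ζ := fun ζ => by
    rw [← hF 0 le_rfl, JumpSystem.semigroup_eq]
    simp [JumpSystem.stay, JumpSystem.duhamel]
  let c : ℝ := 1 + 2 * lam
  have hc : 0 ≤ c := by positivity
  -- the generator of the urn as a sum over sites
  have hP : ∀ t, 0 ≤ t → ∀ ζ z, Summable fun φ => (Φ φ).toReal * F t (nucleate ζ z φ) := by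
    intro t ht ζ z
    refine Summable.of_nonneg_of_le (fun φ => mul_nonneg ENNReal.toReal_nonneg (hF0 _ _))
      (fun φ => mul_le_of_le_one_right ENNReal.toReal_nonneg (hF1 t ht _)) (hasSum_prob Φ).summable
  have hDsum : ∀ t, 0 ≤ t → ∀ ζ (S : Finset (Lattice d)), ζ.support ⊆ S → D t ζ =
      ∑ z ∈ S, (((ζ z).natAbs : ℝ) * ∑' φ, (Φ φ).toReal * F t (nucleate ζ z φ) -
        ((ζ z).natAbs : ℝ) * F t ζ) := by
    intro t ht ζ S hS
    rw [hD t ht, Finset.sum_sub_distrib, ← Finset.sum_mul, total_urn]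
    congr 1
    · have hs := (urn Φ).summable_rate_mul (F := F t)
        (fun s => abs_le.2 ⟨by linarith [hF0 t s], hF1 t ht s⟩) ζ
      rw [hs.tsum_prod]
      have e : ∀ z φ, (((urn Φ).rate ζ (z, φ) : ℝ≥0) : ℝ) * F t ((urn Φ).move ζ (z, φ)) =
          ((ζ z).natAbs : ℝ) * ((Φ φ).toReal * F t (nucleate ζ z φ)) := fun z φ => by
        simp only [urn]
        push_cast
        rw [mul_assoc]
      simp only [e, tsum_mul_left]
      exact tsum_eq_sum fun z hz => by simp [Finsupp.notMem_support_iff.1 fun h => hz (hS h)]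
    · rw [ballCount_eq, wnorm_eq_sum hS]
      simp [Nat.cast_natAbs]
  -- the coupling has the right marginals: the difference of the two solutions solves the backward
  -- equation of the pair
  let U : ℝ → FinConfig d × FinConfig d → ℝ := fun t s => F t s.1 - F t s.2
  have hsub : ∀ t, 0 ≤ t → ∀ s, ENNReal.ofReal (U t s) ≤
      (pairUrn Φ).stay s t * ENNReal.ofReal (U 0 s) +
        (pairUrn Φ).duhamel (fun u x => ENNReal.ofReal (U u x)) t s := by
    intro t ht s
    refine (pairUrn Φ).sub_of_hasDerivAt (U := U) (D := fun t s => D t s.1 - D t s.2)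
      (fun s => (hFc _).sub (hFc _)) (fun t ht s => (hFd t ht _).sub (hFd t ht _))
      (fun s => (hDc _).sub (hDc _)) (fun t ht s => ?_) ht s
    set p : Lattice d → ℝ := fun z => ∑' φ, (Φ φ).toReal * F t (nucleate s.1 z φ)
    set q : Lattice d → ℝ := fun z => ∑' φ, (Φ φ).toReal * F t (nucleate s.2 z φ)
    refine le_trans (le_of_eq ?_) (le_gen_pairUrn s (F := U t)
      (ρ := fun z => (pairRate (s.1 z) (s.2 z) 0 : ℝ) * (p z - q z) +
        (pairRate (s.1 z) (s.2 z) 1 : ℝ) * (p z - 1 * F t s.2) +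
        (pairRate (s.1 z) (s.2 z) 2 : ℝ) * (1 * F t s.1 - q z)) fun z => ?_)
    · rw [hDsum t ht s.1 _ (support_fst_subset s), hDsum t ht s.2 _ (support_snd_subset s),
        total_pairUrn, Finset.sum_mul, ← Finset.sum_sub_distrib, ← Finset.sum_add_distrib]
      congr 1
      refine Finset.sum_congr rfl fun z _ => ?_
      have h1 := common_le_left (s.1 z) (s.2 z)
      have h2 := common_le_right (s.1 z) (s.2 z)
      rw [Fin.sum_univ_three]
      simp only [pairRate, Matrix.cons_val, U]
      push_cast [h1, h2]
      ring
    · have s1 := (hP t ht s.1 z).hasSum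
      have s2 := (hP t ht s.2 z).hasSum
      have s3 := ((s1.sub s2).mul_left (pairRate (s.1 z) (s.2 z) 0 : ℝ)).add
        ((s1.sub ((hasSum_prob Φ).mul_right (F t s.2))).mul_left
          (pairRate (s.1 z) (s.2 z) 1 : ℝ))
      have s4 := s3.add ((((hasSum_prob Φ).mul_right (F t s.1)).sub s2).mul_left
          (pairRate (s.1 z) (s.2 z) 2 : ℝ))
      refine s4.congr_fun fun φ => ?_
      rw [Fin.sum_univ_three]
      simp only [pairMove, Matrix.cons_val, U]
      ring
  let W : ℝ → FinConfig d × FinConfig d → ℝ := fun t s => wnorm (flow (meanRate Φ) h t) (s.1 - s.2)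
  have hsuper : ∀ t, 0 ≤ t → ∀ s, (pairUrn Φ).stay s t * ENNReal.ofReal (U 0 s) +
      (pairUrn Φ).duhamel (fun u x => ENNReal.ofReal (W u x)) t s ≤ ENNReal.ofReal (W t s) := by
    intro t ht s
    have hUW : ENNReal.ofReal (U 0 s) ≤ ENNReal.ofReal (W 0 s) := by
      simp only [U, W, flow_zero_eq]
      rw [ENNReal.ofReal_sub _ (hF0 _ _), hinit, hinit, tsub_le_iff_left]
      exact hgh _ _
    refine le_trans (add_le_add (mul_le_mul_right hUW _) le_rfl)
      ((pairUrn Φ).super_of_hasDerivAt (W := W)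
        (D := fun t s => wnorm (conv (meanRate Φ) (flow (meanRate Φ) h t)) (s.1 - s.2))
        (fun t _ s => hasDerivAt_wnorm_flow hm h0 hB _ t)
        (fun s => (continuous_wnorm_conv_flow hm h0 hB _).continuousOn)
        (fun s => wnorm_nonneg (hfn 0 le_rfl) _)
        (fun t ht s => add_nonneg (wnorm_nonneg (conv_nonneg meanRate_nonneg (hfn t ht)) _)
          (mul_nonneg ((pairUrn Φ).total s).coe_nonneg (wnorm_nonneg (hfn t ht) _)))
        (fun t ht s => ?_) ht s)
    refine (gen_pairUrn_le (F := W t) (fun s => wnorm_nonneg (hfn t ht) _) s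
      (r := fun z φ => (∑ i, (pairRate (s.1 z) (s.2 z) i : ℝ)) * W t s +
        ((s.1 z - s.2 z).natAbs : ℝ) * off (flow (meanRate Φ) h t) z φ)
      (ρ := fun z => 1 * ((∑ i, (pairRate (s.1 z) (s.2 z) i : ℝ)) * W t s) +
        ((s.1 z - s.2 z).natAbs : ℝ) * conv (meanRate Φ) (flow (meanRate Φ) h t) z)
      (fun z φ => ?_) fun z => ?_).trans (le_of_eq ?_)
    -- a joint nucleation changes no discrepancy, and a single one adds at most the offspring
    · have m0 : (pairRate (s.1 z) (s.2 z) 0 : ℝ) * W t (pairMove s z φ 0) =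
          (pairRate (s.1 z) (s.2 z) 0 : ℝ) * W t s := by
        simp only [pairRate, pairMove, Matrix.cons_val, W]
        rcases eq_or_ne (common (s.1 z) (s.2 z)) 0 with h | h
        · rw [h]; simp
        · rw [nucleate_eq, nucleate_eq, sign_eq_of_common_ne_zero h, add_sub_add_right_eq_sub]
      have m1 : W t (pairMove s z φ 1) ≤ W t s + off (flow (meanRate Φ) h t) z φ := by
        simp only [pairMove, Matrix.cons_val, W]
        rw [nucleate_eq, add_sub_right_comm]
        exact (wnorm_add_le (hfn t ht) _ _).trans
          (add_le_add le_rfl (wnorm_burst_le (hfn t ht) (abs_sign_le_one _) _ _))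
      have m2 : W t (pairMove s z φ 2) ≤ W t s + off (flow (meanRate Φ) h t) z φ := by
        simp only [pairMove, Matrix.cons_val, W]
        rw [nucleate_eq, ← sub_sub, sub_eq_add_neg _ (burst _ _ _)]
        refine (wnorm_add_le (hfn t ht) _ _).trans (add_le_add le_rfl ?_)
        rw [wnorm_neg]
        exact wnorm_burst_le (hfn t ht) (abs_sign_le_one _) _ _
      have e : ((s.1 z - s.2 z).natAbs : ℝ) = (pairRate (s.1 z) (s.2 z) 1 : ℝ) +
          (pairRate (s.1 z) (s.2 z) 2 : ℝ) := by
        rw [natAbs_sub_eq]; simp [pairRate]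
      rw [Fin.sum_univ_three, Fin.sum_univ_three, m0, e]
      have n1 := mul_le_mul_of_nonneg_left m1
        (Nat.cast_nonneg (α := ℝ) (pairRate (s.1 z) (s.2 z) 1))
      have n2 := mul_le_mul_of_nonneg_left m2
        (Nat.cast_nonneg (α := ℝ) (pairRate (s.1 z) (s.2 z) 2))
      linarith
    · exact (((hasSum_prob Φ).mul_right _).add ((hm.hasSum_off (hfn t ht) (hfB t ht) z).mul_left
        ((s.1 z - s.2 z).natAbs : ℝ))).congr_fun fun φ => by ring
    · have hsupp : (s.1 - s.2).support ⊆ sites s := by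
        classical exact Finsupp.support_sub
      rw [Finset.sum_add_distrib, total_pairUrn, Finset.sum_mul, add_comm, wnorm_eq_sum hsupp]
      simp [Nat.cast_natAbs]
  -- a multiple of the number of balls bounds the expected number of jumps
  have hexp : ∀ t : ℝ, 0 ≤ t → 0 ≤ Real.exp (c * t) - 1 := fun t ht =>
    sub_nonneg.2 (Real.one_le_exp (by positivity))
  let n : FinConfig d × FinConfig d → ℝ := fun s => ballCount s.1 + ballCount s.2
  have hn0 : ∀ s, 0 ≤ n s := fun s => by positivity
  have hV : ∀ t, 0 ≤ t → ∀ s, (pairUrn Φ).duhamel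
      (fun t s => 1 + ENNReal.ofReal (n s * (Real.exp (c * t) - 1))) t s ≤
      ENNReal.ofReal (n s * (Real.exp (c * t) - 1)) := by
    intro t ht s
    refine le_trans le_add_self ((pairUrn Φ).super_of_hasDerivAt
      (W := fun t s => n s * (Real.exp (c * t) - 1)) (D := fun t s => n s * (Real.exp (c * t) * c))
      (fun t _ s => by
        have h1 := ((hasDerivAt_id t).const_mul c).exp.sub_const 1
        simpa using h1.const_mul (n s))
      (fun s => by fun_prop) (fun s => by simp)
      (fun t ht s => by have := hexp t ht; have := hn0 s; positivity) (fun t ht s => ?_) ht s)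
    have he := hexp t ht
    set k := Real.exp (c * t) - 1 with hk
    have hFn : ∀ s, 0 ≤ 1 + n s * k := fun s => by have := hn0 s; positivity
    have e : ∀ s, 1 + ENNReal.ofReal (n s * k) = ENNReal.ofReal (1 + n s * k) := fun s => by
      rw [ENNReal.ofReal_add zero_le_one (mul_nonneg (hn0 s) he), ENNReal.ofReal_one]
    simp only [e]
    refine (gen_pairUrn_le (F := fun s => 1 + n s * k) hFn s
      (r := fun z φ => (∑ i, (pairRate (s.1 z) (s.2 z) i : ℝ)) * (1 + n s * k) +
        (∑ i, (pairRate (s.1 z) (s.2 z) i : ℝ)) * (2 * k) * size φ)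
      (ρ := fun z => 1 * ((∑ i, (pairRate (s.1 z) (s.2 z) i : ℝ)) * (1 + n s * k)) +
        (∑ i, (pairRate (s.1 z) (s.2 z) i : ℝ)) * (2 * k) * lam)
      (fun z φ => ?_) fun z => ?_).trans (ENNReal.ofReal_le_ofReal ?_)
    · have hmv : ∀ i, n (pairMove s z φ i) ≤ n s + 2 * size φ := by
        intro i
        have h1 := ballCount_nucleate_le s.1 z φ
        have h2 := ballCount_nucleate_le s.2 z φ
        have h3 : (0 : ℝ) ≤ size φ := Nat.cast_nonneg _
        fin_cases i <;> simp [pairMove, n] <;> linarith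
      rw [mul_assoc _ (2 * k), ← mul_add, Finset.sum_mul]
      refine Finset.sum_le_sum fun i _ => mul_le_mul_of_nonneg_left ?_ (Nat.cast_nonneg _)
      have := mul_le_mul_of_nonneg_right (hmv i) he
      linarith
    · exact (((hasSum_prob Φ).mul_right _).add (hm.hasSum_size.mul_left
        ((∑ i, (pairRate (s.1 z) (s.2 z) i : ℝ)) * (2 * k)))).congr_fun fun φ => by ring
    · simp only [Finset.sum_add_distrib, ← Finset.sum_mul, one_mul, ← total_pairUrn (Φ := Φ)]
      have hq := total_pairUrn_le (Φ := Φ) s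
      have h1 : (((pairUrn Φ).total s : ℝ≥0) : ℝ) * (1 + 2 * k * lam) ≤ n s * (1 + 2 * k * lam) :=
        mul_le_mul_of_nonneg_right hq (by positivity)
      have h2 : Real.exp (c * t) * c = (k + 1) * (1 + 2 * lam) := by rw [hk, sub_add_cancel]
      rw [h2]
      have h3 : 0 ≤ n s * (k + 2 * lam) := mul_nonneg (hn0 s) (by positivity)
      nlinarith
  have key := (pairUrn Φ).sub_le_super (U := fun t s => ENNReal.ofReal (U t s))
    (W := fun t s => ENNReal.ofReal (W t s)) (K := fun _ _ => 1)
    (V := fun t s => ENNReal.ofReal (n s * (Real.exp (c * t) - 1))) hsub hsuper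
    (fun t ht s => by
      rw [ENNReal.ofReal_le_one]
      simp only [U]
      linarith [hF1 t ht s.1, hF0 t s.2])
    (fun _ => measurable_const) hV (fun _ _ => ENNReal.ofReal_ne_top) ht (ζ, ζ')
  simp only [U, W] at key
  rwa [ENNReal.ofReal_sub _ (hF0 _ _), ← hF t ht, ← hF t ht, tsub_le_iff_left] at key

end Coupling

section Box

variable {d : ℕ} {Φ : PMF (Offspring d)} {p : unitInterval} {lam m2 : ℝ}

/-! ### The scheme started from a box -/

/-- The box `[-r, r]^d`. -/
noncomputable def box (d r : ℕ) : Finset (Lattice d) :=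
  Finset.Icc (fun _ => -(r : ℤ)) (fun _ => (r : ℤ))

lemma box_mono {r r' : ℕ} (h : r ≤ r') : box d r ⊆ box d r' := by
  have : (r : ℤ) ≤ r' := by exact_mod_cast h
  exact Finset.Icc_subset_Icc (fun _ => neg_le_neg this) fun _ => this

lemma tendsto_box : Tendsto (box d) atTop atTop := by
  refine tendsto_atTop_finset_of_monotone (fun _ _ h => box_mono h) fun x => ?_
  refine ⟨∑ i, (x i).natAbs, Finset.mem_Icc.2 ⟨fun i => ?_, fun i => ?_⟩⟩ <;>
  · have := Finset.single_le_sum (f := fun i => (x i).natAbs) (fun i _ => Nat.zero_le _)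
      (Finset.mem_univ i)
    dsimp only at this ⊢
    omega

lemma restrictBox_apply_of_mem {r : ℕ} {y : Lattice d} (hy : y ∈ box d r) (ζ : Config d) :
    restrictBox r ζ y = ζ y := Finsupp.indicator_of_mem hy _

lemma restrictBox_apply_of_notMem {r : ℕ} {y : Lattice d} (hy : y ∉ box d r) (ζ : Config d) :
    restrictBox r ζ y = 0 := Finsupp.indicator_of_notMem hy _

lemma support_restrictBox_subset (r : ℕ) (ζ : Config d) : (restrictBox r ζ).support ⊆ box d r :=
  Finsupp.support_indicator_subset _ _

lemma measurable_comp_restrictBox (r : ℕ) (F : FinConfig d → ℝ≥0∞) :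
    Measurable fun ζ : Config d => F (restrictBox r ζ) := by
  let _ : MeasurableSpace (FinConfig d) := ⊤
  refine (measurable_from_top (f := F)).comp (measurable_to_countable' fun η => ?_)
  have : restrictBox r ⁻¹' {η} = ⋂ y : Lattice d, {ζ : Config d | restrictBox r ζ y = η y} := by
    ext ζ; simp [Finsupp.ext_iff]
  rw [this]
  refine MeasurableSet.iInter fun y => ?_
  by_cases hy : y ∈ box d r
  · simp only [restrictBox_apply_of_mem hy]
    exact measurableSet_eq_fun (measurable_pi_apply y) measurable_const
  · simp only [restrictBox_apply_of_notMem hy]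
    exact MeasurableSet.const _

instance : IsProbabilityMeasure (bernoulliColouring d p) := by
  unfold bernoulliColouring; infer_instance

lemma ae_abs_eq_one : ∀ᵐ ζ ∂bernoulliColouring d p, ∀ y, |(ζ y : ℝ)| = 1 := by
  rw [ae_all_iff]
  intro y
  have hs : ∀ᵐ k : ℤ ∂(bernoulliMeasure (1 : ℤ) (-1) p), |(k : ℝ)| = 1 := by
    rw [ae_iff, bernoulliMeasure_apply_of_notMem_of_notMem] <;> simp
  have := (measurePreserving_eval_infinitePi (fun _ : Lattice d => bernoulliMeasure (1 : ℤ) (-1) p)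
    y).quasiMeasurePreserving.ae hs
  exact this

/-- The expectation of `G` of the configuration at time `t` of the scheme started from the
restriction to `[-r, r]^d` of a Bernoulli colouring. -/
noncomputable def boxMean (Φ : PMF (Offspring d)) (p : unitInterval) (r : ℕ) (t : ℝ)
    (G : FinConfig d → ℝ≥0∞) : ℝ≥0∞ :=
  ∫⁻ ζ, (urn Φ).semigroup G t (restrictBox r ζ) ∂(bernoulliColouring d p)

lemma boxProb_eq (r : ℕ) (t : ℝ) (A : Set (FinConfig d)) :
    boxProb Φ p r t A = boxMean Φ p r t (A.indicator 1) := by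
  simp only [boxProb, boxMean, transition_eq]

lemma boxMean_mono {G H : FinConfig d → ℝ≥0∞} (h : ∀ ζ, G ζ ≤ H ζ) (r : ℕ) (t : ℝ) :
    boxMean Φ p r t G ≤ boxMean Φ p r t H :=
  lintegral_mono fun _ => (urn Φ).semigroup_mono h _ _

lemma boxMean_const_mul {a : ℝ≥0∞} (ha : a ≠ ∞) (G : FinConfig d → ℝ≥0∞) (r : ℕ) (t : ℝ) :
    boxMean Φ p r t (fun ζ => a * G ζ) = a * boxMean Φ p r t G := by
  simp only [boxMean, (urn Φ).semigroup_const_mul ha]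
  exact lintegral_const_mul' _ _ ha

lemma boxMean_add (G H : FinConfig d → ℝ≥0∞) (r : ℕ) (t : ℝ) :
    boxMean Φ p r t (fun ζ => G ζ + H ζ) = boxMean Φ p r t G + boxMean Φ p r t H := by
  simp only [boxMean, (urn Φ).semigroup_add]
  exact lintegral_add_left (measurable_comp_restrictBox r _) _

lemma boxMean_tsum {ι : Type*} [Countable ι] (G : ι → FinConfig d → ℝ≥0∞) (r : ℕ) (t : ℝ) :
    boxMean Φ p r t (fun ζ => ∑' i, G i ζ) = ∑' i, boxMean Φ p r t (G i) := by
  simp only [boxMean, (urn Φ).semigroup_tsum]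
  exact lintegral_tsum fun i => (measurable_comp_restrictBox r _).aemeasurable

lemma boxMean_one (hm : OffspringMoments Φ lam m2) (r : ℕ) {t : ℝ} (ht : 0 ≤ t) :
    boxMean Φ p r t (fun _ => 1) = 1 := by
  simp [boxMean, urn_semigroup_one hm ht]

lemma boxMean_const (hm : OffspringMoments Φ lam m2) (r : ℕ) {t : ℝ} (ht : 0 ≤ t) {a : ℝ≥0∞}
    (ha : a ≠ ∞) : boxMean Φ p r t (fun _ => a) = a := by
  simpa [boxMean_one hm r ht] using boxMean_const_mul (Φ := Φ) (p := p) ha (fun _ => 1) r t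

/-- Two boxes which both contain the box of radius `N` give laws which differ by at most the mass
of the flow outside that box. -/
lemma boxMean_le_add (hm : OffspringMoments Φ lam m2) {h : Lattice d → ℝ} {B : ℝ}
    (h0 : ∀ y, 0 ≤ h y) (hB : ∀ y, h y ≤ B) {g : FinConfig d → ℝ≥0∞} (hg : ∀ ζ, g ζ ≤ 1)
    (hgh : ∀ ζ ζ', g ζ ≤ g ζ' + ENNReal.ofReal (wnorm h (ζ - ζ'))) {t : ℝ} (ht : 0 ≤ t)
    (hs : Summable (flow (meanRate Φ) h t)) {N r r' : ℕ} (hr : N ≤ r) (hr' : N ≤ r') :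
    boxMean Φ p r t g ≤ boxMean Φ p r' t g + ENNReal.ofReal
      (∑' y, flow (meanRate Φ) h t y - ∑ y ∈ box d N, flow (meanRate Φ) h t y) := by
  classical
  set w := flow (meanRate Φ) h t
  have hw : ∀ y, 0 ≤ w y := flow_nonneg meanRate_nonneg h0 ht
  set T := ENNReal.ofReal (∑' y, w y - ∑ y ∈ box d N, w y)
  calc boxMean Φ p r t g
      ≤ ∫⁻ ζ, ((urn Φ).semigroup g t (restrictBox r' ζ) + T) ∂(bernoulliColouring d p) := by
        refine lintegral_mono_ae (ae_abs_eq_one.mono fun ζ hζ => ?_)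
        refine (semigroup_le_add_wnorm hm h0 hB hg hgh ht _ (restrictBox r' ζ)).trans
          (add_le_add le_rfl (ENNReal.ofReal_le_ofReal ?_))
        set η := restrictBox r ζ - restrictBox r' ζ with hη
        have hval : ∀ y, |(η y : ℝ)| ≤ 1 := by
          intro y
          rw [hη, Finsupp.sub_apply]
          by_cases h1 : y ∈ box d r <;> by_cases h2 : y ∈ box d r' <;>
            simp [restrictBox_apply_of_mem, restrictBox_apply_of_notMem, h1, h2, hζ y]
        have hdisj : Disjoint η.support (box d N) := by
          rw [Finset.disjoint_left]
          intro y hy hyN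
          refine Finsupp.mem_support_iff.1 hy ?_
          rw [hη, Finsupp.sub_apply, restrictBox_apply_of_mem (box_mono hr hyN),
            restrictBox_apply_of_mem (box_mono hr' hyN), sub_self]
        have h1 : wnorm w η ≤ ∑ y ∈ η.support, w y :=
          Finset.sum_le_sum fun y _ => mul_le_of_le_one_left (hw y) (hval y)
        have h2 := hs.sum_le_tsum (η.support ∪ box d N) fun y _ => hw y
        rw [Finset.sum_union hdisj] at h2
        linarith
    _ = boxMean Φ p r' t g + T := by
        rw [lintegral_add_right _ measurable_const]
        simp [boxMean]

/-- The indicator function of a finite set of sites. -/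
noncomputable def siteWeight (F : Finset (Lattice d)) : Lattice d → ℝ :=
  (F : Set (Lattice d)).indicator 1

lemma siteWeight_nonneg (F : Finset (Lattice d)) (y : Lattice d) : 0 ≤ siteWeight F y :=
  Set.indicator_nonneg (fun _ _ => zero_le_one) y

lemma siteWeight_le_one (F : Finset (Lattice d)) (y : Lattice d) : siteWeight F y ≤ 1 :=
  Set.indicator_le_self' (fun _ _ => zero_le_one) y

lemma hasSum_siteWeight (F : Finset (Lattice d)) : HasSum (siteWeight F) F.card := by
  have : HasSum (siteWeight F) (∑ y ∈ F, siteWeight F y) := hasSum_sum_of_ne_finset_zero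
    fun y hy => by simp [siteWeight, hy]
  have e : ∑ y ∈ F, siteWeight F y = F.card := by
    rw [Finset.sum_congr rfl fun y hy => show siteWeight F y = 1 by simp [siteWeight, hy]]
    simp
  rwa [e] at this

lemma hasSum_flow_siteWeight (hm : OffspringMoments Φ lam m2) (F : Finset (Lattice d)) (t : ℝ) :
    HasSum (flow (meanRate Φ) (siteWeight F) t) (Real.exp (lam * t) * F.card) :=
  hasSum_flow meanRate_nonneg hm.hasSum_meanRate (siteWeight_nonneg F)
    (hasSum_siteWeight F) t

lemma abs_le_wnorm {F : Finset (Lattice d)} {x : Lattice d} (hx : x ∈ F) (ζ : FinConfig d) :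
    |(ζ x : ℝ)| ≤ wnorm (siteWeight F) ζ := by
  by_cases h : x ∈ ζ.support
  · have := Finset.single_le_sum (f := fun y => |(ζ y : ℝ)| * siteWeight F y)
      (fun y _ => mul_nonneg (abs_nonneg _) (siteWeight_nonneg F y)) h
    simpa [siteWeight, hx, wnorm, Finsupp.sum] using this
  · rw [Finsupp.notMem_support_iff.1 h]
    simpa using wnorm_nonneg (siteWeight_nonneg F) ζ

/-- Changing an event that depends on the sites in `F` only requires a discrepancy in `F`. -/
lemma indicator_le_add_wnorm {F : Finset (Lattice d)} {A : Set (FinConfig d)}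
    (hA : ∀ η η' : FinConfig d, (∀ x ∈ F, η x = η' x) → η ∈ A → η' ∈ A) (ζ ζ' : FinConfig d) :
    A.indicator (1 : FinConfig d → ℝ≥0∞) ζ ≤
      A.indicator 1 ζ' + ENNReal.ofReal (wnorm (siteWeight F) (ζ - ζ')) := by
  by_cases h : ζ ∈ A
  · by_cases h' : ζ' ∈ A
    · simp [h, h']
    · simp only [h, h', Set.indicator_of_mem, Set.indicator_of_notMem, not_false_eq_true, zero_add,
        Pi.one_apply, ENNReal.one_le_ofReal]
      obtain ⟨x, hx, hne⟩ : ∃ x ∈ F, ζ x ≠ ζ' x := by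
        by_contra! hcon
        exact h' (hA _ _ hcon h)
      refine le_trans ?_ (abs_le_wnorm hx _)
      rw [Finsupp.sub_apply, ← Int.cast_abs]
      exact_mod_cast Int.one_le_abs (sub_ne_zero.2 hne)
  · simp [h]

/-- The expected number of balls at a site is at most its value without annihilations. -/
lemma boxMean_abs_le (hm : OffspringMoments Φ lam m2) (r : ℕ) {t : ℝ} (ht : 0 ≤ t)
    (x : Lattice d) :
    boxMean Φ p r t (fun ζ => ENNReal.ofReal |(ζ x : ℝ)|) ≤
      ENNReal.ofReal (Real.exp (lam * t)) := by
  have hw : ∀ y, 0 ≤ flow (meanRate Φ) (siteWeight {x}) t y :=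
    flow_nonneg meanRate_nonneg (siteWeight_nonneg _) ht
  have hs := hasSum_flow_siteWeight hm {x} t
  rw [Finset.card_singleton, Nat.cast_one, mul_one] at hs
  refine (boxMean_mono (fun ζ => ENNReal.ofReal_le_ofReal
    (abs_le_wnorm (Finset.mem_singleton_self x) ζ)) r t).trans ?_
  refine (lintegral_mono_ae (g := fun _ => ENNReal.ofReal (Real.exp (lam * t)))
    (ae_abs_eq_one.mono fun ζ hζ => ?_)).trans (by simp)
  refine (semigroup_wnorm_le hm (siteWeight_nonneg _) (siteWeight_le_one _) ht _).trans
    (ENNReal.ofReal_le_ofReal ?_)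
  rw [wnorm_eq_sum (support_restrictBox_subset r ζ)]
  refine le_trans (Finset.sum_le_sum fun y hy => ?_) (sum_le_hasSum _ (fun y _ => hw y) hs)
  rw [restrictBox_apply_of_mem hy, hζ y, one_mul]

end Box

section Limit

variable {d : ℕ} {Φ : PMF (Offspring d)} {p : unitInterval} {lam m2 : ℝ}

/-! ### Existence of the scheme on the infinite lattice -/

/-- The law of the configuration at time `t` of the scheme started from a box. -/
noncomputable def boxLaw (Φ : PMF (Offspring d)) (p : unitInterval) (t : ℝ) (r : ℕ) :
    Measure (Config d) :=
  Measure.sum fun η : FinConfig d => boxProb Φ p r t {η} • Measure.dirac (η : Config d)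

lemma boxLaw_apply (t : ℝ) (r : ℕ) {s : Set (Config d)} (hs : MeasurableSet s) :
    boxLaw Φ p t r s = boxProb Φ p r t {η | (η : Config d) ∈ s} := by
  classical
  rw [boxLaw, Measure.sum_apply _ hs]
  have h : ({η | (η : Config d) ∈ s} : Set (FinConfig d)).indicator (1 : FinConfig d → ℝ≥0∞) =
      fun ζ => ∑' η : FinConfig d, s.indicator (1 : Config d → ℝ≥0∞) η *
        ({η} : Set (FinConfig d)).indicator 1 ζ := by
    funext ζ
    rw [tsum_eq_single ζ fun η hη => by simp [hη.symm]]
    simp [Set.indicator]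
  rw [boxProb_eq, h, boxMean_tsum]
  refine tsum_congr fun η => ?_
  rw [boxMean_const_mul (by by_cases h : (η : Config d) ∈ s <;> simp [h]), ← boxProb_eq,
    Measure.smul_apply, Measure.dirac_apply' _ hs, smul_eq_mul, mul_comm]

lemma isProbabilityMeasure_boxLaw (hm : OffspringMoments Φ lam m2) {t : ℝ} (ht : 0 ≤ t) (r : ℕ) :
    IsProbabilityMeasure (boxLaw Φ p t r) :=
  ⟨by rw [boxLaw_apply t r MeasurableSet.univ, boxProb_eq]
      exact (congrArg _ (Set.indicator_univ _)).trans (boxMean_one hm r ht)⟩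

/-- Markov's inequality for the number of balls at a site. -/
lemma boxLaw_abs_gt_le (hm : OffspringMoments Φ lam m2) {t : ℝ} (ht : 0 ≤ t) (r : ℕ)
    (x : Lattice d) (k : ℕ) :
    k * boxLaw Φ p t r {η | η x ∉ Set.Icc (-(k : ℤ)) k} ≤ ENNReal.ofReal (Real.exp (lam * t)) := by
  have hmeas : MeasurableSet {η : Config d | η x ∉ Set.Icc (-(k : ℤ)) k} :=
    (measurable_pi_apply x) (measurableSet_Icc.compl)
  rw [boxLaw_apply t r hmeas, boxProb_eq, ← boxMean_const_mul (ENNReal.natCast_ne_top k)]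
  refine (boxMean_mono (fun ζ => ?_) r t).trans (boxMean_abs_le hm r ht x)
  by_cases h : ζ x ∈ Set.Icc (-(k : ℤ)) k
  · rw [Set.indicator_of_notMem (by simpa using h)]
    simp
  · have : (k : ℝ) ≤ |(ζ x : ℝ)| := by
      rw [Set.mem_Icc, ← abs_le, not_le] at h
      rw [← Int.cast_abs]
      exact_mod_cast h.le
    rw [Set.indicator_of_mem (by exact h), Pi.one_apply, mul_one, ← ENNReal.ofReal_natCast]
    exact ENNReal.ofReal_le_ofReal this

lemma isTightMeasureSet_boxLaw (hm : OffspringMoments Φ lam m2) {t : ℝ} (ht : 0 ≤ t) :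
    IsTightMeasureSet (Set.range (boxLaw Φ p t)) := by
  rw [isTightMeasureSet_iff_exists_isCompact_measure_compl_le]
  intro ε hε
  obtain ⟨ε', hε', hsum⟩ := ENNReal.exists_pos_sum_of_countable hε.ne' (Lattice d)
  have hk : ∀ x : Lattice d, ∃ k : ℕ, Real.exp (lam * t) ≤ k * ε' x := fun x => by
    obtain ⟨k, hk⟩ := exists_nat_ge (Real.exp (lam * t) / ε' x)
    exact ⟨k, (div_le_iff₀ (NNReal.coe_pos.2 (hε' x))).1 hk⟩
  choose k hk using hk
  refine ⟨Set.pi Set.univ fun x => Set.Icc (-(k x : ℤ)) (k x),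
    isCompact_univ_pi fun x => isCompact_Icc, ?_⟩
  rintro _ ⟨r, rfl⟩
  have hK : (Set.pi Set.univ fun x => Set.Icc (-(k x : ℤ)) (k x))ᶜ =
      ⋃ x, {η : Config d | η x ∉ Set.Icc (-(k x : ℤ)) (k x)} := by
    ext η
    simp only [Set.mem_compl_iff, Set.mem_pi, Set.mem_univ, forall_const, not_forall,
      Set.mem_iUnion, Set.mem_ofPred_eq]
  rw [hK]
  refine (measure_iUnion_le _).trans (le_trans (ENNReal.tsum_le_tsum fun x => ?_) hsum.le)
  have hk0 : (k x : ℝ≥0∞) ≠ 0 := by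
    intro h
    have h' := hk x
    rw [Nat.cast_eq_zero.1 h, Nat.cast_zero, zero_mul] at h'
    exact absurd h' (not_le.2 (Real.exp_pos _))
  have h1 := (boxLaw_abs_gt_le (p := p) hm ht r x (k x)).trans (ENNReal.ofReal_le_ofReal (hk x))
  rw [ENNReal.ofReal_mul (Nat.cast_nonneg _), ENNReal.ofReal_natCast,
    ENNReal.ofReal_coe_nnreal] at h1
  exact (ENNReal.mul_le_mul_iff_right hk0 (ENNReal.natCast_ne_top _)).1 h1

/-- The scheme on the infinite lattice exists: the laws of the schemes started from boxes are tight,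
and by the coupling the probabilities of cylinder events converge. -/
theorem exists_isUrnLaw (hm : OffspringMoments Φ lam m2) {t : ℝ} (ht : 0 ≤ t) :
    ∃ ν, IsUrnLaw Φ p t ν := by
  let μ : ℕ → ProbabilityMeasure (Config d) := fun r =>
    ⟨boxLaw Φ p t r, isProbabilityMeasure_boxLaw hm ht r⟩
  have htight : IsTightMeasureSet
      {((ρ : ProbabilityMeasure (Config d)) : Measure (Config d)) | ρ ∈ Set.range μ} := by
    convert isTightMeasureSet_boxLaw (p := p) hm ht using 1
    ext ν
    constructor
    · rintro ⟨_, ⟨r, rfl⟩, rfl⟩; exact ⟨r, rfl⟩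
    · rintro ⟨r, rfl⟩; exact ⟨μ r, ⟨r, rfl⟩, rfl⟩
  have hcomp := isCompact_closure_of_isTightMeasureSet htight
  obtain ⟨ν, -, hν⟩ := isCompact_iff_ultrafilter_le_nhds.1 hcomp ((hyperfilter ℕ).map μ)
    (le_principal_iff.2 (Ultrafilter.mem_map.2 (mem_of_superset univ_mem
      fun r _ => subset_closure (Set.mem_range_self r))))
  refine ⟨ν, inferInstance, fun F a => ?_⟩
  set A : Set (Config d) := {η | ∀ x ∈ F, η x = a x} with hA
  have hclopen : IsClopen A := by
    have : A = ⋂ x ∈ F, (fun η : Config d => η x) ⁻¹' {a x} := by ext; simp [A]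
    rw [this]
    exact isClopen_biInter_finset fun x _ => (isClopen_discrete _).preimage (continuous_apply x)
  have hlim : Tendsto (fun r => boxProb Φ p r t {η | ∀ x ∈ F, η x = a x}) (hyperfilter ℕ)
      (𝓝 ((ν : Measure (Config d)) A)) := by
    have := ProbabilityMeasure.tendsto_measure_of_null_frontier_of_tendsto' (E := A)
      (show Tendsto μ (hyperfilter ℕ) (𝓝 ν) from hν) (by simp [hclopen.frontier_eq])
    refine this.congr fun r => ?_
    exact boxLaw_apply t r hclopen.isOpen.measurableSet
  set w := flow (meanRate Φ) (siteWeight F) t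
  have hs : HasSum w _ := hasSum_flow_siteWeight hm F t
  set e : ℕ → ℝ≥0∞ := fun N => ENNReal.ofReal (∑' y, w y - ∑ y ∈ box d N, w y)
  have he : Tendsto e atTop (𝓝 0) := by
    have h1 : Tendsto (fun N => ∑' y, w y - ∑ y ∈ box d N, w y) atTop (𝓝 0) := by
      have := (tendsto_const_nhds (x := ∑' y, w y)).sub (hs.summable.hasSum.comp tendsto_box)
      rwa [sub_self] at this
    simpa using ENNReal.tendsto_ofReal h1
  have hle : ∀ N r r', N ≤ r → N ≤ r' → boxProb Φ p r t {η | ∀ x ∈ F, η x = a x} ≤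
      boxProb Φ p r' t {η | ∀ x ∈ F, η x = a x} + e N := by
    intro N r r' hr hr'
    rw [boxProb_eq, boxProb_eq]
    have hA' : ∀ η η' : FinConfig d, (∀ x ∈ F, η x = η' x) →
        η ∈ {η : FinConfig d | ∀ x ∈ F, η x = a x} →
        η' ∈ {η : FinConfig d | ∀ x ∈ F, η x = a x} :=
      fun η η' h hη x hx => (h x hx).symm.trans (hη x hx)
    exact boxMean_le_add hm (siteWeight_nonneg F) (siteWeight_le_one F)
      (fun ζ => Set.indicator_le_self' (fun _ _ => by simp) ζ)
      (indicator_le_add_wnorm hA') ht hs.summable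
      hr hr'
  -- comparison along the ultrafilter upgrades its limit to the limit of the whole sequence
  have hev : ∀ N, ∀ᶠ r in (hyperfilter ℕ : Filter ℕ), N ≤ r := fun N =>
    Nat.hyperfilter_le_atTop (eventually_ge_atTop N)
  have h1 : ∀ N r, N ≤ r → boxProb Φ p r t {η | ∀ x ∈ F, η x = a x} ≤
      (ν : Measure (Config d)) A + e N := fun N r hr =>
    ge_of_tendsto (hlim.add_const (e N)) ((hev N).mono fun r' hr' => hle N r r' hr hr')
  have h2 : ∀ N r, N ≤ r → (ν : Measure (Config d)) A ≤
      boxProb Φ p r t {η | ∀ x ∈ F, η x = a x} + e N := fun N r hr =>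
    le_of_tendsto hlim ((hev N).mono fun r' hr' => hle N r' r hr' hr)
  refine tendsto_of_tendsto_of_tendsto_of_le_of_le
    (g := fun r => (ν : Measure (Config d)) A - e r)
    (h := fun r => (ν : Measure (Config d)) A + e r) ?_ ?_
    (fun r => tsub_le_iff_right.2 (h2 r r le_rfl)) (fun r => h1 r r le_rfl)
  · simpa using ENNReal.Tendsto.sub tendsto_const_nhds he (Or.inl (measure_ne_top _ A))
  · simpa using tendsto_const_nhds.add he

lemma isUrnLaw_urnLaw (hm : OffspringMoments Φ lam m2) {t : ℝ} (ht : 0 ≤ t) :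
    IsUrnLaw Φ p t (urnLaw Φ p t) := by
  have h : ∃ ν, IsUrnLaw Φ p t ν := exists_isUrnLaw hm ht
  rw [urnLaw, dif_pos h]
  exact h.choose_spec

end Limit

section Colouring

variable {d : ℕ}

/-! ### Moments of the balanced colouring -/

/-- Exchange of the two colours at the site `y`. -/
def flip (y : Lattice d) (ζ : Config d) : Config d := fun x => if x = y then -ζ x else ζ x

/-- The balanced colouring is invariant under the exchange of the colours at a site. -/
lemma measurePreserving_flip (y : Lattice d) :
    MeasurePreserving (flip y) (bernoulliColouring d half) (bernoulliColouring d half) := by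
  have hσ : unitInterval.symm half = half := by
    ext; simp only [unitInterval.coe_symm_eq, half]; norm_num
  have hneg : (bernoulliMeasure (1 : ℤ) (-1) half).map (fun k => -k) =
      bernoulliMeasure (1 : ℤ) (-1) half := by
    rw [map_bernoulliMeasure' _ _ measurable_neg, neg_neg, bernoulliMeasure_def,
      bernoulliMeasure_def, hσ, add_comm]
  have hf : ∀ x : Lattice d, Measurable fun k : ℤ => if x = y then -k else k := fun x =>
    Measurable.of_discrete
  refine ⟨measurable_pi_lambda _ fun x => (hf x).comp (measurable_pi_apply x), ?_⟩
  have h := Measure.infinitePi_map_pi (μ := fun _ : Lattice d => bernoulliMeasure (1 : ℤ) (-1) half)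
    (f := fun x k => if x = y then -k else k) hf
  refine h.trans ?_
  unfold bernoulliColouring
  congr 1
  funext x
  by_cases hx : x = y
  · simp only [hx, if_true]; exact hneg
  · simp only [hx, if_false]; exact Measure.map_id

/-- A random colour is uncorrelated with functions of the other colours. -/
lemma integral_mul_eq_zero {y : Lattice d} {G : Config d → ℝ} (hG : ∀ ζ, G (flip y ζ) = G ζ) :
    ∫ ζ, (ζ y : ℝ) * G ζ ∂bernoulliColouring d half = 0 := by
  have hmp := measurePreserving_flip y
  have hinv : flip y ∘ flip y = id := by
    funext ζ x; simp only [flip, Function.comp_apply, id]; split_ifs <;> simp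
  let e : Config d ≃ᵐ Config d :=
    { toFun := flip y, invFun := flip y, left_inv := congrFun hinv, right_inv := congrFun hinv,
      measurable_toFun := hmp.measurable, measurable_invFun := hmp.measurable }
  have h := hmp.integral_comp (f := flip y) e.measurableEmbedding
    (fun ζ => (ζ y : ℝ) * G ζ)
  have h2 : ∀ ζ : Config d, ((flip y ζ) y : ℝ) * G (flip y ζ) = -((ζ y : ℝ) * G ζ) := fun ζ => by
    rw [hG]; simp [flip]
  simp only [h2, integral_neg] at h
  linarith

/-- The Rademacher sum `∑ y ∈ s, ζ(y) w(y)`. -/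
noncomputable def colourSum (w : Lattice d → ℝ) (s : Finset (Lattice d)) (ζ : Config d) : ℝ :=
  ∑ y ∈ s, (ζ y : ℝ) * w y

lemma measurable_colourSum (w : Lattice d → ℝ) (s : Finset (Lattice d)) :
    Measurable (colourSum w s) := by
  unfold colourSum
  refine Finset.measurable_sum _ fun y _ => ?_
  exact ((Measurable.of_discrete (f := fun k : ℤ => (k : ℝ))).comp
    (measurable_pi_apply y)).mul_const _

lemma integrable_mul_colourSum_pow (w : Lattice d → ℝ) (s : Finset (Lattice d)) (y : Lattice d)
    (m k : ℕ) :
    Integrable (fun ζ : Config d => (ζ y : ℝ) ^ m * colourSum w s ζ ^ k)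
      (bernoulliColouring d half) := by
  refine Integrable.of_bound (C := (∑ y ∈ s, |w y|) ^ k) ?_ ?_
  · exact (Measurable.mul (((Measurable.of_discrete (f := fun k : ℤ => (k : ℝ))).comp
      (measurable_pi_apply y)).pow_const m)
      ((measurable_colourSum w s).pow_const k)).aestronglyMeasurable
  · refine ae_abs_eq_one.mono fun ζ hζ => ?_
    rw [norm_mul, norm_pow, norm_pow, Real.norm_eq_abs, Real.norm_eq_abs, hζ y, one_pow, one_mul]
    refine pow_le_pow_left₀ (abs_nonneg _) ((Finset.abs_sum_le_sum_abs _ _).trans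
      (Finset.sum_le_sum fun x _ => ?_)) k
    rw [abs_mul, hζ x, one_mul]

lemma integrable_colourSum_pow (w : Lattice d → ℝ) (s : Finset (Lattice d)) (k : ℕ) :
    Integrable (fun ζ => colourSum w s ζ ^ k) (bernoulliColouring d half) := by
  simpa using integrable_mul_colourSum_pow w s 0 0 k

lemma integral_colourSum (w : Lattice d → ℝ) (s : Finset (Lattice d)) :
    ∫ ζ, colourSum w s ζ ∂bernoulliColouring d half = 0 := by
  unfold colourSum
  rw [integral_finsetSum]
  · exact Finset.sum_eq_zero fun y _ => integral_mul_eq_zero (G := fun _ => w y) fun _ => rfl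
  · intro y _
    simpa [colourSum] using integrable_colourSum_pow w {y} 1

lemma integral_mul_colourSum_pow {w : Lattice d → ℝ} {s : Finset (Lattice d)} {y : Lattice d}
    (hy : y ∉ s) (k : ℕ) :
    ∫ ζ, (ζ y : ℝ) * colourSum w s ζ ^ k ∂bernoulliColouring d half = 0 := by
  refine integral_mul_eq_zero (G := fun ζ => colourSum w s ζ ^ k) fun ζ => ?_
  congr 1
  refine Finset.sum_congr rfl fun x hx => ?_
  simp [flip, ne_of_mem_of_not_mem hx hy]

/-- The second moment of a Rademacher sum, and the bound `E R⁴ ≤ 3 (E R²)²` for the fourth. -/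
lemma integral_colourSum_sq_and_pow_four (w : Lattice d → ℝ) (s : Finset (Lattice d)) :
    ∫ ζ, colourSum w s ζ ^ 2 ∂bernoulliColouring d half = ∑ y ∈ s, w y ^ 2 ∧
      ∫ ζ, colourSum w s ζ ^ 4 ∂bernoulliColouring d half ≤ 3 * (∑ y ∈ s, w y ^ 2) ^ 2 := by
  induction s using Finset.cons_induction with
  | empty => simp [colourSum]
  | cons y s hy ih =>
    obtain ⟨ih2, ih4⟩ := ih
    have hi := integrable_colourSum_pow w s
    have hiy := fun k => integrable_mul_colourSum_pow w s y 1 k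
    simp only [pow_one] at hiy
    have hz := fun k => integral_mul_colourSum_pow (w := w) hy k
    have hsq : ∀ ζ : Config d, |(ζ y : ℝ)| = 1 → (ζ y : ℝ) ^ 2 = 1 := fun ζ h => by
      rw [← sq_abs, h, one_pow]
    have e2 : ∫ ζ, colourSum w (Finset.cons y s hy) ζ ^ 2 ∂bernoulliColouring d half =
        w y ^ 2 + ∑ y ∈ s, w y ^ 2 := by
      calc _ = ∫ ζ, (w y ^ 2 + 2 * w y * ((ζ y : ℝ) * colourSum w s ζ ^ 1) +
            colourSum w s ζ ^ 2) ∂bernoulliColouring d half := by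
            refine integral_congr_ae (ae_abs_eq_one.mono fun ζ hζ => ?_)
            simp only [colourSum, Finset.sum_cons]
            linear_combination w y ^ 2 * hsq ζ (hζ y)
        _ = _ := by
            have i1 := (hiy 1).const_mul (2 * w y)
            rw [integral_add ((integrable_const _).fun_add i1) (hi 2),
              integral_add (integrable_const _) i1, integral_const_mul, hz, ih2]
            simp
    have e4 : ∫ ζ, colourSum w (Finset.cons y s hy) ζ ^ 4 ∂bernoulliColouring d half =
        w y ^ 4 + 6 * w y ^ 2 * ∑ y ∈ s, w y ^ 2 +
          ∫ ζ, colourSum w s ζ ^ 4 ∂bernoulliColouring d half := by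
      calc _ = ∫ ζ, (w y ^ 4 + 6 * w y ^ 2 * colourSum w s ζ ^ 2 + colourSum w s ζ ^ 4 +
            4 * w y ^ 3 * ((ζ y : ℝ) * colourSum w s ζ ^ 1) +
            4 * w y * ((ζ y : ℝ) * colourSum w s ζ ^ 3)) ∂bernoulliColouring d half := by
            refine integral_congr_ae (ae_abs_eq_one.mono fun ζ hζ => ?_)
            simp only [colourSum, Finset.sum_cons]
            have h2 := hsq ζ (hζ y)
            generalize (∑ x ∈ s, (ζ x : ℝ) * w x) = R
            generalize (ζ y : ℝ) = c at h2 ⊢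
            linear_combination (w y ^ 4 * (c ^ 2 + 1) + 4 * w y ^ 3 * c * R +
              6 * w y ^ 2 * R ^ 2) * h2
        _ = _ := by
            have i1 := (hi 2).const_mul (6 * w y ^ 2)
            have i3 := (hiy 1).const_mul (4 * w y ^ 3)
            have i4 := (hiy 3).const_mul (4 * w y)
            have i0 := integrable_const (μ := bernoulliColouring d half) (w y ^ 4)
            rw [integral_add (((i0.fun_add i1).fun_add (hi 4)).fun_add i3) i4,
              integral_add ((i0.fun_add i1).fun_add (hi 4)) i3,
              integral_add (i0.fun_add i1) (hi 4),
              integral_add i0 i1]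
            simp only [integral_const_mul, hz, ih2]
            simp
    rw [e2, e4, Finset.sum_cons]
    refine ⟨rfl, ?_⟩
    nlinarith [sq_nonneg (w y ^ 2)]

/-- **Khintchine's inequality** for the positive part of a Rademacher sum, from the pointwise bound
`u² - u⁴ / 6 ≤ u` for `u ≥ 0`. -/
lemma ofReal_sqrt_le_lintegral_colourSum (w : Lattice d → ℝ) (s : Finset (Lattice d)) :
    ENNReal.ofReal (√(∑ y ∈ s, w y ^ 2) / 4) ≤
      ∫⁻ ζ, ENNReal.ofReal (colourSum w s ζ) ∂bernoulliColouring d half := by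
  obtain ⟨h2, h4⟩ := integral_colourSum_sq_and_pow_four w s
  set V := ∑ y ∈ s, w y ^ 2 with hV
  have hV0 : 0 ≤ V := Finset.sum_nonneg fun y _ => sq_nonneg _
  rcases hV0.eq_or_lt with h0 | hpos
  · simp [← h0]
  set σ := √V
  have hσ : 0 < σ := Real.sqrt_pos.2 hpos
  have hσ2 : σ ^ 2 = V := Real.sq_sqrt hV0
  have hi := integrable_colourSum_pow w s
  have hi1 : Integrable (colourSum w s) (bernoulliColouring d half) := by simpa using hi 1
  set f : Config d → ℝ := fun ζ => colourSum w s ζ / 2 + (σ⁻¹ / 2 * colourSum w s ζ ^ 2 -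
    σ⁻¹ ^ 3 / 12 * colourSum w s ζ ^ 4)
  have hf : ∀ ζ, f ζ ≤ max (colourSum w s ζ) 0 := by
    intro ζ
    set R := colourSum w s ζ
    have hu : ∀ u : ℝ, 0 ≤ u → u ^ 2 - u ^ 4 / 6 ≤ u := fun u hu => by
      -- `1 - u + u³ / 6` is positive, with its minimum at `√2 ≈ 1.4`
      nlinarith [mul_nonneg hu (sq_nonneg (u - 1.4)), mul_nonneg (mul_nonneg hu hu)
        (sq_nonneg (u - 1.4)), sq_nonneg (u ^ 2 - 1.4 * u)]
    have h1 := hu (σ⁻¹ * |R|) (by positivity)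
    have h3 := mul_le_mul_of_nonneg_left h1 hσ.le
    have e : σ * ((σ⁻¹ * |R|) ^ 2 - (σ⁻¹ * |R|) ^ 4 / 6) = σ⁻¹ * R ^ 2 - σ⁻¹ ^ 3 / 6 * R ^ 4 := by
      have e4 : |R| ^ 4 = R ^ 4 := by rw [pow_abs, abs_of_nonneg (by positivity)]
      rw [mul_pow, mul_pow, sq_abs, e4]
      field_simp
    rw [e, mul_inv_cancel_left₀ hσ.ne'] at h3
    have h5 : max R 0 = (R + |R|) / 2 := by
      rcases le_total 0 R with h | h
      · rw [max_eq_left h, abs_of_nonneg h]; ring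
      · rw [max_eq_right h, abs_of_nonpos h]; ring
    rw [h5]
    simp only [f]
    linarith
  have hfi : Integrable f (bernoulliColouring d half) :=
    (hi1.div_const 2).add (((hi 2).const_mul _).sub ((hi 4).const_mul _))
  have hint : σ / 4 ≤ ∫ ζ, f ζ ∂bernoulliColouring d half := by
    have i24 : Integrable (fun ζ => σ⁻¹ / 2 * colourSum w s ζ ^ 2 -
        σ⁻¹ ^ 3 / 12 * colourSum w s ζ ^ 4) (bernoulliColouring d half) :=
      ((hi 2).const_mul _).sub ((hi 4).const_mul _)
    simp only [f]
    rw [integral_add (hi1.div_const 2) i24,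
      integral_sub ((hi 2).const_mul _) ((hi 4).const_mul _), integral_const_mul,
      integral_const_mul, integral_div, integral_colourSum, h2]
    have : σ⁻¹ ^ 3 / 12 * ∫ ζ, colourSum w s ζ ^ 4 ∂bernoulliColouring d half ≤
        σ⁻¹ ^ 3 / 12 * (3 * V ^ 2) := mul_le_mul_of_nonneg_left h4 (by positivity)
    have e1 : σ⁻¹ / 2 * V = σ / 2 := by rw [← hσ2]; field_simp
    have e2 : σ⁻¹ ^ 3 / 12 * (3 * V ^ 2) = σ / 4 := by rw [← hσ2]; field_simp; norm_num
    linarith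
  calc ENNReal.ofReal (σ / 4)
      ≤ ENNReal.ofReal (∫ ζ, max (colourSum w s ζ) 0 ∂bernoulliColouring d half) :=
        ENNReal.ofReal_le_ofReal (hint.trans (integral_mono hfi hi1.pos_part hf))
    _ = ∫⁻ ζ, ENNReal.ofReal (max (colourSum w s ζ) 0) ∂bernoulliColouring d half :=
        ofReal_integral_eq_lintegral_ofReal hi1.pos_part (ae_of_all _ fun _ => le_max_right _ _)
    _ = _ := by simp [ENNReal.ofReal_max]

lemma lintegral_colourSum_sq (w : Lattice d → ℝ) (s : Finset (Lattice d)) :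
    ∫⁻ ζ, ENNReal.ofReal (colourSum w s ζ ^ 2) ∂bernoulliColouring d half =
      ENNReal.ofReal (∑ y ∈ s, w y ^ 2) := by
  rw [← (integral_colourSum_sq_and_pow_four w s).1, ofReal_integral_eq_lintegral_ofReal
    (integrable_colourSum_pow w s 2) (ae_of_all _ fun _ => sq_nonneg _)]

lemma lin_restrictBox (w : Lattice d → ℝ) (r : ℕ) (ζ : Config d) :
    lin w (restrictBox r ζ) = colourSum w (box d r) ζ := by
  rw [lin, Finsupp.sum_of_support_subset _ (support_restrictBox_subset r ζ) _ (by simp)]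
  exact Finset.sum_congr rfl fun y hy => by rw [restrictBox_apply_of_mem hy]

lemma wnorm_restrictBox {w : Lattice d → ℝ} (r : ℕ) {ζ : Config d} (hζ : ∀ y, |(ζ y : ℝ)| = 1) :
    wnorm w (restrictBox r ζ) = ∑ y ∈ box d r, w y := by
  rw [wnorm_eq_sum (support_restrictBox_subset r ζ)]
  exact Finset.sum_congr rfl fun y hy => by rw [restrictBox_apply_of_mem hy, hζ, one_mul]

end Colouring

section Origin

variable {d : ℕ} {Φ : PMF (Offspring d)} {lam m2 : ℝ}

/-! ### The number of balls at the origin -/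

lemma lin_delta (ζ : FinConfig d) : lin (delta d) ζ = ζ 0 := by
  have : lin (delta d) ζ = ζ.sum fun y n => if y = 0 then (n : ℝ) else 0 := by
    simp [lin, delta]
  rw [this, Finsupp.sum_ite_eq']
  split_ifs with h
  · rfl
  · simp [Finsupp.notMem_support_iff.1 h]

lemma boxMean_origin_ge (hm : OffspringMoments Φ lam m2) (r : ℕ) {t : ℝ} (ht : 0 ≤ t) :
    ENNReal.ofReal (√(∑ y ∈ box d r, flow (meanRate Φ) (delta d) t y ^ 2) / 4) ≤
      boxMean Φ half r t fun ζ => ENNReal.ofReal (ζ 0 : ℝ) := by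
  refine (ofReal_sqrt_le_lintegral_colourSum _ _).trans (lintegral_mono fun ζ => ?_)
  dsimp only
  rw [← lin_restrictBox]
  simpa only [lin_delta] using
    ofReal_lin_flow_le hm delta_nonneg delta_le_one ht (restrictBox r ζ)

lemma boxMean_origin_sq_le (hd : 1 ≤ d) (hm : OffspringMoments Φ lam m2) (hl : 0 < lam) {C : ℝ}
    (hC : 0 < C) (hw : ∀ t, 0 ≤ t → ∀ y,
      flow (meanRate Φ) (delta d) t y ≤ C * heatBound d lam (d / lam) t) (r : ℕ)
    {t : ℝ} (ht : 0 ≤ t) :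
    boxMean Φ half r t (fun ζ => ENNReal.ofReal ((ζ 0 : ℝ) ^ 2)) ≤
      ENNReal.ofReal ((1 + 2 * m2 / lam) * C * (heatBound d lam (d / lam) t *
        Real.exp (lam * t))) := by
  set w := flow (meanRate Φ) (delta d) t with hwdef
  set N := flow (meanRate Φ) (conv (biasedRate Φ) (delta d)) t with hNdef
  have hdpos : (0 : ℝ) < d := by exact_mod_cast hd
  have hH : 0 < heatBound d lam (d / lam) t := heatBound_pos (by positivity) ht
  set H := heatBound d lam (d / lam) t
  have hw0 : ∀ y, 0 ≤ w y := flow_nonneg meanRate_nonneg delta_nonneg ht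
  have hν0 : ∀ y, 0 ≤ conv (biasedRate Φ) (delta d) y := conv_nonneg biasedRate_nonneg delta_nonneg
  have hN0 : ∀ y, 0 ≤ N y := flow_nonneg meanRate_nonneg hν0 ht
  have hws : HasSum w (Real.exp (lam * t) * 1) :=
    hasSum_flow meanRate_nonneg hm.hasSum_meanRate delta_nonneg hasSum_delta t
  have hNs : HasSum N (Real.exp (lam * t) * (m2 ^ 1 * 1)) :=
    hasSum_flow meanRate_nonneg hm.hasSum_meanRate hν0
      (hasSum_iterate_conv biasedRate_nonneg hm.hasSum_biasedRate delta_nonneg hasSum_delta 1) t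
  have hsq : ∑ y ∈ box d r, w y ^ 2 ≤ C * H * Real.exp (lam * t) := by
    calc ∑ y ∈ box d r, w y ^ 2 ≤ ∑ y ∈ box d r, C * H * w y :=
          Finset.sum_le_sum fun y _ => by
            rw [sq]; exact mul_le_mul_of_nonneg_right (hw t ht y) (hw0 y)
      _ = C * H * ∑ y ∈ box d r, w y := by rw [Finset.mul_sum]
      _ ≤ C * H * Real.exp (lam * t) := by
          have := sum_le_hasSum (box d r) (fun y _ => hw0 y) hws
          rw [mul_one] at this
          gcongr
  have hsN : ∑ y ∈ box d r, N y ≤ Real.exp (lam * t) * m2 := by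
    simpa using sum_le_hasSum (box d r) (fun y _ => hN0 y) hNs
  calc boxMean Φ half r t (fun ζ => ENNReal.ofReal ((ζ 0 : ℝ) ^ 2))
      ≤ ∫⁻ ζ, (ENNReal.ofReal (colourSum w (box d r) ζ ^ 2) +
          ENNReal.ofReal (2 * C / lam * H * ∑ y ∈ box d r, N y)) ∂bernoulliColouring d half := by
        refine lintegral_mono_ae (ae_abs_eq_one.mono fun ζ hζ => ?_)
        have := semigroup_sq_le hd hm hl hC hw ht (restrictBox r ζ)
        simp only [lin_delta] at this
        refine this.trans (ENNReal.ofReal_add_le.trans ?_)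
        rw [lin_restrictBox, wnorm_restrictBox r hζ]
    _ = ENNReal.ofReal (∑ y ∈ box d r, w y ^ 2) +
          ENNReal.ofReal (2 * C / lam * H * ∑ y ∈ box d r, N y) := by
        rw [lintegral_add_right _ measurable_const, lintegral_colourSum_sq]
        simp
    _ ≤ _ := by
        rw [← ENNReal.ofReal_add (Finset.sum_nonneg fun y _ => sq_nonneg _)
          (mul_nonneg (by positivity) (Finset.sum_nonneg fun y _ => hN0 y))]
        refine ENNReal.ofReal_le_ofReal ?_
        have h1 : 2 * C / lam * H * ∑ y ∈ box d r, N y ≤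
            2 * C / lam * H * (Real.exp (lam * t) * m2) :=
          mul_le_mul_of_nonneg_left hsN (by positivity)
        have h2 : (1 + 2 * m2 / lam) * C * (H * Real.exp (lam * t)) =
            C * H * Real.exp (lam * t) + 2 * C / lam * H * (Real.exp (lam * t) * m2) := by
          field_simp
        rw [h2]
        exact add_le_add hsq h1

/-- **Paley–Zygmund inequality**, in the form that a random variable whose positive part has mean at
least `m` lies in `(a, M]` with positive probability, for any `M ≥ K`. It follows from the pointwise
bound `z⁺ ≤ a + z² / K + (K / 2) 1_{a < z ≤ M}`; the cutoff `M` makes the event one about finitely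
many values, to which convergence in law applies. -/
lemma paleyZygmund (hm : OffspringMoments Φ lam m2) {r : ℕ} {t : ℝ} (ht : 0 ≤ t)
    {m v a K : ℝ} {M : ℤ} (ha : 0 ≤ a) (hK : 0 < K) (hKM : K ≤ M) (hv0 : 0 ≤ v)
    (h1 : ENNReal.ofReal m ≤ boxMean Φ half r t fun ζ => ENNReal.ofReal (ζ 0 : ℝ))
    (h2 : boxMean Φ half r t (fun ζ => ENNReal.ofReal ((ζ 0 : ℝ) ^ 2)) ≤ ENNReal.ofReal v) :
    ENNReal.ofReal (2 / K * (m - a - v / K)) ≤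
      boxProb Φ half r t {η | a < (η 0 : ℝ) ∧ η 0 ≤ M} := by
  set A : Set (FinConfig d) := {η | a < (η 0 : ℝ) ∧ η 0 ≤ M}
  have hpt : ∀ ζ : FinConfig d, ENNReal.ofReal (ζ 0 : ℝ) ≤ ENNReal.ofReal a +
      (ENNReal.ofReal K⁻¹ * ENNReal.ofReal ((ζ 0 : ℝ) ^ 2) +
        ENNReal.ofReal (K / 2) * A.indicator 1 ζ) := by
    intro ζ
    set z : ℝ := (ζ 0 : ℝ) with hz
    rw [← ENNReal.ofReal_mul (by positivity)]
    rcases le_or_gt z a with h | h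
    · exact (ENNReal.ofReal_le_ofReal h).trans le_self_add
    refine le_trans ?_ le_add_self
    by_cases h' : ζ 0 ≤ M
    · have hA : ζ ∈ A := ⟨h, h'⟩
      rw [Set.indicator_of_mem hA, Pi.one_apply, mul_one,
        ← ENNReal.ofReal_add (by positivity) (by positivity)]
      refine ENNReal.ofReal_le_ofReal ?_
      have e : K⁻¹ * z ^ 2 + K / 2 - z = K⁻¹ * ((z - K / 2) ^ 2 + K ^ 2 / 4) := by field_simp; ring
      have : 0 ≤ K⁻¹ * ((z - K / 2) ^ 2 + K ^ 2 / 4) := by positivity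
      linarith
    · refine le_trans (ENNReal.ofReal_le_ofReal ?_) le_self_add
      have hMz : (M : ℝ) < z := by rw [hz]; exact_mod_cast not_le.1 h'
      have hKz : K ≤ z := hKM.trans hMz.le
      rw [← div_eq_inv_mul, le_div_iff₀ hK, sq]
      exact mul_le_mul_of_nonneg_left hKz (hK.le.trans hKz)
  have h3 := h1.trans (boxMean_mono hpt r t)
  rw [boxMean_add, boxMean_add, boxMean_const hm r ht ENNReal.ofReal_ne_top,
    boxMean_const_mul ENNReal.ofReal_ne_top, boxMean_const_mul ENNReal.ofReal_ne_top,
    ← boxProb_eq] at h3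
  have hp1 : boxProb Φ half r t A ≤ 1 := by
    rw [boxProb_eq, ← boxMean_one (Φ := Φ) (p := half) hm r ht]
    exact boxMean_mono (fun ζ => Set.indicator_le_self' (fun _ _ => by simp) ζ) r t
  have hpt' : boxProb Φ half r t A ≠ ∞ := ne_top_of_le_ne_top ENNReal.one_ne_top hp1
  rw [← ENNReal.ofReal_toReal hpt'] at h3 ⊢
  set P := (boxProb Φ half r t A).toReal
  have hP : 0 ≤ P := ENNReal.toReal_nonneg
  have h4 : ENNReal.ofReal m ≤ ENNReal.ofReal (a + (K⁻¹ * v + K / 2 * P)) := by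
    rw [ENNReal.ofReal_add ha (by positivity), ENNReal.ofReal_add (by positivity) (by positivity),
      ENNReal.ofReal_mul (by positivity), ENNReal.ofReal_mul (by positivity)]
    exact h3.trans (by gcongr)
  rw [ENNReal.ofReal_le_ofReal_iff (by positivity)] at h4
  refine ENNReal.ofReal_le_ofReal ?_
  rw [div_mul_eq_mul_div, div_le_iff₀ hK, div_eq_inv_mul v K]
  linarith

/-- The probability that the number of balls at the origin lies in a bounded set is the limit of
the same probabilities for the schemes started from boxes. -/
lemma tendsto_boxProb_origin {p : unitInterval} {t : ℝ} {ν : Measure (Config d)}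
    (hν : IsUrnLaw Φ p t ν) (S : Finset ℤ) :
    Tendsto (fun r => boxProb Φ p r t {η | η 0 ∈ S}) atTop (𝓝 (ν {η | η 0 ∈ S})) := by
  have h1 : ∀ r, boxProb Φ p r t {η | η 0 ∈ S} =
      ∑ k ∈ S, boxProb Φ p r t {η | ∀ x ∈ ({0} : Finset (Lattice d)), η x = (fun _ => k) x} := by
    intro r
    have e : ({η | η 0 ∈ S} : Set (FinConfig d)).indicator (1 : FinConfig d → ℝ≥0∞) = fun ζ =>
        ∑' k : S, ({η | ∀ x ∈ ({0} : Finset (Lattice d)), η x = k} :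
          Set (FinConfig d)).indicator 1 ζ := by
      funext ζ
      rw [tsum_fintype, Finset.sum_coe_sort S fun k : ℤ =>
        ({η | ∀ x ∈ ({0} : Finset (Lattice d)), η x = k} : Set (FinConfig d)).indicator
          (1 : FinConfig d → ℝ≥0∞) ζ]
      simp [Set.indicator]
    simp only [boxProb_eq]
    rw [e, boxMean_tsum, tsum_fintype, Finset.sum_coe_sort S fun k : ℤ => boxMean Φ p r t
      (({η | ∀ x ∈ ({0} : Finset (Lattice d)), η x = k} : Set (FinConfig d)).indicator 1)]
  have h2 : ν {η | η 0 ∈ S} =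
      ∑ k ∈ S, ν {η | ∀ x ∈ ({0} : Finset (Lattice d)), η x = (fun _ => k) x} := by
    have e : ({η | η 0 ∈ S} : Set (Config d)) =
        ⋃ k ∈ S, {η | ∀ x ∈ ({0} : Finset (Lattice d)), η x = (fun _ => k) x} := by
      ext η; simp
    rw [e, measure_biUnion_finset]
    · intro k _ l _ hkl
      refine Set.disjoint_left.2 fun η hη hη' => hkl ?_
      simp only [Finset.mem_singleton, forall_eq, Set.mem_ofPred_eq] at hη hη'
      exact hη.symm.trans hη'
    · intro k _
      simp only [Finset.mem_singleton, forall_eq]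
      exact measurableSet_eq_fun (measurable_pi_apply 0) measurable_const
  simp only [h1, h2]
  exact tendsto_finsetSum S fun k _ => hν.2 {0} fun _ => k

/-- At time `t` the number of balls at the origin is of order `e^{λt} t^{-d/4}`, or larger, with
probability bounded below. -/
theorem exists_lt_urnLaw_origin (hd : 1 ≤ d) (hirr : Irreducible Φ)
    (hdisp2 : expectation Φ (fun φ => displacement 2 φ) < ∞)
    (hsecond : expectation Φ (fun φ => (size φ : ℝ) ^ 2) < ∞) :
    ∃ c : ℝ, 0 < c ∧ ∀ t : ℝ, 1 / c < t →
      (urnLaw Φ half t).real {η | Real.exp (-(meanOffspring Φ * t)) * (η 0 : ℝ) >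
        c * t ^ (-(d : ℝ) / 4)} > c := by
  obtain ⟨m2, hm⟩ := exists_offspringMoments hdisp2 hsecond
  set lam := meanOffspring Φ
  have hl : 0 < lam := mean_pos hd hm hirr
  have hdpos : (0 : ℝ) < d := by exact_mod_cast hd
  obtain ⟨C, hC, hw⟩ := exists_flow_le meanRate_nonneg hm.hasSum_meanRate
    (closure_meanKernel_pos hm hirr) (T := d / lam) (by positivity)
  have hw' : ∀ t, 0 ≤ t → ∀ y,
      flow (meanRate Φ) (delta d) t y ≤ C * heatBound d lam (d / lam) t := fun t ht y => by
    rw [heatBound, ← mul_assoc]; exact hw t ht y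
  obtain ⟨c₁, hc₁, hlow⟩ := exists_le_tsum_flow_sq meanRate_nonneg hm.hasSum_meanRate
    hm.summable_displacement
  have hm2 := hm.second_nonneg
  -- the mean of the positive part has order at least `κ X`, the second moment at most `K₂ X²`,
  -- where `X = e^{λt} t^{-d/4}`
  set κ := √(c₁ / 2) / 4
  have hκ : 0 < κ := by positivity
  set K₂ := (1 + 2 * m2 / lam) * C
  have hK₂ : 0 < K₂ := by positivity
  set c := min (min 1 (κ / 4)) (κ ^ 2 / (8 * K₂))
  have hc : 0 < c := by positivity
  have hcκ : c ≤ κ / 4 := (min_le_left _ _).trans (min_le_right _ _)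
  have hc1 : c ≤ 1 := (min_le_left _ _).trans (min_le_left _ _)
  have hcp : c < κ ^ 2 / (4 * K₂) := by
    refine (min_le_right _ _).trans_lt ?_
    exact div_lt_div_of_pos_left (by positivity) (by positivity) (by linarith)
  refine ⟨c, hc, fun t hct => ?_⟩
  have ht1 : 1 ≤ t := ((one_le_div hc).2 hc1).trans hct.le
  have ht0 : 0 < t := by linarith
  set X := Real.exp (lam * t) * t ^ (-(d : ℝ) / 4)
  have hX : 0 < X := by positivity
  have hpow : (t ^ (-(d : ℝ) / 4)) ^ 2 = t ^ (-(d : ℝ) / 2) := by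
    rw [← Real.rpow_mul_natCast ht0.le]; congr 1; push_cast; ring
  have hX2 : X ^ 2 = Real.exp (2 * lam * t) * t ^ (-(d : ℝ) / 2) := by
    rw [mul_pow, hpow, ← Real.exp_nat_mul]; congr 2; push_cast; ring
  have hν : IsUrnLaw Φ half t (urnLaw Φ half t) := isUrnLaw_urnLaw hm ht0.le
  have := hν.1
  set K := 4 * K₂ / κ * X
  have hK : 0 < K := by positivity
  obtain ⟨M, hM⟩ := exists_nat_ge K
  -- the first moment of the positive part, in large boxes
  have hsum := (hasSum_flow_sq (d := d) (meanRate_nonneg (Φ := Φ)) hm.hasSum_meanRate t).summable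
  have hev : ∀ᶠ r in atTop, c₁ / 2 * X ^ 2 <
      ∑ y ∈ box d r, flow (meanRate Φ) (delta d) t y ^ 2 := by
    refine (hsum.hasSum.comp tendsto_box).eventually (lt_mem_nhds ?_)
    refine lt_of_lt_of_le ?_ (hlow t ht1)
    rw [mul_assoc c₁, ← hX2]
    have := mul_pos hc₁ (pow_pos hX 2)
    linarith
  have hsecondMoment : ∀ r, boxMean Φ half r t (fun ζ => ENNReal.ofReal ((ζ 0 : ℝ) ^ 2)) ≤
      ENNReal.ofReal (K₂ * X ^ 2) := fun r => by
    refine (boxMean_origin_sq_le hd hm hl hC hw' r ht0.le).trans (ENNReal.ofReal_le_ofReal ?_)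
    refine mul_le_mul_of_nonneg_left ?_ hK₂.le
    have h1 : heatBound d lam (d / lam) t ≤ Real.exp (lam * t) * t ^ (-(d : ℝ) / 2) := by
      refine mul_le_mul_of_nonneg_left ?_ (Real.exp_nonneg _)
      refine Real.rpow_le_rpow_of_nonpos ht0 ?_ (by linarith)
      have : 0 < (d : ℝ) / lam := by positivity
      linarith
    calc heatBound d lam (d / lam) t * Real.exp (lam * t)
        ≤ Real.exp (lam * t) * t ^ (-(d : ℝ) / 2) * Real.exp (lam * t) := by gcongr
      _ = X ^ 2 := by rw [mul_pow, hpow]; ring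
  have hbox : ∀ᶠ r in atTop, ENNReal.ofReal (κ ^ 2 / (4 * K₂)) ≤
      boxProb Φ half r t {η | κ / 4 * X < (η 0 : ℝ) ∧ η 0 ≤ (M : ℤ)} := by
    filter_upwards [hev] with r hr
    have hfirst : ENNReal.ofReal (κ * X) ≤
        boxMean Φ half r t fun ζ => ENNReal.ofReal (ζ 0 : ℝ) := by
      refine le_trans (ENNReal.ofReal_le_ofReal ?_) (boxMean_origin_ge hm r ht0.le)
      have h1 := Real.sqrt_le_sqrt hr.le
      rw [Real.sqrt_mul (by positivity), Real.sqrt_sq hX.le] at h1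
      simp only [κ]
      linarith
    refine le_trans (le_of_eq ?_) (paleyZygmund hm ht0.le (a := κ / 4 * X) (by positivity) hK
      (M := (M : ℤ)) (by exact_mod_cast hM) (by positivity) hfirst (hsecondMoment r))
    congr 1
    simp only [K]
    field_simp
    ring
  classical
  set S : Finset ℤ := (Finset.Icc 0 (M : ℤ)).filter fun k => κ / 4 * X < (k : ℝ)
  have hS : ∀ r, boxProb Φ half r t {η | κ / 4 * X < (η 0 : ℝ) ∧ η 0 ≤ (M : ℤ)} =
      boxProb Φ half r t {η | η 0 ∈ S} := fun r => by
    congr 1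
    ext η
    simp only [S, Finset.mem_filter, Finset.mem_Icc, Set.mem_ofPred_eq]
    refine ⟨fun h => ⟨⟨?_, h.2⟩, h.1⟩, fun h => ⟨h.2, h.1.2⟩⟩
    have : (0 : ℝ) < (η 0 : ℝ) := lt_trans (by positivity) h.1
    exact_mod_cast this.le
  simp only [hS] at hbox
  have hlim := ge_of_tendsto (tendsto_boxProb_origin hν S) hbox
  have hreal : κ ^ 2 / (4 * K₂) ≤ (urnLaw Φ half t).real {η | η 0 ∈ S} :=
    (ENNReal.ofReal_le_iff_le_toReal (measure_ne_top _ _)).1 hlim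
  refine lt_of_lt_of_le hcp (hreal.trans (measureReal_mono fun η hη => ?_))
  have hη' : κ / 4 * X < (η 0 : ℝ) := (Finset.mem_filter.1 (show η 0 ∈ S from hη)).2
  have h1 : c * X < (η 0 : ℝ) := lt_of_le_of_lt (mul_le_mul_of_nonneg_right hcκ hX.le) hη'
  have h2 := mul_lt_mul_of_pos_left h1 (Real.exp_pos (-(lam * t)))
  have h3 : Real.exp (-(lam * t)) * (c * X) = c * t ^ (-(d : ℝ) / 4) := by
    have : Real.exp (-(lam * t)) * Real.exp (lam * t) = 1 := by rw [← Real.exp_add]; simp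
    calc _ = c * (Real.exp (-(lam * t)) * Real.exp (lam * t)) * t ^ (-(d : ℝ) / 4) := by
          simp only [X]; ring
      _ = _ := by rw [this, mul_one]
  rw [h3] at h2
  exact h2

end Origin

end UrnScheme

theorem proposition5p1 (d : ℕ) (hd : 1 ≤ d) (Φ : PMF (UrnScheme.Offspring d))
    (hirr : UrnScheme.Irreducible Φ)
    (hdisp1 : UrnScheme.expectation Φ (fun φ => UrnScheme.displacement 1 φ ^ 2) < ∞)
    (hdisp2 : UrnScheme.expectation Φ (fun φ => UrnScheme.displacement 2 φ) < ∞)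
    (hsecond : UrnScheme.expectation Φ (fun φ => (UrnScheme.size φ : ℝ) ^ 2) < ∞) :
    ∃ c : ℝ, 0 < c ∧ ∀ t : ℝ, 1 / c < t →
      (UrnScheme.urnLaw Φ UrnScheme.half t).real
        {η | Real.exp (-(UrnScheme.meanOffspring Φ * t)) * (η 0 : ℝ) >
          c * t ^ (-(d : ℝ) / 4)} > c :=
  UrnScheme.exists_lt_urnLaw_origin hd hirr hdisp2 hsecond
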